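/- **Setting.** Let $k\ge 0$ be fixed. For $n=1,2,\dots$ let $T=T_n$, $p=p_n$ be integers with $T,p\to\infty$, and let $p$ variables be partitioned into $J$ known groups of sizes $p_1,\dots,p_J$. Suppose that $y_t=\mathbf B G_t+\boldsymbol\Lambda F_t+u_t$, $t=1,\dots,T$, where $\mathbf B$ is $p\times k$, $\boldsymbol\Lambda=\mathrm{diag}(\Lambda^1,\dots,\Lambda^J)$ with $\Lambda^j$ of size $p_j\times r_j$ ($r_j$ bounded uniformly), the square integrable random vectors $G_t,F_t,u_t$ are mutually uncorrelated, $\mathrm{cov}(G_t)=I$, $\mathrm{cov}(F_t)=I$, $\mathrm{cov}(u_t)=\Sigma_u=(\sigma_{u,ij})$, and $\mathbf B'\mathbf B$, $\Lambda^{j\prime}\Lambda^j$ are diagonal. Let $\Sigma=\mathrm{cov}(y_t)=\mathbf B\mathbf B'+\boldsymbol\Lambda\boldsymbol\Lambda'+\Sigma_u$, let $\widehat\Sigma=T^{-1}\sum_t(y_t-\bar y)(y_t-\bar y)'$, and for some $q\in[0,1)$ let $m_p=\max_i\sum_j|\sigma_{u,ij}|^q$ (with $0^0=0$). Let $\|\cdot\|_{\max}$,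 $\|\cdot\|_1$, $\|\cdot\|_2$, $\|\cdot\|_F$ be the elementwise maximum, maximal absolute column sum, operator and Frobenius norms, and $\|\widehat S-\Sigma\|_\Sigma=p^{-1/2}\|\Sigma^{-1/2}\widehat S\,\Sigma^{-1/2}-I\|_F$. **Double-POET.** $\widehat R$ is the sum of the $k$ leading principal components (eigenvalue times eigenprojection) of $\widehat\Sigma$; $\widehat R_j$ is the sum of the $r_j$ leading principal components of the $j$th diagonal block of $\widehat\Sigma-\widehat R$; $\widehat\Sigma_u=(\widehat\sigma_{u,ij})=\widehat\Sigma-\widehat R-\mathrm{diag}(\widehat R_1,\dots,\widehat R_J)$; $\widehat\Sigma_u^{\mathcal D}$ has the diagonal of $\widehat\Sigma_u$ and off-diagonal entries $s_{ij}(\widehat\sigma_{u,ij})\mathbf 1(|\widehat\sigma_{u,ij}|\ge\tau_{ij})$ with $\tau_{ij}=\tau(\widehat\sigma_{u,ii}\widehat\sigma_{u,jj})^{1/2}$ and generalized shrinkage functions $s_{ij}$ (that is, $|s_{ij}(z)|\le|z|$, $s_{ij}(z)=0$ for $|z|<\tau_{ij}$, $|s_{ij}(z)-z|\le\tau_{ij}$);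 and $\widehat\Sigma^{\mathcal D}=\widehat R+\mathrm{diag}(\widehat R_1,\dots,\widehat R_J)+\widehat\Sigma_u^{\mathcal D}$. **Assumptions.** For constants $c\in(0,1]$, $a_1\in(\frac{3+2c}5,1]$, $a_2\in(\frac35,1]$ with $a_1\ge ca_2$: (a) $p_j\asymp p^c$ uniformly in $j$; the eigenvalues of $\mathbf B'\mathbf B/p^{a_1}$ and of $\Lambda^{j\prime}\Lambda^j/p_j^{a_2}$ are eventually bounded below by a positive constant, uniformly in $j$; if $a_1=ca_2$, then $\lambda_{\min}(\mathbf B'\mathbf B)-\lambda_{\max}(\boldsymbol\Lambda'\boldsymbol\Lambda)\ge d_\lambda$ for some constant $d_\lambda>0$; $\|\mathbf B\|_{\max}$ and $\|\boldsymbol\Lambda\|_{\max}$ are bounded. (b) The eigenvalues of $\Sigma_u$ are bounded and bounded away from $0$, and $\|\Sigma_u\|_1\le d_2m_p$ for some constant $d_2$. (c) $\|\widehat\Sigma-\Sigma\|_{\max}=O_P(\sqrt{\log p/T})$. (d) $\mathbf B'\boldsymbol\Lambda=0$. (e) $m_p=o(\min\{p^{(5a_1-3)/2},p^{c(5a_2-3)/2}\})$.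 (f) $m_p\,\omega_{T,2}^{1-q}=o(1)$, where $$\omega_{T,2}=p^{\frac52(1-a_1)+\frac52c(1-a_2)}\sqrt{\tfrac{\log p}{T}}+\frac{m_p}{\sqrt{p^{c(5a_2-3)}}}+\frac{m_p}{\sqrt{p^{5a_1-3-5c(1-a_2)}}}.$$ **Theorem 2.** For every $\tau\asymp\omega_{T,2}$, $$\|\widehat\Sigma_u^{\mathcal D}-\Sigma_u\|_{\max}=O_P(\omega_{T,2}),\qquad \|\widehat\Sigma^{\mathcal D}-\Sigma\|_{\max}=O_P(\omega_{T,2}).$$ For $\tau\asymp\omega_{T,2}$ with a sufficiently large constant, that is $\tau\ge C_0\,\omega_{T,2}$, $$\|\widehat\Sigma_u^{\mathcal D}-\Sigma_u\|_2,\quad \|(\widehat\Sigma_u^{\mathcal D})^{-1}-\Sigma_u^{-1}\|_2,\quad \|(\widehat\Sigma^{\mathcal D})^{-1}-\Sigma^{-1}\|_2\quad\text{are}\quad O_P(m_p\,\omega_{T,2}^{1-q}),$$ and, if in addition $a_1>\frac34$ and $a_2>\frac34$, $$\|\widehat\Sigma^{\mathcal D}-\Sigma\|_\Sigma=O_P\Big(m_p\omega_{T,2}^{1-q}+p^{\frac{11}2-5a_1+5c(1-a_2)}\frac{\log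 p}T+\frac{m_p^2}{p^{5a_1-\frac72-5c(1-a_2)}}+\frac{m_p^2}{p^{c(5a_2-3)-\frac12}}\Big).$$ Here, in the last two displays, $C_0$ may depend on the level: for every $\varepsilon>0$ there is $C_0>0$ such that, for every $\tau\asymp\omega_{T,2}$ with $\tau\ge C_0\omega_{T,2}$ eventually, each error exceeds some constant times its rate with probability at most $\varepsilon$ for all large $n$. If there is a constant $K$ with $P(\|\widehat\Sigma-\Sigma\|_{\max}>K\sqrt{\log p/T})\to0$, then one $C_0$ serves all levels, and the bounds are $O_P$ bounds for each such $\tau$. -/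

import Mathlib

open MeasureTheory ProbabilityTheory Matrix Filter Topology Asymptotics

noncomputable section

/-! ### Matrix norms -/

/-- Elementwise maximum norm `max_{i,j} |a_{ij}|`. -/
def maxNorm {m n : Type*} (A : Matrix m n ℝ) : ℝ := ⨆ ij : m × n, |A ij.1 ij.2|

/-- The `ℓ₁` operator norm, i.e. the largest absolute column sum. -/
def oneNorm {m n : Type*} [Fintype m] (A : Matrix m n ℝ) : ℝ := ⨆ j : n, ∑ i : m, |A i j|

/-- Operator norm with respect to the Euclidean norm. -/
def opNorm {m : Type*} [Fintype m] [DecidableEq m] (A : Matrix m m ℝ) : ℝ :=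
  ‖Matrix.toEuclideanCLM (n := m) (𝕜 := ℝ) A‖

/-- Frobenius norm `tr(A'A)^{1/2}`. -/
def frobNorm {m n : Type*} [Fintype m] [Fintype n] (A : Matrix m n ℝ) : ℝ :=
  √((Aᵀ * A).trace)

/-- `S^{-1/2}` for a positive definite symmetric matrix `S`, by the spectral calculus. -/
def invSqrt {m : Type*} [Fintype m] [DecidableEq m] (S : Matrix m m ℝ) : Matrix m m ℝ :=
  cfc (fun x : ℝ => (√x)⁻¹) S

/-- Relative Frobenius error of `R` as an estimator of the `p × p` matrix `S`:
`p^{-1/2} ‖S^{-1/2} R S^{-1/2} - I‖_F`. -/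
def relFrobError {m : Type*} [Fintype m] [DecidableEq m] (R S : Matrix m m ℝ) : ℝ :=
  (√(Fintype.card m : ℝ))⁻¹ * frobNorm (invSqrt S * R * invSqrt S - 1)

/-- Sparsity level `max_i ∑_j |s_{ij}|^q`, with the usual convention that for `q = 0` the nonzero
entries of a row are counted. -/
def sparsity {m : Type*} [Fintype m] (q : ℝ) (S : Matrix m m ℝ) : ℝ :=
  ⨆ i : m, ∑ j : m, if S i j = 0 then 0 else |S i j| ^ q

/-! ### The multi-level factor model -/

/-- Cross-covariance matrix of two random vectors. -/
def covMatrix {Ω m n : Type*} [MeasurableSpace Ω] (P : Measure Ω) (X : Ω → m → ℝ)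
    (Y : Ω → n → ℝ) : Matrix m n ℝ :=
  Matrix.of fun i j => cov[fun ω => X ω i, fun ω => Y ω j; P]

/-- A multi-level factor model with `k` global factors: `T` observations of the variables
`(j, i)`, where `j` is one of `J` groups and `i` one of the `size j` members of the group `j`;
group `j` has `r j` local factors. -/
structure FactorModel (k : ℕ) where
  T : ℕ
  T_pos : 0 < T
  J : ℕ
  size : Fin J → ℕ
  r : Fin J → ℕ
  /-- global loadings -/
  B : Matrix ((j : Fin J) × Fin (size j)) (Fin k) ℝ
  /-- local loadings of each group -/
  L : (j : Fin J) → Matrix (Fin (size j)) (Fin (r j)) ℝ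
  /-- idiosyncratic covariance matrix -/
  SigmaU : Matrix ((j : Fin J) × Fin (size j)) ((j : Fin J) × Fin (size j)) ℝ
  Ω : Type*
  [mΩ : MeasurableSpace Ω]
  P : Measure Ω
  [prob : IsProbabilityMeasure P]
  /-- global factors -/
  G : Fin T → Ω → Fin k → ℝ
  /-- local factors -/
  F : Fin T → Ω → ((j : Fin J) × Fin (r j)) → ℝ
  /-- idiosyncratic errors -/
  U : Fin T → Ω → ((j : Fin J) × Fin (size j)) → ℝ
  memLp_G : ∀ t l, MemLp (fun ω => G t ω l) 2 P
  memLp_F : ∀ t l, MemLp (fun ω => F t ω l) 2 P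
  memLp_U : ∀ t i, MemLp (fun ω => U t ω i) 2 P
  cov_G : ∀ t, covMatrix P (G t) (G t) = 1
  cov_F : ∀ t, covMatrix P (F t) (F t) = 1
  cov_G_F : ∀ t, covMatrix P (G t) (F t) = 0
  cov_G_U : ∀ t, covMatrix P (G t) (U t) = 0
  cov_F_U : ∀ t, covMatrix P (F t) (U t) = 0
  cov_U : ∀ t, covMatrix P (U t) (U t) = SigmaU
  /-- normalization of the loadings -/
  isDiag_B : (Bᵀ * B).IsDiag
  isDiag_L : ∀ j, ((L j)ᵀ * L j).IsDiag

attribute [instance] FactorModel.mΩ FactorModel.prob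

namespace FactorModel

variable {k : ℕ} (M : FactorModel k)

/-- The index set of the observed variables. -/
abbrev Idx : Type := (j : Fin M.J) × Fin (M.size j)

/-- The index set of all local factors. -/
abbrev LIdx : Type := (j : Fin M.J) × Fin (M.r j)

/-- The number of observed variables. -/
def p : ℕ := Fintype.card M.Idx

/-- The block diagonal matrix `diag(L 1, …, L J)` of all local loadings. -/
def Lam : Matrix M.Idx M.LIdx ℝ := Matrix.blockDiagonal' M.L

/-- The observation at time `t`. -/
def y (t : Fin M.T) (ω : M.Ω) : M.Idx → ℝ := M.B *ᵥ M.G t ω + M.Lam *ᵥ M.F t ω + M.U t ω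

/-- The covariance matrix of the observations (it does not depend on the time, see
`FactorModel.cov_y`). -/
def Sigma : Matrix M.Idx M.Idx ℝ := covMatrix M.P (M.y ⟨0, M.T_pos⟩) (M.y ⟨0, M.T_pos⟩)

/-- Sample mean. -/
def ybar (ω : M.Ω) : M.Idx → ℝ := (M.T : ℝ)⁻¹ • ∑ t, M.y t ω

/-- Sample covariance matrix. -/
def sampleCov (ω : M.Ω) : Matrix M.Idx M.Idx ℝ :=
  (M.T : ℝ)⁻¹ • ∑ t, Matrix.vecMulVec (M.y t ω - M.ybar ω) (M.y t ω - M.ybar ω)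

/-- `√(log p / T)` -/
def baseRate : ℝ := √(Real.log M.p / M.T)

end FactorModel

section Cov

variable {Ω m n m' n' : Type*} [MeasurableSpace Ω] {P : Measure Ω}

theorem covMatrix_mulVec [IsProbabilityMeasure P] [Fintype m] [Fintype n] (A : Matrix m' m ℝ) (C : Matrix n' n ℝ)
    {X : Ω → m → ℝ} {Y : Ω → n → ℝ} (hX : ∀ i, MemLp (fun ω => X ω i) 2 P)
    (hY : ∀ i, MemLp (fun ω => Y ω i) 2 P) :
    covMatrix P (fun ω => A *ᵥ X ω) (fun ω => C *ᵥ Y ω) = A * covMatrix P X Y * Cᵀ := by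
  ext i j
  simp only [covMatrix, Matrix.of_apply, Matrix.mulVec, dotProduct, Matrix.mul_apply,
    Matrix.transpose_apply]
  rw [covariance_fun_sum_fun_sum (fun a => (hX a).const_mul _) (fun b => (hY b).const_mul _),
    Finset.sum_comm]
  refine Finset.sum_congr rfl fun b _ => ?_
  rw [Finset.sum_mul]
  refine Finset.sum_congr rfl fun a _ => ?_
  rw [covariance_const_mul_left, covariance_const_mul_right]
  ring

theorem covMatrix_transpose (X : Ω → m → ℝ) (Y : Ω → n → ℝ) :
    (covMatrix P X Y)ᵀ = covMatrix P Y X := by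
  ext i j
  simp [covMatrix, covariance_comm]

theorem covMatrix_add_left [IsProbabilityMeasure P] {X X' : Ω → m → ℝ} {Y : Ω → n → ℝ}
    (hX : ∀ i, MemLp (fun ω => X ω i) 2 P) (hX' : ∀ i, MemLp (fun ω => X' ω i) 2 P)
    (hY : ∀ i, MemLp (fun ω => Y ω i) 2 P) :
    covMatrix P (fun ω => X ω + X' ω) Y = covMatrix P X Y + covMatrix P X' Y := by
  ext i j
  exact covariance_add_left (hX i) (hX' i) (hY j)

theorem covMatrix_add_right [IsProbabilityMeasure P] {X : Ω → m → ℝ} {Y Y' : Ω → n → ℝ}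
    (hX : ∀ i, MemLp (fun ω => X ω i) 2 P) (hY : ∀ i, MemLp (fun ω => Y ω i) 2 P)
    (hY' : ∀ i, MemLp (fun ω => Y' ω i) 2 P) :
    covMatrix P X (fun ω => Y ω + Y' ω) = covMatrix P X Y + covMatrix P X Y' := by
  ext i j
  exact covariance_add_right (hX i) (hY j) (hY' j)

theorem memLp_mulVec [Fintype m] (A : Matrix m' m ℝ) {X : Ω → m → ℝ}
    (hX : ∀ i, MemLp (fun ω => X ω i) 2 P) (i : m') : MemLp (fun ω => (A *ᵥ X ω) i) 2 P := by
  simp only [Matrix.mulVec, dotProduct]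
  exact memLp_finsetSum _ fun a _ => (hX a).const_mul _

end Cov

/-- The covariance matrix of the observations is the same at all times and equals
`B B' + Λ Λ' + Σ_u`. -/
theorem FactorModel.cov_y {k : ℕ} (M : FactorModel k) (t : Fin M.T) :
    covMatrix M.P (M.y t) (M.y t) = M.B * M.Bᵀ + M.Lam * M.Lamᵀ + M.SigmaU := by
  have hG := memLp_mulVec M.B (M.memLp_G t)
  have hF := memLp_mulVec M.Lam (M.memLp_F t)
  have hU := M.memLp_U t
  have hGF : ∀ i, MemLp (fun ω => (M.B *ᵥ M.G t ω + M.Lam *ᵥ M.F t ω) i) 2 M.P :=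
    fun i => (hG i).add (hF i)
  have hy : ∀ i, MemLp (fun ω => (M.B *ᵥ M.G t ω + M.Lam *ᵥ M.F t ω + M.U t ω) i) 2 M.P :=
    fun i => (hGF i).add (hU i)
  have hFG : covMatrix M.P (M.F t) (M.G t) = 0 := by
    rw [← covMatrix_transpose, M.cov_G_F, Matrix.transpose_zero]
  have hUG : covMatrix M.P (M.U t) (M.G t) = 0 := by
    rw [← covMatrix_transpose, M.cov_G_U, Matrix.transpose_zero]
  have hUF : covMatrix M.P (M.U t) (M.F t) = 0 := by
    rw [← covMatrix_transpose, M.cov_F_U, Matrix.transpose_zero]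
  have e1 : covMatrix M.P (fun ω => M.B *ᵥ M.G t ω) (M.U t) = 0 := by
    have := covMatrix_mulVec M.B (1 : Matrix M.Idx M.Idx ℝ) (M.memLp_G t) hU
    simpa [M.cov_G_U] using this
  have e2 : covMatrix M.P (fun ω => M.Lam *ᵥ M.F t ω) (M.U t) = 0 := by
    have := covMatrix_mulVec M.Lam (1 : Matrix M.Idx M.Idx ℝ) (M.memLp_F t) hU
    simpa [M.cov_F_U] using this
  have e3 : covMatrix M.P (M.U t) (fun ω => M.B *ᵥ M.G t ω) = 0 := by
    rw [← covMatrix_transpose, e1, Matrix.transpose_zero]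
  have e4 : covMatrix M.P (M.U t) (fun ω => M.Lam *ᵥ M.F t ω) = 0 := by
    rw [← covMatrix_transpose, e2, Matrix.transpose_zero]
  change covMatrix M.P (fun ω => M.B *ᵥ M.G t ω + M.Lam *ᵥ M.F t ω + M.U t ω)
    (fun ω => M.B *ᵥ M.G t ω + M.Lam *ᵥ M.F t ω + M.U t ω) = _
  rw [covMatrix_add_left hGF hU hy, covMatrix_add_right hGF hGF hU,
    covMatrix_add_right hU hGF hU, covMatrix_add_left hG hF hGF, covMatrix_add_left hG hF hU,
    covMatrix_add_right hG hG hF, covMatrix_add_right hF hG hF, covMatrix_add_right hU hG hF,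
    e1, e2, e3, e4, covMatrix_mulVec _ _ (M.memLp_G t) (M.memLp_G t),
    covMatrix_mulVec _ _ (M.memLp_G t) (M.memLp_F t),
    covMatrix_mulVec _ _ (M.memLp_F t) (M.memLp_G t),
    covMatrix_mulVec _ _ (M.memLp_F t) (M.memLp_F t), M.cov_G, M.cov_F, M.cov_G_F, hFG, M.cov_U]
  simp

/-! ### The Double-POET procedure -/

/-- `R` is the sum of the `k` leading principal components `δ_i v_i v_i'` of the symmetric matrix
`A`, for some orthonormal basis of eigenvectors of `A` in decreasing order of the eigenvalues. -/
def IsLeadingPart {m : Type*} [Fintype m] (k : ℕ) (A R : Matrix m m ℝ) : Prop :=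
  ∃ (δ : Fin (Fintype.card m) → ℝ) (v : Fin (Fintype.card m) → m → ℝ),
    Antitone δ ∧ (∀ a b, v a ⬝ᵥ v b = if a = b then 1 else 0) ∧
    (∀ a, A *ᵥ v a = δ a • v a) ∧
    R = ∑ a with a.val < k, δ a • Matrix.vecMulVec (v a) (v a)

/-- Generalized shrinkage (thresholding) functions `z ↦ s l z` with threshold `l ≥ 0`, for example
hard and soft thresholding. -/
def IsShrinkage (s : ℝ → ℝ → ℝ) : Prop :=
  ∀ l z : ℝ, 0 ≤ l → |s l z| ≤ |z| ∧ (|z| < l → s l z = 0) ∧ |s l z - z| ≤ l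

/-- Adaptive thresholding of the off-diagonal entries, the threshold of the entry `(i, j)` being
`τ (a_{ii} a_{jj})^{1/2}`. -/
def adaptiveThreshold {m : Type*} [DecidableEq m] (s : m → m → ℝ → ℝ → ℝ) (τ : ℝ)
    (A : Matrix m m ℝ) : Matrix m m ℝ :=
  Matrix.of fun i j =>
    if i = j then A i j
    else if τ * √(A i i * A j j) ≤ |A i j| then s i j (τ * √(A i i * A j j)) (A i j) else 0

/-- `Su` and `S` are the Double-POET estimators of the idiosyncratic and of the full covariance
matrix that are computed from the sample covariance matrix `A`, with `k` global factors, `r j`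
local factors in group `j`, shrinkage functions `s` and thresholding constant `τ`. -/
def IsDoublePOET {J : ℕ} {size : Fin J → ℕ} (k : ℕ) (r : Fin J → ℕ)
    (s : (j : Fin J) × Fin (size j) → (j : Fin J) × Fin (size j) → ℝ → ℝ → ℝ) (τ : ℝ)
    (A Su S : Matrix ((j : Fin J) × Fin (size j)) ((j : Fin J) × Fin (size j)) ℝ) : Prop :=
  ∃ (Rg : Matrix ((j : Fin J) × Fin (size j)) ((j : Fin J) × Fin (size j)) ℝ)
    (Rl : (j : Fin J) → Matrix (Fin (size j)) (Fin (size j)) ℝ),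
    IsLeadingPart k A Rg ∧
    (∀ j, IsLeadingPart (r j) ((A - Rg).blockDiag' j) (Rl j)) ∧
    Su = adaptiveThreshold s τ (A - Rg - Matrix.blockDiagonal' Rl) ∧
    S = Rg + Matrix.blockDiagonal' Rl + Su

/-! ### Stochastic orders -/

/-- Up to probability `ε`, the sequence `X n` is bounded by a constant multiple of `a n`. -/
def BoundedUpTo {k : ℕ} (M : ℕ → FactorModel k) (ε : ℝ) (X : (n : ℕ) → (M n).Ω → ℝ)
    (a : ℕ → ℝ) : Prop :=
  ∃ C : ℝ, ∀ᶠ n in atTop, (M n).P {ω | C * a n < |X n ω|} ≤ ENNReal.ofReal ε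

/-- `X n = O_P(a n)`. -/
def IsBigOP {k : ℕ} (M : ℕ → FactorModel k) (X : (n : ℕ) → (M n).Ω → ℝ) (a : ℕ → ℝ) : Prop :=
  ∀ ε : ℝ, 0 < ε → BoundedUpTo M ε X a

/-- `a n ≍ b n` for sequences of positive numbers. -/
def SameOrder (a b : ℕ → ℝ) : Prop :=
  ∃ c C : ℝ, 0 < c ∧ 0 < C ∧ ∀ᶠ n in atTop, c * b n ≤ a n ∧ a n ≤ C * b n

/-! ### Assumptions and rates -/

/-- The assumptions on a sequence of multi-level factor models: `a₁`, `a₂` are the strengths of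
the global and the local factors, the group sizes are of the order `p^c`. -/
structure Assumptions {k : ℕ} (M : ℕ → FactorModel k) (c a₁ a₂ q : ℝ) : Prop where
  c_mem : c ∈ Set.Ioc (0 : ℝ) 1
  a₁_mem : a₁ ∈ Set.Ioc ((3 + 2 * c) / 5) 1
  a₂_mem : a₂ ∈ Set.Ioc (3 / 5 : ℝ) 1
  a₂_le : c * a₂ ≤ a₁
  q_mem : q ∈ Set.Ico (0 : ℝ) 1
  p_tendsto : Tendsto (fun n => (M n).p) atTop atTop
  T_tendsto : Tendsto (fun n => (M n).T) atTop atTop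
  /-- the numbers of local factors are bounded -/
  r_bdd : ∃ R : ℕ, ∀ n j, (M n).r j ≤ R
  /-- the group sizes are of the order `p^c` -/
  size_order : ∃ c₁ c₂ : ℝ, 0 < c₁ ∧ 0 < c₂ ∧ ∀ᶠ n in atTop, ∀ j,
    c₁ * ((M n).p : ℝ) ^ c ≤ (M n).size j ∧ ((M n).size j : ℝ) ≤ c₂ * ((M n).p : ℝ) ^ c
  /-- pervasiveness of the global factors -/
  pervasive_B : ∃ κ : ℝ, 0 < κ ∧ ∀ᶠ n in atTop,
    ∀ x ∈ spectrum ℝ ((((M n).p : ℝ) ^ a₁)⁻¹ • ((M n).Bᵀ * (M n).B)), κ ≤ x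
  /-- pervasiveness of the local factors -/
  pervasive_L : ∃ κ : ℝ, 0 < κ ∧ ∀ᶠ n in atTop, ∀ j,
    ∀ x ∈ spectrum ℝ ((((M n).size j : ℝ) ^ a₂)⁻¹ • (((M n).L j)ᵀ * (M n).L j)), κ ≤ x
  /-- separation of the two levels in the boundary case -/
  gap : a₁ = c * a₂ → ∃ d : ℝ, 0 < d ∧ ∀ᶠ n in atTop,
    ∀ x ∈ spectrum ℝ ((M n).Bᵀ * (M n).B), ∀ z ∈ spectrum ℝ ((M n).Lamᵀ * (M n).Lam), d ≤ x - z
  loadings_bdd : ∃ d : ℝ, 0 < d ∧ ∀ n, maxNorm (M n).B ≤ d ∧ maxNorm (M n).Lam ≤ d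
  /-- the eigenvalues of `Σ_u` are bounded and bounded away from zero -/
  eig_lower : ∃ d : ℝ, 0 < d ∧ ∀ n, ∀ x ∈ spectrum ℝ (M n).SigmaU, d < x
  eig_upper : ∃ d : ℝ, 0 < d ∧ ∀ n, ∀ x ∈ spectrum ℝ (M n).SigmaU, x ≤ d
  oneNorm_le : ∃ d : ℝ, 0 < d ∧ ∀ n, oneNorm (M n).SigmaU ≤ d * sparsity q (M n).SigmaU
  /-- elementwise convergence of the sample covariance matrix -/
  sampleCov_rate : IsBigOP M (fun n ω => maxNorm ((M n).sampleCov ω - (M n).Sigma))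
    (fun n => (M n).baseRate)

/-- The rate `ω_{T,2}`. -/
def omega₂ {k : ℕ} (M : FactorModel k) (c a₁ a₂ q : ℝ) : ℝ :=
  (M.p : ℝ) ^ (5 / 2 * (1 - a₁) + 5 / 2 * c * (1 - a₂)) * M.baseRate
    + sparsity q M.SigmaU / √((M.p : ℝ) ^ (c * (5 * a₂ - 3)))
    + sparsity q M.SigmaU / √((M.p : ℝ) ^ (5 * a₁ - 3 - 5 * c * (1 - a₂)))

/-- The rate in the operator norm, `m_p ω_{T,2}^{1-q}`. -/
def opRate {k : ℕ} (M : FactorModel k) (c a₁ a₂ q : ℝ) : ℝ :=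
  sparsity q M.SigmaU * omega₂ M c a₁ a₂ q ^ (1 - q)

/-- The rate in the relative Frobenius norm. -/
def relRate {k : ℕ} (M : FactorModel k) (c a₁ a₂ q : ℝ) : ℝ :=
  opRate M c a₁ a₂ q
    + (M.p : ℝ) ^ (11 / 2 - 5 * a₁ + 5 * c * (1 - a₂)) * (Real.log M.p / M.T)
    + sparsity q M.SigmaU ^ 2 / (M.p : ℝ) ^ (5 * a₁ - 7 / 2 - 5 * c * (1 - a₂))
    + sparsity q M.SigmaU ^ 2 / (M.p : ℝ) ^ (c * (5 * a₂ - 3) - 1 / 2)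

end

/-!
The theorem rests on a deterministic bound for principal components that needs no gap between the
leading eigenvalues. Let `A = B Bᵀ + L Lᵀ + Δ` with `Bᵀ L = 0`, `Bᵀ B ≥ lam`, and `L Lᵀ`, `Δ` small
against `lam`, and let `P` be the projection on the leading eigenvectors of `A` and `R = P A`. The
two matrices that measure the misalignment, `Bᵀ (1 - P)` and `P L`, satisfy linear equations of
Sylvester type whose coefficients are separated at the scale `lam`: for example
`Bᵀ B (Bᵀ (1 - P)) = Bᵀ (1 - P) (A - R) - Bᵀ Δ (1 - P)` with `‖A - R‖ ≤ lam / 4`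
(`FactorStep.sylvester`). So both are small in operator norm. Reading the first equation column by
column, with bounded rows of the loadings and `Δ = U + E`, where `U` has bounded row sums and `E`
has small entries, makes `Bᵀ (1 - P)` small uniformly over the columns, and writing `B Bᵀ - R` as
`(1 - P) B Bᵀ (1 - P)` up to terms that have a factor `P` on an outer side
(`FactorStep.sub_part_eq`) turns this into the elementwise bound `FactorStep.abs_part_sub_le`: with
`N` variables, `|E i j| ≤ η` and row sums of `U` at most `μ`, the error is of the order
`(N / lam)² (η + μ / N)`.

This bound is used twice, for the sample covariance matrix as a whole and, with the resulting error
as an additional input error, in each group (`TwoLevel.exists_split`). All elementwise errors of the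
principal components are thereby at most a multiple of `totalError`, which is of the order
`ω_{T,2}` (`totalError_le_omega₂`). Adaptive thresholding of a matrix that is elementwise within
`e` of the sparse matrix `Σ_u`, at a level above `2 e`, has an operator norm error of the order
`m_p e^{1-q}` (`norm_adaptiveThreshold_sub_le`).

For the inverse of the full matrix one writes `S⁻¹ - Σ⁻¹ = S⁻¹ (Σ - S) Σ⁻¹`. The error of one level
of principal components is `P X - Y Bᵀ` with small `X`, `Y` (`FactorStep.part_sub_eq`), and although
this error is not small in operator norm, `S⁻¹ P` and `Bᵀ Σ⁻¹` are of the orders `1 / lam` and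
`1 / √lam`, because the idiosyncratic part is bounded and bounded below
(`TwoLevel.norm_inv_sub_inv_le`). The relative Frobenius norm is treated in the same way with
`Σ^{-1/2}` in place of both inverses, using that the two terms have rank at most the number of
factors (`TwoLevel.relFrobError_le`); this produces the terms `√p ω_{T,2}²` of the rate.

Finally, these bounds hold for every realization in the event
`‖Σ̂ - Σ‖_max ≤ K √(log p / T)`, and the constant of the threshold has to exceed a multiple of the
elementwise error, which depends on `K`, hence in general on the level `ε`.
-/

set_option linter.unusedSectionVars false

/-! ### Euclidean norms of vectors and operator norms of matrices -/

section Norms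

open scoped Matrix.Norms.L2Operator

variable {m n l : Type*} [Fintype m] [Fintype n] [Fintype l]

/-- The Euclidean norm of a vector that is given as a plain function, whose own norm would be the
supremum norm. -/
noncomputable def vecNorm (x : n → ℝ) : ℝ := ‖WithLp.toLp 2 x‖

theorem vecNorm_nonneg (x : n → ℝ) : 0 ≤ vecNorm x := norm_nonneg _

theorem vecNorm_sq_eq_sum (x : n → ℝ) : vecNorm x ^ 2 = ∑ i, x i ^ 2 := by
  rw [vecNorm, EuclideanSpace.real_norm_sq_eq]

theorem vecNorm_sq (x : n → ℝ) : vecNorm x ^ 2 = x ⬝ᵥ x := by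
  rw [vecNorm_sq_eq_sum]; simp [dotProduct, pow_two]

theorem vecNorm_zero : vecNorm (0 : n → ℝ) = 0 := by simp [vecNorm]

theorem vecNorm_add_le (x y : n → ℝ) : vecNorm (x + y) ≤ vecNorm x + vecNorm y := by
  simpa [vecNorm] using norm_add_le (WithLp.toLp 2 x) (WithLp.toLp 2 y)

theorem vecNorm_sub_le (x y : n → ℝ) : vecNorm (x - y) ≤ vecNorm x + vecNorm y := by
  simpa [vecNorm] using norm_sub_le (WithLp.toLp 2 x) (WithLp.toLp 2 y)

theorem vecNorm_smul (c : ℝ) (x : n → ℝ) : vecNorm (c • x) = |c| * vecNorm x := by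
  simp [vecNorm, norm_smul]

theorem vecNorm_sum_le {ι : Type*} (s : Finset ι) (f : ι → n → ℝ) :
    vecNorm (∑ i ∈ s, f i) ≤ ∑ i ∈ s, vecNorm (f i) := by
  simpa [vecNorm] using norm_sum_le s (fun i => WithLp.toLp 2 (f i))

theorem dotProduct_le_vecNorm (x y : n → ℝ) : x ⬝ᵥ y ≤ vecNorm x * vecNorm y := by
  have := real_inner_le_norm (WithLp.toLp 2 y) (WithLp.toLp 2 x)
  rw [EuclideanSpace.inner_eq_star_dotProduct] at this
  simpa [vecNorm, mul_comm] using this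

theorem abs_dotProduct_le_vecNorm (x y : n → ℝ) : |x ⬝ᵥ y| ≤ vecNorm x * vecNorm y := by
  have := abs_real_inner_le_norm (WithLp.toLp 2 y) (WithLp.toLp 2 x)
  rw [EuclideanSpace.inner_eq_star_dotProduct] at this
  simpa [vecNorm, mul_comm] using this

theorem vecNorm_eq_zero {x : n → ℝ} : vecNorm x = 0 ↔ x = 0 := by
  simp [vecNorm]

theorem vecNorm_pos {x : n → ℝ} (hx : x ≠ 0) : 0 < vecNorm x :=
  lt_of_le_of_ne (vecNorm_nonneg x) (fun h => hx (vecNorm_eq_zero.1 h.symm))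

theorem dotProduct_mulVec_transpose (A : Matrix m n ℝ) (x : m → ℝ) (y : n → ℝ) :
    x ⬝ᵥ (A *ᵥ y) = (Aᵀ *ᵥ x) ⬝ᵥ y := by
  rw [dotProduct_mulVec, mulVec_transpose]

theorem vecNorm_mulVec_sq (A : Matrix m n ℝ) (x : n → ℝ) :
    vecNorm (A *ᵥ x) ^ 2 = x ⬝ᵥ ((Aᵀ * A) *ᵥ x) := by
  rw [vecNorm_sq, dotProduct_mulVec_transpose, dotProduct_comm, mulVec_mulVec]

variable [DecidableEq n] [DecidableEq m]

theorem vecNorm_mulVec_le (A : Matrix m n ℝ) (x : n → ℝ) :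
    vecNorm (A *ᵥ x) ≤ ‖A‖ * vecNorm x :=
  Matrix.l2_opNorm_mulVec A (WithLp.toLp 2 x)

theorem l2norm_le_of_mulVec {A : Matrix m n ℝ} {c : ℝ} (hc : 0 ≤ c)
    (h : ∀ x, vecNorm (A *ᵥ x) ≤ c * vecNorm x) : ‖A‖ ≤ c := by
  rw [Matrix.l2_opNorm_def]
  refine ContinuousLinearMap.opNorm_le_bound _ hc fun x => ?_
  exact h x.ofLp

theorem l2norm_transpose (A : Matrix m n ℝ) : ‖Aᵀ‖ = ‖A‖ := by
  rw [← Matrix.l2_opNorm_conjTranspose A, conjTranspose_eq_transpose_of_trivial]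

/-- Multiplication bound with prescribed bounds of the factors. -/
theorem l2norm_mul_le [DecidableEq l] {A : Matrix m n ℝ} {B : Matrix n l ℝ} {a b : ℝ}
    (hA : ‖A‖ ≤ a) (hB : ‖B‖ ≤ b) : ‖A * B‖ ≤ a * b :=
  (Matrix.l2_opNorm_mul A B).trans
    (mul_le_mul hA hB (norm_nonneg _) ((norm_nonneg _).trans hA))

theorem vecNorm_mulVec_le_of_le {A : Matrix m n ℝ} {x : n → ℝ} {a b : ℝ}
    (hA : ‖A‖ ≤ a) (hx : vecNorm x ≤ b) : vecNorm (A *ᵥ x) ≤ a * b :=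
  (vecNorm_mulVec_le A x).trans
    (mul_le_mul hA hx (vecNorm_nonneg _) ((norm_nonneg _).trans hA))

theorem col_mul (A : Matrix m n ℝ) (B : Matrix n l ℝ) (j : l) :
    (A * B).col j = A *ᵥ B.col j := by
  ext i; simp [Matrix.mul_apply, mulVec, dotProduct]

theorem vecNorm_col_le (A : Matrix m n ℝ) (j : n) : vecNorm (A.col j) ≤ ‖A‖ := by
  have h := vecNorm_mulVec_le A (Pi.single j 1)
  have h1 : vecNorm (Pi.single j (1 : ℝ) : n → ℝ) = 1 := by
    have : vecNorm (Pi.single j (1 : ℝ) : n → ℝ) ^ 2 = 1 := by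
      rw [vecNorm_sq]; simp
    nlinarith [vecNorm_nonneg (Pi.single j (1 : ℝ) : n → ℝ)]
  rwa [mulVec_single_one, h1, mul_one] at h

/-- Entries of `Aᵀ * B` are inner products of columns. -/
theorem abs_transpose_mul_apply_le (A : Matrix m n ℝ) (B : Matrix m l ℝ) (i : n) (j : l) :
    |(Aᵀ * B) i j| ≤ vecNorm (A.col i) * vecNorm (B.col j) :=
  abs_dotProduct_le_vecNorm (A.col i) (B.col j)

/-- A matrix all whose rows have norm at most `b` has operator norm at most `b √N`. -/
theorem l2norm_le_of_rows {A : Matrix m n ℝ} {b N : ℝ} (hb : 0 ≤ b)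
    (hN : (Fintype.card m : ℝ) ≤ N) (h : ∀ i, vecNorm (A.row i) ≤ b) : ‖A‖ ≤ b * √N := by
  have hN0 : 0 ≤ N := le_trans (by positivity) hN
  refine l2norm_le_of_mulVec (by positivity) fun x => ?_
  refine abs_le_of_sq_le_sq' ?_ (by have := vecNorm_nonneg x; positivity) |>.2
  rw [vecNorm_sq_eq_sum]
  calc ∑ i, (A *ᵥ x) i ^ 2 ≤ ∑ _i : m, (b * vecNorm x) ^ 2 := by
        refine Finset.sum_le_sum fun i _ => ?_
        refine sq_le_sq' ?_ ?_
        · have := abs_dotProduct_le_vecNorm (A.row i) x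
          have h2 := mul_le_mul_of_nonneg_right (h i) (vecNorm_nonneg x)
          exact (abs_le.1 (this.trans h2)).1
        · have := abs_dotProduct_le_vecNorm (A.row i) x
          have h2 := mul_le_mul_of_nonneg_right (h i) (vecNorm_nonneg x)
          exact (abs_le.1 (this.trans h2)).2
    _ = Fintype.card m * (b * vecNorm x) ^ 2 := by simp
    _ ≤ N * (b * vecNorm x) ^ 2 := by gcongr
    _ = (b * √N * vecNorm x) ^ 2 := by
        rw [mul_pow, mul_pow, mul_pow, Real.sq_sqrt hN0]; ring

/-- Schur's test for a symmetric majorant. -/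
theorem l2norm_le_of_schur {A W : Matrix n n ℝ} {c : ℝ} (hc : 0 ≤ c) (hA : ∀ i j, |A i j| ≤ W i j)
    (hW : ∀ i j, W i j = W j i) (hsum : ∀ i, ∑ j, W i j ≤ c) : ‖A‖ ≤ c := by
  have hW0 : ∀ i j, 0 ≤ W i j := fun i j => (abs_nonneg _).trans (hA i j)
  refine l2norm_le_of_mulVec hc fun x => ?_
  refine abs_le_of_sq_le_sq' ?_ (by have := vecNorm_nonneg x; positivity) |>.2
  rw [vecNorm_sq_eq_sum, mul_pow, vecNorm_sq_eq_sum]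
  have hrow : ∀ i, (A *ᵥ x) i ^ 2 ≤ c * ∑ j, W i j * x j ^ 2 := by
    intro i
    have h1 : |(A *ᵥ x) i| ≤ ∑ j, √(W i j) * (√(W i j) * |x j|) := by
      refine (Finset.abs_sum_le_sum_abs _ _).trans (Finset.sum_le_sum fun j _ => ?_)
      rw [← mul_assoc, Real.mul_self_sqrt (hW0 i j), abs_mul]
      exact mul_le_mul_of_nonneg_right (hA i j) (abs_nonneg _)
    calc (A *ᵥ x) i ^ 2 = |(A *ᵥ x) i| ^ 2 := (sq_abs _).symm
      _ ≤ (∑ j, √(W i j) * (√(W i j) * |x j|)) ^ 2 := by gcongr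
      _ ≤ (∑ j, √(W i j) ^ 2) * ∑ j, (√(W i j) * |x j|) ^ 2 :=
          Finset.sum_mul_sq_le_sq_mul_sq _ _ _
      _ = (∑ j, W i j) * ∑ j, W i j * x j ^ 2 := by
          simp only [mul_pow, sq_abs, Real.sq_sqrt (hW0 i _)]
      _ ≤ c * ∑ j, W i j * x j ^ 2 := by
          refine mul_le_mul_of_nonneg_right (hsum i) (Finset.sum_nonneg fun j _ => ?_)
          have := hW0 i j; positivity
  calc ∑ i, (A *ᵥ x) i ^ 2 ≤ ∑ i, c * ∑ j, W i j * x j ^ 2 :=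
        Finset.sum_le_sum fun i _ => hrow i
    _ = c * ∑ j, (∑ i, W j i) * x j ^ 2 := by
        rw [← Finset.mul_sum, Finset.sum_comm]
        simp only [Finset.sum_mul, hW]
    _ ≤ c * ∑ j, c * x j ^ 2 := by
        gcongr with j; exact hsum j
    _ = c ^ 2 * ∑ j, x j ^ 2 := by rw [← Finset.mul_sum]; ring

theorem l2norm_le_of_abs_le {A : Matrix n n ℝ} {η N : ℝ} (hη : 0 ≤ η)
    (hN : (Fintype.card n : ℝ) ≤ N) (h : ∀ i j, |A i j| ≤ η) : ‖A‖ ≤ N * η := by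
  have hN0 : 0 ≤ N := le_trans (by positivity) hN
  refine l2norm_le_of_schur (W := Matrix.of fun _ _ => η) (by positivity) (by simpa using h)
    (by simp) (fun i => ?_)
  simp only [of_apply, Finset.sum_const, Finset.card_univ, nsmul_eq_mul]
  gcongr

end Norms

section Block

open scoped Matrix.Norms.L2Operator

variable {o : Type*} [Fintype o] [DecidableEq o] {m n : o → Type*} [∀ i, Fintype (m i)]
  [∀ i, Fintype (n i)] [∀ i, DecidableEq (m i)] [∀ i, DecidableEq (n i)]

theorem blockDiagonal'_mulVec_apply (A : ∀ i, Matrix (m i) (n i) ℝ) (x : (Σ i, n i) → ℝ) (j : o)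
    (i : m j) : (blockDiagonal' A *ᵥ x) ⟨j, i⟩ = (A j *ᵥ fun a => x ⟨j, a⟩) i := by
  simp only [mulVec, dotProduct, Fintype.sum_sigma]
  rw [Finset.sum_eq_single j]
  · simp [blockDiagonal'_apply_eq]
  · intro b _ hb
    refine Finset.sum_eq_zero fun a _ => ?_
    rw [blockDiagonal'_apply_ne _ _ _ hb.symm, zero_mul]
  · simp

theorem l2norm_blockDiagonal'_le {A : ∀ i, Matrix (m i) (n i) ℝ} {c : ℝ} (hc : 0 ≤ c)
    (h : ∀ i, ‖A i‖ ≤ c) : ‖blockDiagonal' A‖ ≤ c := by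
  refine l2norm_le_of_mulVec hc fun x => ?_
  refine abs_le_of_sq_le_sq' ?_ (by have := vecNorm_nonneg x; positivity) |>.2
  rw [vecNorm_sq_eq_sum, mul_pow, vecNorm_sq_eq_sum, Fintype.sum_sigma, Fintype.sum_sigma,
    Finset.mul_sum]
  refine Finset.sum_le_sum fun j _ => ?_
  simp only [blockDiagonal'_mulVec_apply]
  rw [← vecNorm_sq_eq_sum, ← vecNorm_sq_eq_sum (fun a => x ⟨j, a⟩), ← mul_pow]
  have h1 := vecNorm_mulVec_le_of_le (h j) (le_refl (vecNorm fun a => x ⟨j, a⟩))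
  exact pow_le_pow_left₀ (vecNorm_nonneg _) h1 2

end Block

section Spectrum

variable {n : Type*} [Fintype n] [DecidableEq n]

/-- Lower bound of the quadratic form of a symmetric matrix from its spectrum. -/
theorem le_dotProduct_mulVec_of_spectrum {A : Matrix n n ℝ} (hA : Aᵀ = A) {κ : ℝ}
    (h : ∀ x ∈ spectrum ℝ A, κ ≤ x) (v : n → ℝ) : κ * (v ⬝ᵥ v) ≤ v ⬝ᵥ (A *ᵥ v) := by
  have hH : A.IsHermitian := by rwa [Matrix.IsHermitian, conjTranspose_eq_transpose_of_trivial]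
  have hp : (A - algebraMap ℝ _ κ).PosSemidef := by
    refine posSemidef_iff_isHermitian_and_spectrum_nonneg.2 ⟨?_, ?_⟩
    · refine hH.sub ?_
      rw [algebraMap_eq_diagonal]
      exact isHermitian_diagonal _
    · intro x hx
      have h2 : x ∈ ({x} : Set ℝ) := rfl
      rw [← spectrum.sub_singleton_eq] at hx
      obtain ⟨y, hy, z, hz, rfl⟩ := hx
      have := h y hy
      simp only [Set.mem_singleton_iff] at hz
      simp [hz, this]
  have := hp.dotProduct_mulVec_nonneg v
  simp only [star_trivial, sub_mulVec, dotProduct_sub, algebraMap_eq_diagonal] at this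
  have e : v ⬝ᵥ (diagonal (algebraMap ℝ (n → ℝ) κ) *ᵥ v) = κ * (v ⬝ᵥ v) := by
    simp [dotProduct, mulVec_diagonal, Finset.mul_sum]
    exact Finset.sum_congr rfl fun i _ => by ring
  linarith

theorem dotProduct_mulVec_le_of_spectrum {A : Matrix n n ℝ} (hA : Aᵀ = A) {κ : ℝ}
    (h : ∀ x ∈ spectrum ℝ A, x ≤ κ) (v : n → ℝ) : v ⬝ᵥ (A *ᵥ v) ≤ κ * (v ⬝ᵥ v) := by
  have := le_dotProduct_mulVec_of_spectrum (A := -A) (by simp [hA]) (κ := -κ)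
    (fun x hx => by
      rw [← spectrum.neg_eq] at hx
      have := h (-x) (by simpa using hx)
      linarith) v
  simp only [neg_mulVec, dotProduct_neg] at this
  linarith

end Spectrum

/-! ### Leading principal components -/

section Leading

open scoped Matrix.Norms.L2Operator

variable {n κ : Type*} [Fintype n] [DecidableEq n] [Fintype κ] [DecidableEq κ]

/-- `R` is the part of the symmetric matrix `A` on the range of the orthogonal projection `P`, which
commutes with `A`; on that range `A` is at least `lam / 2`, and on its complement `A` is at most
`lam / 4` in absolute value. -/
structure LeadingSplit (A R P : Matrix n n ℝ) (lam : ℝ) : Prop where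
  symm : Pᵀ = P
  idem : P * P = P
  left : P * A = R
  right : A * P = R
  lower : ∀ y, lam / 2 * vecNorm (P *ᵥ y) ^ 2 ≤ y ⬝ᵥ (R *ᵥ y)
  upper : ‖A - R‖ ≤ lam / 4

/-- The matrix with columns `v a`. -/
def colMatrix {ι : Type*} (v : ι → n → ℝ) : Matrix n ι ℝ := Matrix.of fun i a => v a i

variable {δ : Fin (Fintype.card n) → ℝ} {v : Fin (Fintype.card n) → n → ℝ} {A : Matrix n n ℝ}

theorem colMatrix_transpose_mul (hv : ∀ a b, v a ⬝ᵥ v b = if a = b then 1 else 0) :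
    (colMatrix v)ᵀ * colMatrix v = 1 := by
  ext a b
  rw [one_apply, ← hv a b]
  rfl

theorem colMatrix_mul_transpose (hv : ∀ a b, v a ⬝ᵥ v b = if a = b then 1 else 0) :
    colMatrix v * (colMatrix v)ᵀ = 1 :=
  (mul_eq_one_comm_of_card_eq _ _ _ (by simp)).1 (colMatrix_transpose_mul hv)

theorem eq_colMatrix_mul_diagonal (hv : ∀ a b, v a ⬝ᵥ v b = if a = b then 1 else 0)
    (hA : ∀ a, A *ᵥ v a = δ a • v a) :
    A = colMatrix v * diagonal δ * (colMatrix v)ᵀ := by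
  have h : A * colMatrix v = colMatrix v * diagonal δ := by
    ext i a
    have := congrFun (hA a) i
    rw [mul_diagonal]
    simpa [mulVec, dotProduct, Matrix.mul_apply, colMatrix, mul_comm] using this
  rw [← h, Matrix.mul_assoc, colMatrix_mul_transpose hv, Matrix.mul_one]

theorem sum_smul_vecMulVec_eq (w : Fin (Fintype.card n) → ℝ) :
    ∑ a, w a • vecMulVec (v a) (v a) = colMatrix v * diagonal w * (colMatrix v)ᵀ := by
  ext i j
  rw [Matrix.mul_apply, Matrix.sum_apply]
  refine Finset.sum_congr rfl fun a _ => ?_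
  rw [mul_diagonal]
  simp [colMatrix, vecMulVec_apply]
  ring

theorem dotProduct_colMatrix_diagonal (w : Fin (Fintype.card n) → ℝ) (x : n → ℝ) :
    x ⬝ᵥ ((colMatrix v * diagonal w * (colMatrix v)ᵀ) *ᵥ x) =
      ∑ a, w a * (v a ⬝ᵥ x) ^ 2 := by
  rw [← mulVec_mulVec, ← mulVec_mulVec, dotProduct_mulVec_transpose]
  refine Finset.sum_congr rfl fun a _ => ?_
  rw [mulVec_diagonal]
  change (v a ⬝ᵥ x) * (w a * (v a ⬝ᵥ x)) = _
  ring

theorem vecNorm_sq_eq_sum_dotProduct (hv : ∀ a b, v a ⬝ᵥ v b = if a = b then 1 else 0)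
    (x : n → ℝ) : vecNorm x ^ 2 = ∑ a, (v a ⬝ᵥ x) ^ 2 := by
  have h := dotProduct_colMatrix_diagonal (v := v) (fun _ => 1) x
  rw [diagonal_one, Matrix.mul_one, colMatrix_mul_transpose hv, one_mulVec] at h
  rw [vecNorm_sq, h]
  simp

/-- Courant-Fischer bound: `A ≥ μ` on a `k`-dimensional space, the range of `B`. -/
theorem le_eigenvalue_of_range (hδ : Antitone δ)
    (hv : ∀ a b, v a ⬝ᵥ v b = if a = b then 1 else 0) (hA : ∀ a, A *ᵥ v a = δ a • v a)
    {B : Matrix n κ ℝ} {μ : ℝ} (hinj : ∀ c, B *ᵥ c = 0 → c = 0)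
    (hB : ∀ c, μ * vecNorm (B *ᵥ c) ^ 2 ≤ (B *ᵥ c) ⬝ᵥ (A *ᵥ (B *ᵥ c)))
    {a : Fin (Fintype.card n)} (ha : a.val < Fintype.card κ) : μ ≤ δ a := by
  -- a nonzero vector in the range of `B` that is orthogonal to the eigenvectors before `a`
  let f : (κ → ℝ) →ₗ[ℝ] (Fin a.val → ℝ) :=
    (Matrix.of fun (b : Fin a.val) (i : n) => v ⟨b, b.2.trans a.2⟩ i).mulVecLin ∘ₗ B.mulVecLin
  have hf : LinearMap.ker f ≠ ⊥ := LinearMap.ker_ne_bot_of_finrank_lt (by simpa using ha)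
  obtain ⟨c, hc, hc0⟩ := (Submodule.ne_bot_iff _).1 hf
  have hx0 : B *ᵥ c ≠ 0 := fun h => hc0 (hinj c h)
  have horth : ∀ b : Fin (Fintype.card n), b < a → v b ⬝ᵥ (B *ᵥ c) = 0 := fun b hb =>
    congrFun (LinearMap.mem_ker.1 hc) ⟨b.val, hb⟩
  have h1 := hB c
  have h2 : (B *ᵥ c) ⬝ᵥ (A *ᵥ (B *ᵥ c)) ≤ δ a * vecNorm (B *ᵥ c) ^ 2 := by
    rw [eq_colMatrix_mul_diagonal hv hA, dotProduct_colMatrix_diagonal,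
      vecNorm_sq_eq_sum_dotProduct hv, Finset.mul_sum]
    refine Finset.sum_le_sum fun b _ => ?_
    rcases lt_or_ge b a with hb | hb
    · rw [horth b hb]; simp
    · exact mul_le_mul_of_nonneg_right (hδ hb) (sq_nonneg _)
  have hpos : 0 < vecNorm (B *ᵥ c) ^ 2 := pow_pos (vecNorm_pos hx0) 2
  exact le_of_mul_le_mul_right (h1.trans h2) hpos

/-- Courant-Fischer bound: `A ≤ ν` on a space of codimension `k`, the kernel of `Bᵀ`. -/
theorem eigenvalue_le_of_ker (hδ : Antitone δ)
    (hv : ∀ a b, v a ⬝ᵥ v b = if a = b then 1 else 0) (hA : ∀ a, A *ᵥ v a = δ a • v a)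
    {B : Matrix n κ ℝ} {ν : ℝ}
    (hB : ∀ x, Bᵀ *ᵥ x = 0 → x ⬝ᵥ (A *ᵥ x) ≤ ν * vecNorm x ^ 2)
    {a : Fin (Fintype.card n)} (ha : Fintype.card κ ≤ a.val) : δ a ≤ ν := by
  -- a nonzero vector in the kernel of `Bᵀ` that is spanned by the eigenvectors up to `a`
  let g : (Fin (a.val + 1) → ℝ) →ₗ[ℝ] (n → ℝ) :=
    (colMatrix fun b : Fin (a.val + 1) => v ⟨b, by omega⟩).mulVecLin
  have hf : LinearMap.ker (Bᵀ.mulVecLin ∘ₗ g) ≠ ⊥ :=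
    LinearMap.ker_ne_bot_of_finrank_lt (by simp; omega)
  obtain ⟨c, hc, hc0⟩ := (Submodule.ne_bot_iff _).1 hf
  have hg : ∀ b : Fin (Fintype.card n),
      v b ⬝ᵥ g c = if h : b.val < a.val + 1 then c ⟨b.val, h⟩ else 0 := by
    intro b
    have e : g c = ∑ e : Fin (a.val + 1), c e • v ⟨e, by omega⟩ := by
      ext i
      simp [g, colMatrix, mulVec, dotProduct, Finset.sum_apply, mul_comm]
    rw [e, dotProduct_sum]
    simp only [dotProduct_smul, hv, smul_eq_mul]
    split_ifs with h
    · rw [Finset.sum_eq_single ⟨b.val, h⟩]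
      · simp
      · intro e _ he
        rw [if_neg, mul_zero]
        intro h'
        exact he (Fin.ext (by simp [h']))
      · simp
    · refine Finset.sum_eq_zero fun e _ => ?_
      rw [if_neg, mul_zero]
      intro h'
      have := e.2
      rw [h'] at h
      exact h this
  have hx0 : g c ≠ 0 := by
    intro h0
    refine hc0 (funext fun e => ?_)
    have := hg ⟨e, by omega⟩
    rw [h0, dotProduct_zero, dif_pos e.2] at this
    exact this.symm
  have h1 := hB (g c) (LinearMap.mem_ker.1 hc)
  have h2 : δ a * vecNorm (g c) ^ 2 ≤ g c ⬝ᵥ (A *ᵥ g c) := by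
    rw [eq_colMatrix_mul_diagonal hv hA, dotProduct_colMatrix_diagonal,
      vecNorm_sq_eq_sum_dotProduct hv, Finset.mul_sum]
    refine Finset.sum_le_sum fun b _ => ?_
    rcases lt_or_ge a b with hb | hb
    · rw [hg b, dif_neg (by have : a.val < b.val := hb
                            omega)]; simp
    · exact mul_le_mul_of_nonneg_right (hδ hb) (sq_nonneg _)
  have hpos : 0 < vecNorm (g c) ^ 2 := pow_pos (vecNorm_pos hx0) 2
  exact le_of_mul_le_mul_right (h2.trans h1) hpos

theorem le_eigenvalue (hv : ∀ a b, v a ⬝ᵥ v b = if a = b then 1 else 0)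
    (hA : ∀ a, A *ᵥ v a = δ a • v a) {ν : ℝ}
    (h : ∀ x, ν * vecNorm x ^ 2 ≤ x ⬝ᵥ (A *ᵥ x)) (a : Fin (Fintype.card n)) : ν ≤ δ a := by
  have := h (v a)
  rw [hA, dotProduct_smul, vecNorm_sq, hv] at this
  simpa using this

theorem l2norm_colMatrix_le (hv : ∀ a b, v a ⬝ᵥ v b = if a = b then 1 else 0) :
    ‖colMatrix v‖ ≤ 1 := by
  refine l2norm_le_of_mulVec zero_le_one fun x => ?_
  refine abs_le_of_sq_le_sq' ?_ (by have := vecNorm_nonneg x; positivity) |>.2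
  rw [vecNorm_mulVec_sq, colMatrix_transpose_mul hv, one_mulVec, one_mul, vecNorm_sq]

/-- The principal components of a matrix with a spectral gap form a `LeadingSplit`, with a
projection of rank (which is its trace) at most `k`. Only the separation of the `k` leading
eigenvalues from the others enters, through the form of `A` on the range of `B` and on its
orthogonal complement. -/
theorem exists_leadingSplit {k : ℕ} {R : Matrix n n ℝ} {lam : ℝ} (hlam : 0 ≤ lam)
    (hR : IsLeadingPart k A R) {B : Matrix n κ ℝ} (hk : Fintype.card κ = k)
    (hinj : ∀ c, B *ᵥ c = 0 → c = 0)
    (hB : ∀ c, lam / 2 * vecNorm (B *ᵥ c) ^ 2 ≤ (B *ᵥ c) ⬝ᵥ (A *ᵥ (B *ᵥ c)))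
    (hker : ∀ x, Bᵀ *ᵥ x = 0 → x ⬝ᵥ (A *ᵥ x) ≤ lam / 4 * vecNorm x ^ 2)
    (hneg : ∀ x, -(lam / 4) * vecNorm x ^ 2 ≤ x ⬝ᵥ (A *ᵥ x)) :
    ∃ P, LeadingSplit A R P lam ∧ P.trace ≤ k := by
  obtain ⟨δ, v, hδ, hv, hA, rfl⟩ := hR
  let w : Fin (Fintype.card n) → ℝ := fun a => if a.val < k then 1 else 0
  let O := colMatrix v
  have hO : Oᵀ * O = 1 := colMatrix_transpose_mul hv
  have hAO : A = O * diagonal δ * Oᵀ := eq_colMatrix_mul_diagonal hv hA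
  have hRO : ∑ a with a.val < k, δ a • vecMulVec (v a) (v a) =
      O * diagonal (fun a => w a * δ a) * Oᵀ := by
    rw [← sum_smul_vecMulVec_eq, Finset.sum_filter]
    refine Finset.sum_congr rfl fun a _ => ?_
    by_cases h : a.val < k <;> simp [w, h]
  have hmul : ∀ d e : Fin (Fintype.card n) → ℝ, O * diagonal d * Oᵀ * (O * diagonal e * Oᵀ) =
      O * diagonal (fun a => d a * e a) * Oᵀ := by
    intro d e
    calc O * diagonal d * Oᵀ * (O * diagonal e * Oᵀ)
        = O * diagonal d * (Oᵀ * O) * diagonal e * Oᵀ := by simp only [Matrix.mul_assoc]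
      _ = _ := by rw [hO, Matrix.mul_one, Matrix.mul_assoc O, diagonal_mul_diagonal]
  rw [hRO]
  refine ⟨O * diagonal w * Oᵀ, ⟨?_, ?_, ?_, ?_, ?_, ?_⟩, ?_⟩
  · simp [Matrix.mul_assoc]
  · rw [hmul]
    congr 3
    ext a
    simp [w]
  · rw [hAO, hmul]
  · rw [hAO, hmul]
    simp only [mul_comm]
  · intro y
    have e1 : vecNorm ((O * diagonal w * Oᵀ) *ᵥ y) ^ 2 = ∑ a, w a * (v a ⬝ᵥ y) ^ 2 := by
      rw [vecNorm_mulVec_sq]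
      have : (O * diagonal w * Oᵀ)ᵀ * (O * diagonal w * Oᵀ) = O * diagonal w * Oᵀ := by
        have : (O * diagonal w * Oᵀ)ᵀ = O * diagonal w * Oᵀ := by simp [Matrix.mul_assoc]
        rw [this, hmul]
        congr 3
        ext a
        simp [w]
      rw [this, dotProduct_colMatrix_diagonal]
    rw [e1, dotProduct_colMatrix_diagonal, Finset.mul_sum]
    refine Finset.sum_le_sum fun a _ => ?_
    by_cases h : a.val < k
    · have := le_eigenvalue_of_range hδ hv hA hinj hB (a := a) (by omega)
      simp only [w, h, if_true, one_mul]
      exact mul_le_mul_of_nonneg_right this (sq_nonneg _)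
    · simp [w, h]
  · have e : A - O * diagonal (fun a => w a * δ a) * Oᵀ =
        O * diagonal (fun a => (1 - w a) * δ a) * Oᵀ := by
      conv_lhs => rw [hAO]
      rw [← Matrix.sub_mul, ← Matrix.mul_sub, diagonal_sub]
      congr 3
      ext a
      ring
    rw [e]
    have hO1 : ‖O‖ ≤ 1 := l2norm_colMatrix_le hv
    have hd : ‖(diagonal (fun a => (1 - w a) * δ a) : Matrix _ _ ℝ)‖ ≤ lam / 4 := by
      rw [Matrix.l2_opNorm_diagonal, pi_norm_le_iff_of_nonneg (by positivity)]
      intro a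
      by_cases h : a.val < k
      · simp [w, h]; positivity
      · simp only [w, h, if_false, sub_zero, one_mul, Real.norm_eq_abs]
        exact abs_le.2 ⟨le_eigenvalue hv hA hneg a,
          eigenvalue_le_of_ker hδ hv hA hker (by omega)⟩
    have := l2norm_mul_le (l2norm_mul_le hO1 hd) ((l2norm_transpose O).le.trans hO1)
    simpa using this
  · rw [Matrix.trace_mul_comm, ← Matrix.mul_assoc, hO, Matrix.one_mul, trace_diagonal]
    have : ∑ a, w a =
        ((Finset.univ.filter fun a : Fin (Fintype.card n) => a.val < k).card : ℝ) := by
      rw [Finset.card_filter]; push_cast; rfl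
    rw [this]
    norm_cast
    calc _ ≤ (Finset.range k).card := by
          refine Finset.card_le_card_of_injOn (fun a => a.val) ?_ ?_
          · intro a ha; simpa using ha
          · intro a _ b _ h; exact Fin.ext h
      _ = k := by simp

end Leading

/-! ### Principal components of an approximate factor structure -/

section Perturbation

open scoped Matrix.Norms.L2Operator

variable {n κ κ' l : Type*} [Fintype n] [DecidableEq n] [Fintype κ] [DecidableEq κ] [Fintype κ']
  [DecidableEq κ'] [Fintype l] [DecidableEq l]

namespace LeadingSplit

variable {A R P : Matrix n n ℝ} {lam : ℝ}

theorem norm_proj_le (h : LeadingSplit A R P lam) : ‖P‖ ≤ 1 := by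
  refine l2norm_le_of_mulVec zero_le_one fun x => ?_
  have h1 : vecNorm (P *ᵥ x) ^ 2 ≤ vecNorm x * vecNorm (P *ᵥ x) := by
    rw [vecNorm_mulVec_sq, h.symm, h.idem]
    exact dotProduct_le_vecNorm _ _
  nlinarith [vecNorm_nonneg (P *ᵥ x), vecNorm_nonneg x]

theorem norm_compl_le (h : LeadingSplit A R P lam) : ‖1 - P‖ ≤ 1 := by
  refine l2norm_le_of_mulVec zero_le_one fun x => ?_
  have h1 : vecNorm ((1 - P) *ᵥ x) ^ 2 ≤ vecNorm x * vecNorm ((1 - P) *ᵥ x) := by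
    rw [vecNorm_mulVec_sq]
    have : (1 - P)ᵀ * (1 - P) = 1 - P := by
      simp [Matrix.mul_sub, Matrix.sub_mul, h.symm, h.idem]
    rw [this]
    exact dotProduct_le_vecNorm _ _
  nlinarith [vecNorm_nonneg ((1 - P) *ᵥ x), vecNorm_nonneg x]

theorem proj_mul_part (h : LeadingSplit A R P lam) : P * R = R := by
  rw [← h.left, ← Matrix.mul_assoc, h.idem]

theorem vecNorm_proj_le (h : LeadingSplit A R P lam) (y : n → ℝ) :
    lam / 2 * vecNorm (P *ᵥ y) ≤ vecNorm (R *ᵥ y) := by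
  have h1 := h.lower y
  have h2 : y ⬝ᵥ (R *ᵥ y) ≤ vecNorm (P *ᵥ y) * vecNorm (R *ᵥ y) := by
    have : y ⬝ᵥ (R *ᵥ y) = (P *ᵥ y) ⬝ᵥ (R *ᵥ y) := by
      conv_lhs => rw [← h.proj_mul_part, ← mulVec_mulVec, dotProduct_mulVec_transpose, h.symm]
    rw [this]
    exact dotProduct_le_vecNorm _ _
  rcases eq_or_lt_of_le (vecNorm_nonneg (P *ᵥ y)) with h0 | h0
  · rw [← h0, mul_zero]; exact vecNorm_nonneg _
  · refine le_of_mul_le_mul_right ?_ h0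
    nlinarith

theorem norm_proj_mul_le (h : LeadingSplit A R P lam) (hlam : 0 < lam) (Y : Matrix n l ℝ) :
    lam / 2 * ‖P * Y‖ ≤ ‖R * Y‖ := by
  have : ‖P * Y‖ ≤ ‖R * Y‖ / (lam / 2) := by
    refine l2norm_le_of_mulVec (by positivity) fun x => ?_
    rw [div_mul_eq_mul_div, le_div_iff₀ (by positivity), mul_comm, ← mulVec_mulVec]
    refine (h.vecNorm_proj_le _).trans ?_
    rw [mulVec_mulVec]
    exact vecNorm_mulVec_le _ _
  rwa [le_div_iff₀ (by positivity), mul_comm] at this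

end LeadingSplit

/-- A symmetric matrix `A` with dominant part `B Bᵀ`, a moderate part `L Lᵀ` that is orthogonal to
it, and an error `Δ` of norm at most `ε` that is small against the lower bound `lam` of `Bᵀ B`. The
scale `N` stands for the number of variables, `b` for a bound of the rows of `B`. -/
structure FactorStep (A Δ : Matrix n n ℝ) (B : Matrix n κ ℝ) (L : Matrix n κ' ℝ)
    (b N lam ε : ℝ) : Prop where
  eq : A = B * Bᵀ + L * Lᵀ + Δ
  symm : Δᵀ = Δ
  orth : Bᵀ * L = 0
  lam_pos : 0 < lam
  norm_B : ‖B‖ ≤ b * √N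
  norm_L : ‖L‖ ^ 2 ≤ lam / 8
  norm_err : ‖Δ‖ ≤ ε
  err_le : ε ≤ lam / 16
  lower : ∀ c, lam * vecNorm c ^ 2 ≤ vecNorm (B *ᵥ c) ^ 2

namespace FactorStep

variable {A Δ R P : Matrix n n ℝ} {B : Matrix n κ ℝ} {L : Matrix n κ' ℝ} {b N lam ε : ℝ}

theorem err_nonneg (h : FactorStep A Δ B L b N lam ε) : 0 ≤ ε := (norm_nonneg _).trans h.norm_err

theorem abs_err_form_le (h : FactorStep A Δ B L b N lam ε) (x : n → ℝ) :
    |x ⬝ᵥ (Δ *ᵥ x)| ≤ ε * vecNorm x ^ 2 := by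
  have h1 := abs_dotProduct_le_vecNorm x (Δ *ᵥ x)
  have h2 := vecNorm_mulVec_le_of_le h.norm_err (le_refl (vecNorm x))
  nlinarith [vecNorm_nonneg x]

theorem form_eq (h : FactorStep A Δ B L b N lam ε) (x : n → ℝ) :
    x ⬝ᵥ (A *ᵥ x) = vecNorm (Bᵀ *ᵥ x) ^ 2 + vecNorm (Lᵀ *ᵥ x) ^ 2 + x ⬝ᵥ (Δ *ᵥ x) := by
  rw [vecNorm_mulVec_sq, vecNorm_mulVec_sq, h.eq, add_mulVec, add_mulVec, dotProduct_add,
    dotProduct_add, transpose_transpose, transpose_transpose]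

theorem vecNorm_gram_ge (h : FactorStep A Δ B L b N lam ε) (c : κ → ℝ) :
    lam * vecNorm c ≤ vecNorm ((Bᵀ * B) *ᵥ c) := by
  have h1 := h.lower c
  rw [vecNorm_mulVec_sq] at h1
  have h2 := dotProduct_le_vecNorm c ((Bᵀ * B) *ᵥ c)
  rcases eq_or_lt_of_le (vecNorm_nonneg c) with h0 | h0
  · rw [← h0, mul_zero]; exact vecNorm_nonneg _
  · refine le_of_mul_le_mul_right ?_ h0
    nlinarith

/-- The leading principal components of `A`, as many as `B` has columns, split off. -/
theorem exists_split (h : FactorStep A Δ B L b N lam ε) {k : ℕ} (hk : Fintype.card κ = k)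
    (hR : IsLeadingPart k A R) : ∃ P, LeadingSplit A R P lam ∧ P.trace ≤ k := by
  have hlam := h.lam_pos
  have hε := h.err_le
  refine exists_leadingSplit hlam.le hR hk (B := B) ?_ ?_ ?_ ?_
  · intro c hc
    have := h.lower c
    rw [hc, vecNorm_zero] at this
    have h0 : vecNorm c ^ 2 = 0 := by nlinarith [sq_nonneg (vecNorm c)]
    exact vecNorm_eq_zero.1 (pow_eq_zero_iff (two_ne_zero)|>.1 h0)
  · intro c
    rw [h.form_eq]
    have h1 := (abs_le.1 (h.abs_err_form_le (B *ᵥ c))).1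
    have h2 : lam * vecNorm (B *ᵥ c) ^ 2 ≤ vecNorm (Bᵀ *ᵥ (B *ᵥ c)) ^ 2 := by
      rw [mulVec_mulVec]
      have h3 := h.vecNorm_gram_ge c
      have h4 : vecNorm (B *ᵥ c) ^ 2 ≤ vecNorm c * vecNorm ((Bᵀ * B) *ᵥ c) := by
        rw [vecNorm_mulVec_sq]; exact dotProduct_le_vecNorm _ _
      have h5 := vecNorm_nonneg c
      have h6 := vecNorm_nonneg ((Bᵀ * B) *ᵥ c)
      calc lam * vecNorm (B *ᵥ c) ^ 2 ≤ lam * (vecNorm c * vecNorm ((Bᵀ * B) *ᵥ c)) := by gcongr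
        _ = (lam * vecNorm c) * vecNorm ((Bᵀ * B) *ᵥ c) := by ring
        _ ≤ vecNorm ((Bᵀ * B) *ᵥ c) * vecNorm ((Bᵀ * B) *ᵥ c) := by gcongr
        _ = _ := by ring
    nlinarith [sq_nonneg (vecNorm (B *ᵥ c)), sq_nonneg (vecNorm (Lᵀ *ᵥ (B *ᵥ c)))]
  · intro x hx
    rw [h.form_eq, hx, vecNorm_zero]
    have h1 := (abs_le.1 (h.abs_err_form_le x)).2
    have h2 : vecNorm (Lᵀ *ᵥ x) ^ 2 ≤ lam / 8 * vecNorm x ^ 2 := by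
      have := vecNorm_mulVec_le Lᵀ x
      rw [l2norm_transpose] at this
      calc vecNorm (Lᵀ *ᵥ x) ^ 2 ≤ (‖L‖ * vecNorm x) ^ 2 :=
            pow_le_pow_left₀ (vecNorm_nonneg _) this 2
        _ = ‖L‖ ^ 2 * vecNorm x ^ 2 := by ring
        _ ≤ _ := by gcongr; exact h.norm_L
    nlinarith [sq_nonneg (vecNorm x)]
  · intro x
    rw [h.form_eq]
    have h1 := (abs_le.1 (h.abs_err_form_le x)).1
    nlinarith [sq_nonneg (vecNorm x), sq_nonneg (vecNorm (Bᵀ *ᵥ x)),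
      sq_nonneg (vecNorm (Lᵀ *ᵥ x))]

theorem norm_gram_mul_ge (h : FactorStep A Δ B L b N lam ε) (Z : Matrix κ l ℝ) :
    lam * ‖Z‖ ≤ ‖Bᵀ * B * Z‖ := by
  have hlam := h.lam_pos
  have : ‖Z‖ ≤ ‖Bᵀ * B * Z‖ / lam := by
    refine l2norm_le_of_mulVec (by positivity) fun x => ?_
    rw [div_mul_eq_mul_div, le_div_iff₀ hlam, mul_comm]
    refine (h.vecNorm_gram_ge _).trans ?_
    rw [mulVec_mulVec]
    exact vecNorm_mulVec_le _ _
  rwa [le_div_iff₀ hlam, mul_comm] at this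

variable (h : FactorStep A Δ B L b N lam ε) (hs : LeadingSplit A R P lam)

include h hs

theorem transpose_mul_self_eq : Bᵀ * A = Bᵀ * B * Bᵀ + Bᵀ * Δ := by
  rw [h.eq, Matrix.mul_add, Matrix.mul_add, ← Matrix.mul_assoc Bᵀ L, h.orth]
  simp [Matrix.mul_assoc]

/-- The Sylvester equation for the part of `Bᵀ` that the estimated projection misses. -/
theorem sylvester : Bᵀ * B * (Bᵀ * (1 - P)) =
    Bᵀ * (1 - P) * (A - R) - Bᵀ * Δ * (1 - P) := by
  have e1 : (1 - P) * (A - R) = A * (1 - P) := by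
    simp [Matrix.sub_mul, Matrix.mul_sub, hs.left, hs.proj_mul_part, hs.right]
  rw [Matrix.mul_assoc Bᵀ (1 - P), e1, ← Matrix.mul_assoc Bᵀ A, h.transpose_mul_self_eq hs,
    Matrix.add_mul]
  simp [Matrix.mul_assoc]

theorem norm_transpose_B : ‖Bᵀ‖ ≤ b * √N := (l2norm_transpose B).le.trans h.norm_B

/-- The estimated eigenspace almost contains the range of `B`: in the Sylvester equation the
coefficient `Bᵀ B ≥ lam` dominates the other one, `‖A - R‖ ≤ lam / 4`. -/
theorem norm_missed_le : ‖Bᵀ * (1 - P)‖ ≤ 2 * (b * √N) * ε / lam := by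
  have hlam := h.lam_pos
  have h1 := h.norm_gram_mul_ge (Bᵀ * (1 - P))
  rw [h.sylvester hs] at h1
  have h2 := norm_sub_le (Bᵀ * (1 - P) * (A - R)) (Bᵀ * Δ * (1 - P))
  have h3 := l2norm_mul_le (le_refl ‖Bᵀ * (1 - P)‖) hs.upper
  have h4 := l2norm_mul_le (l2norm_mul_le (h.norm_transpose_B hs) h.norm_err) hs.norm_compl_le
  rw [le_div_iff₀ hlam]
  nlinarith [norm_nonneg (Bᵀ * (1 - P)), h.err_nonneg]

/-- The estimated eigenspace is almost orthogonal to the moderate part. -/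
theorem norm_proj_mul_L_le : ‖P * L‖ ≤ 4 * ‖L‖ * ε / lam := by
  have hlam := h.lam_pos
  have h1 := hs.norm_proj_mul_le hlam L
  have e : R * L = P * L * (Lᵀ * L) + P * Δ * L := by
    rw [← hs.left, h.eq, Matrix.mul_assoc P, Matrix.add_mul, Matrix.add_mul, Matrix.mul_assoc B,
      h.orth]
    simp [Matrix.mul_add, Matrix.mul_assoc]
  rw [e] at h1
  have h2 := norm_add_le (P * L * (Lᵀ * L)) (P * Δ * L)
  have hLL : ‖Lᵀ * L‖ ≤ lam / 8 := by
    refine (l2norm_mul_le (l2norm_transpose L).le le_rfl).trans ?_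
    have := h.norm_L
    rwa [pow_two] at this
  have h3 := l2norm_mul_le (le_refl ‖P * L‖) hLL
  have h4 := l2norm_mul_le (l2norm_mul_le hs.norm_proj_le h.norm_err) (le_refl ‖L‖)
  rw [le_div_iff₀ hlam]
  nlinarith [norm_nonneg (P * L), h.err_nonneg, norm_nonneg L]

theorem norm_proj_mul_rest_le : ‖P * (L * Lᵀ + Δ)‖ ≤ 2 * ε := by
  have hlam := h.lam_pos
  rw [Matrix.mul_add, ← Matrix.mul_assoc]
  have h1 := l2norm_mul_le (h.norm_proj_mul_L_le hs) (l2norm_transpose L).le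
  have h2 := l2norm_mul_le hs.norm_proj_le h.norm_err
  have h3 : 4 * ‖L‖ * ε / lam * ‖L‖ ≤ ε := by
    rw [div_mul_eq_mul_div, div_le_iff₀ hlam]
    nlinarith [h.norm_L, h.err_nonneg]
  have h4 := norm_add_le (P * L * Lᵀ) (P * Δ)
  linarith

/-- The error of the principal components, as a sum of two terms of low rank, the first one with the
estimated eigenspace on the left and the second one with the loadings on the right. -/
theorem part_sub_eq : R - B * Bᵀ = P * (L * Lᵀ + Δ) - (Bᵀ * (1 - P))ᵀ * Bᵀ := by
  have e : (Bᵀ * (1 - P))ᵀ = B - P * B := by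
    rw [transpose_mul, transpose_transpose, transpose_sub, transpose_one, hs.symm, Matrix.sub_mul,
      Matrix.one_mul]
  rw [e, ← hs.left]
  conv_lhs => rw [h.eq]
  rw [Matrix.sub_mul]
  simp only [Matrix.mul_add, Matrix.mul_assoc]
  abel

/-- Symmetric form of the error of the principal components, quadratic in the missed part of `B`.
This is what allows elementwise bounds: the factor `Bᵀ` of `FactorStep.part_sub_eq`, whose columns
are not small, does not occur. -/
theorem sub_part_eq : B * Bᵀ - R = (Bᵀ * (1 - P))ᵀ * (Bᵀ * (1 - P))
    - P * (L * Lᵀ + Δ) - (P * (L * Lᵀ + Δ))ᵀ + P * (P * (L * Lᵀ + Δ) * P) := by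
  set E := L * Lᵀ + Δ with hE
  have hEs : Eᵀ = E := by simp [hE, h.symm]
  have hA : A = B * Bᵀ + E := by rw [h.eq, hE, add_assoc]
  have e1 : (Bᵀ * (1 - P))ᵀ * (Bᵀ * (1 - P)) = (1 - P) * (A - E) * (1 - P) := by
    rw [transpose_mul, transpose_transpose, transpose_sub, transpose_one, hs.symm, hA]
    simp [Matrix.mul_assoc]
  have e2 : (1 - P) * A * (1 - P) = A - R := by
    rw [Matrix.sub_mul, Matrix.one_mul, hs.left, Matrix.mul_sub, Matrix.mul_one, Matrix.sub_mul,
      hs.right]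
    have : R * P = R := by rw [← hs.right, Matrix.mul_assoc, hs.idem]
    rw [this]; simp
  rw [e1, Matrix.mul_sub (1 - P), Matrix.sub_mul ((1 - P) * A), e2, transpose_mul, hEs, hs.symm]
  have e3 : P * (P * E * P) = P * E * P := by
    rw [Matrix.mul_assoc P E, ← Matrix.mul_assoc P P, hs.idem]
  rw [e3]
  have e4 : (1 - P) * E * (1 - P) = E - P * E - E * P + P * E * P := by
    rw [Matrix.sub_mul, Matrix.one_mul, Matrix.mul_sub, Matrix.mul_one, Matrix.sub_mul]
    abel
  rw [e4]
  have : B * Bᵀ = A - E := by rw [hA]; abel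
  rw [this]
  abel

end FactorStep

end Perturbation

/-! ### Elementwise error of the principal components -/

section Entrywise

open scoped Matrix.Norms.L2Operator

variable {n κ κ' l : Type*} [Fintype n] [DecidableEq n] [Fintype κ] [DecidableEq κ] [Fintype κ']
  [DecidableEq κ'] [Fintype l] [DecidableEq l]

/-- Bound of `Mᵀ w` by the `ℓ₁` norm of `w`. -/
theorem vecNorm_transpose_mulVec_le {M : Matrix n l ℝ} {c : ℝ}
    (h : ∀ i, vecNorm (M.row i) ≤ c) (w : n → ℝ) :
    vecNorm (Mᵀ *ᵥ w) ≤ c * ∑ i, |w i| := by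
  have e : Mᵀ *ᵥ w = ∑ i, w i • M.row i := by
    ext a
    simp [mulVec, dotProduct, Finset.sum_apply, mul_comm]
  rw [e, Finset.mul_sum]
  refine (vecNorm_sum_le _ _).trans (Finset.sum_le_sum fun i _ => ?_)
  rw [vecNorm_smul, mul_comm]
  exact mul_le_mul_of_nonneg_right (h i) (abs_nonneg _)

theorem vecNorm_le_of_abs_le {w : n → ℝ} {η N : ℝ} (hη : 0 ≤ η)
    (hN : (Fintype.card n : ℝ) ≤ N) (h : ∀ i, |w i| ≤ η) : vecNorm w ≤ √N * η := by
  have hN0 : 0 ≤ N := le_trans (by positivity) hN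
  refine abs_le_of_sq_le_sq' ?_ (by positivity) |>.2
  rw [vecNorm_sq_eq_sum, mul_pow, Real.sq_sqrt hN0]
  calc ∑ i, w i ^ 2 ≤ ∑ _i : n, η ^ 2 := by
        refine Finset.sum_le_sum fun i _ => ?_
        rw [← sq_abs]
        exact pow_le_pow_left₀ (abs_nonneg _) (h i) 2
    _ = Fintype.card n * η ^ 2 := by simp
    _ ≤ _ := by gcongr

namespace FactorStep

variable {A U E R P : Matrix n n ℝ} {B : Matrix n κ ℝ} {L : Matrix n κ' ℝ} {b N lam ε μ η : ℝ}

theorem norm_L_le (h : FactorStep A (U + E) B L b N lam ε) (hlamN : lam ≤ N) : ‖L‖ ≤ √N := by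
  have := h.lam_pos
  refine Real.le_sqrt_of_sq_le ?_
  linarith [h.norm_L]

/-- Columns of `A` are of the order `√N`. -/
theorem vecNorm_col_A_le (h : FactorStep A (U + E) B L b N lam ε) (hb : 1 ≤ b)
    (hN : (Fintype.card n : ℝ) ≤ N) (hlamN : lam ≤ N) (hB : ∀ i, vecNorm (B.row i) ≤ b)
    (hL : ∀ i, vecNorm (L.row i) ≤ b) (hU : ‖U‖ ≤ b) (hη : 0 ≤ η) (hη1 : η ≤ 1)
    (hE : ∀ i j, |E i j| ≤ η) (i : n) : vecNorm (A.col i) ≤ 4 * b ^ 2 * √N := by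
  have hN1 : 1 ≤ N := by
    have : 0 < Fintype.card n := Fintype.card_pos_iff.2 ⟨i⟩
    exact le_trans (by exact_mod_cast this) hN
  have hs : 1 ≤ √N := by rw [Real.one_le_sqrt]; exact hN1
  have e : A.col i = B *ᵥ Bᵀ.col i + L *ᵥ Lᵀ.col i + (U.col i + E.col i) := by
    rw [← col_mul, ← col_mul, h.eq]
    rfl
  rw [e]
  have h1 := vecNorm_mulVec_le_of_le h.norm_B (x := Bᵀ.col i) (hB i)
  have h2 := vecNorm_mulVec_le_of_le (h.norm_L_le hlamN) (x := Lᵀ.col i) (hL i)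
  have h3 := (vecNorm_col_le U i).trans hU
  have h4 := vecNorm_le_of_abs_le hη hN (fun j => hE j i)
  have h5 := vecNorm_add_le (B *ᵥ Bᵀ.col i + L *ᵥ Lᵀ.col i) (U.col i + E.col i)
  have h6 := vecNorm_add_le (B *ᵥ Bᵀ.col i) (L *ᵥ Lᵀ.col i)
  have h7 := vecNorm_add_le (U.col i) (E.col i)
  have h8 : vecNorm (E.col i) ≤ √N * η := h4
  have h9 : √N * η ≤ √N * 1 := by gcongr
  have h10 : b * 1 ≤ b * √N := by gcongr
  have h11 : b * √N ≤ b ^ 2 * √N := by nlinarith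
  have h12 : 1 * √N ≤ b ^ 2 * √N := by nlinarith
  nlinarith

/-- The leading eigenvectors are delocalized: columns of `P` are of the order `√N / lam`, since
`R` is at least `lam / 2` on the range of `P` and `R = P A`. -/
theorem vecNorm_col_proj_le (h : FactorStep A (U + E) B L b N lam ε)
    (hs : LeadingSplit A R P lam) {a : ℝ} (hA : ∀ i, vecNorm (A.col i) ≤ a) (i : n) :
    vecNorm (P.col i) ≤ 2 * a / lam := by
  have hlam := h.lam_pos
  have h1 := hs.vecNorm_proj_le (Pi.single i 1)
  have e : R *ᵥ Pi.single i 1 = P *ᵥ A.col i := by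
    rw [← hs.left, ← mulVec_mulVec, mulVec_single_one]
  rw [e, mulVec_single_one] at h1
  have h2 := vecNorm_mulVec_le_of_le hs.norm_proj_le (hA i)
  rw [le_div_iff₀ hlam]
  linarith

/-- The rows of the loadings are almost contained in the estimated eigenspace, uniformly. -/
theorem vecNorm_col_missed_le (h : FactorStep A (U + E) B L b N lam ε)
    (hs : LeadingSplit A R P lam) (hb : 1 ≤ b) (hN : (Fintype.card n : ℝ) ≤ N) (hlamN : lam ≤ N)
    (hB : ∀ i, vecNorm (B.row i) ≤ b) (hL : ∀ i, vecNorm (L.row i) ≤ b) (hU : ‖U‖ ≤ b)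
    (hη : 0 ≤ η) (hη1 : η ≤ 1) (hE : ∀ i j, |E i j| ≤ η) (hUs : Uᵀ = U)
    (hUrow : ∀ i, ∑ j, |U i j| ≤ μ) (hε : ε = N * η + μ) (i : n) :
    vecNorm ((Bᵀ * (1 - P)).col i) ≤ 17 * b ^ 3 * ((N / lam) ^ 2 * (ε / N)) := by
  have hlam := h.lam_pos
  have hN0 : 0 < N := hlam.trans_le hlamN
  have hA := h.vecNorm_col_A_le hb hN hlamN hB hL hU hη hη1 hE
  have hr := h.vecNorm_col_proj_le hs hA i
  have hX := h.norm_missed_le hs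
  set X := Bᵀ * (1 - P) with hXdef
  have hss : √N * √N = N := Real.mul_self_sqrt hN0.le
  have h1 := h.vecNorm_gram_ge (X.col i)
  -- the Sylvester equation, read in one column
  have e : (Bᵀ * B) *ᵥ X.col i =
      X *ᵥ A.col i - (Bᵀ *ᵥ U.col i + Bᵀ *ᵥ E.col i - (Bᵀ * (U + E)) *ᵥ P.col i) := by
    rw [← col_mul, h.sylvester hs]
    have e1 : Bᵀ * (1 - P) * (A - R) = X * A := by
      rw [Matrix.mul_sub, hXdef, Matrix.mul_assoc Bᵀ (1 - P) R, Matrix.sub_mul 1 P R,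
        hs.proj_mul_part]
      simp
    have e2 : Bᵀ * (U + E) * (1 - P) = Bᵀ * U + Bᵀ * E - Bᵀ * (U + E) * P := by
      rw [Matrix.mul_sub, Matrix.mul_one, Matrix.mul_add]
    rw [e1, e2, ← col_mul, ← col_mul, ← col_mul, ← col_mul]
    rfl
  rw [e] at h1
  have t1 := vecNorm_mulVec_le_of_le hX (hA i)
  have t2 : vecNorm (Bᵀ *ᵥ U.col i) ≤ b * μ := by
    refine (vecNorm_transpose_mulVec_le hB _).trans ?_
    have : ∑ j, |U.col i j| = ∑ j, |U i j| := by
      conv_rhs => rw [← hUs]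
      rfl
    rw [this]
    exact mul_le_mul_of_nonneg_left (hUrow i) (by linarith)
  have t3 := vecNorm_mulVec_le_of_le (h.norm_transpose_B hs)
    (x := E.col i) (vecNorm_le_of_abs_le hη hN (fun j => hE j i))
  have t4 := vecNorm_mulVec_le_of_le (l2norm_mul_le (h.norm_transpose_B hs) h.norm_err) hr
  have t5 := vecNorm_sub_le (X *ᵥ A.col i)
    (Bᵀ *ᵥ U.col i + Bᵀ *ᵥ E.col i - (Bᵀ * (U + E)) *ᵥ P.col i)
  have t6 := vecNorm_sub_le (Bᵀ *ᵥ U.col i + Bᵀ *ᵥ E.col i) ((Bᵀ * (U + E)) *ᵥ P.col i)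
  have t7 := vecNorm_add_le (Bᵀ *ᵥ U.col i) (Bᵀ *ᵥ E.col i)
  have q1 : 2 * (b * √N) * ε / lam * (4 * b ^ 2 * √N) = 8 * b ^ 3 * N * ε / lam := by
    calc _ = 8 * b ^ 3 * (√N * √N) * ε / lam := by ring
      _ = _ := by rw [hss]
  have q2 : b * √N * (√N * η) = b * N * η := by
    calc _ = b * (√N * √N) * η := by ring
      _ = _ := by rw [hss]
  have q3 : b * √N * ε * (2 * (4 * b ^ 2 * √N) / lam) = 8 * b ^ 3 * N * ε / lam := by
    calc _ = 8 * b ^ 3 * (√N * √N) * ε / lam := by ring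
      _ = _ := by rw [hss]
  have q4 : b * ε ≤ b ^ 3 * N * ε / lam := by
    rw [le_div_iff₀ hlam]
    have : b * lam ≤ b ^ 3 * N := by
      have : b ≤ b ^ 3 := by nlinarith [sq_nonneg b]
      exact mul_le_mul this hlamN hlam.le (by positivity)
    nlinarith [h.err_nonneg]
  have q5 : lam * vecNorm (X.col i) ≤ 17 * (b ^ 3 * N * ε / lam) := by
    rw [q1] at t1; rw [q2] at t3; rw [q3] at t4
    have : 8 * b ^ 3 * N * ε / lam = 8 * (b ^ 3 * N * ε / lam) := by ring
    rw [this] at t1 t4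
    have : b * N * η + b * μ = b * ε := by rw [hε]; ring
    linarith
  have q6 : 17 * b ^ 3 * ((N / lam) ^ 2 * (ε / N)) = 17 * (b ^ 3 * N * ε / lam) / lam := by
    field_simp
  rw [q6, le_div_iff₀ hlam, mul_comm]
  exact q5

/-- Elementwise error of the leading principal components. The constant collects the bounds `289 b⁶`
of the quadratic term, twice `104 b⁴` of the mixed terms and `128 b⁴` of the last term of
`FactorStep.sub_part_eq`. -/
theorem abs_part_sub_le (h : FactorStep A (U + E) B L b N lam ε)
    (hs : LeadingSplit A R P lam) (hb : 1 ≤ b) (hN : (Fintype.card n : ℝ) ≤ N) (hlamN : lam ≤ N)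
    (hB : ∀ i, vecNorm (B.row i) ≤ b) (hL : ∀ i, vecNorm (L.row i) ≤ b) (hU : ‖U‖ ≤ b)
    (hη : 0 ≤ η) (hη1 : η ≤ 1) (hE : ∀ i j, |E i j| ≤ η) (hUs : Uᵀ = U)
    (hUrow : ∀ i, ∑ j, |U i j| ≤ μ) (hε : ε = N * η + μ)
    (hsmall : (N / lam) ^ 2 * (ε / N) ≤ 1) (i j : n) :
    |(R - B * Bᵀ) i j| ≤ 700 * b ^ 6 * ((N / lam) ^ 2 * (ε / N)) := by
  have hlam := h.lam_pos
  have hN0 : 0 < N := hlam.trans_le hlamN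
  have hε0 := h.err_nonneg
  have hμ : 0 ≤ μ := (Finset.sum_nonneg fun j _ => abs_nonneg (U i j)).trans (hUrow i)
  have hA := h.vecNorm_col_A_le hb hN hlamN hB hL hU hη hη1 hE
  have hr := h.vecNorm_col_proj_le hs hA
  have hXc := h.vecNorm_col_missed_le hs hb hN hlamN hB hL hU hη hη1 hE hUs hUrow hε
  have hPL := h.norm_proj_mul_L_le hs
  have hrest := h.norm_proj_mul_rest_le hs
  set x := (N / lam) ^ 2 * (ε / N) with hx
  have hx0 : 0 ≤ x := by positivity
  set X := Bᵀ * (1 - P) with hXdef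
  set r := 2 * (4 * b ^ 2 * √N) / lam with hrdef
  have hr0 : 0 ≤ r := by positivity
  have hss : √N * √N = N := Real.mul_self_sqrt hN0.le
  have hrr : r * r = 64 * b ^ 4 * N / lam ^ 2 := by
    calc r * r = 64 * b ^ 4 * (√N * √N) / lam ^ 2 := by rw [hrdef]; field_simp; ring
      _ = _ := by rw [hss]
  have hx' : x = N * ε / lam ^ 2 := by rw [hx]; field_simp
  -- the part of the error that mixes the estimated eigenspace with the remainder
  have hmix : ∀ i j, |(P * (L * Lᵀ + (U + E))) i j| ≤ 104 * b ^ 4 * x := by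
    intro i j
    have e : P * (L * Lᵀ + (U + E)) = Pᵀ * (P * L * Lᵀ) + Pᵀ * (P * U) + Pᵀ * E := by
      rw [hs.symm, ← Matrix.mul_assoc P (P * L), ← Matrix.mul_assoc P P, ← Matrix.mul_assoc P P,
        hs.idem]
      simp [Matrix.mul_add, Matrix.mul_assoc, add_assoc]
    rw [e, Matrix.add_apply, Matrix.add_apply]
    have f1 := abs_transpose_mul_apply_le P (P * L * Lᵀ) i j
    have f2 := abs_transpose_mul_apply_le P (P * U) i j
    have f3 := abs_transpose_mul_apply_le P E i j
    have g1 : vecNorm ((P * L * Lᵀ).col j) ≤ 4 * √N * ε / lam * b := by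
      rw [col_mul]
      refine vecNorm_mulVec_le_of_le (hPL.trans ?_) (hL j)
      have := h.norm_L_le hlamN
      gcongr
    have g2 : vecNorm ((P * U).col j) ≤ r * μ := by
      rw [col_mul]
      have e2 : P *ᵥ U.col j = Pᵀ *ᵥ U.col j := by rw [hs.symm]
      rw [e2]
      have hPr : ∀ i, vecNorm (P.row i) ≤ r := by
        intro i
        have : P.row i = P.col i := by
          conv_lhs => rw [← hs.symm]
          rfl
        rw [this]; exact hr i
      refine (vecNorm_transpose_mulVec_le hPr _).trans ?_
      have : ∑ i, |U.col j i| = ∑ i, |U j i| := by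
        conv_rhs => rw [← hUs]
        rfl
      rw [this]
      exact mul_le_mul_of_nonneg_left (hUrow j) hr0
    have g3 : vecNorm (E.col j) ≤ √N * η := vecNorm_le_of_abs_le hη hN (fun a => hE a j)
    have k1 : |(Pᵀ * (P * L * Lᵀ)) i j| ≤ r * (4 * √N * ε / lam * b) :=
      f1.trans (mul_le_mul (hr i) g1 (vecNorm_nonneg _) hr0)
    have k2 : |(Pᵀ * (P * U)) i j| ≤ r * (r * μ) :=
      f2.trans (mul_le_mul (hr i) g2 (vecNorm_nonneg _) hr0)
    have k3 : |(Pᵀ * E) i j| ≤ r * (√N * η) :=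
      f3.trans (mul_le_mul (hr i) g3 (vecNorm_nonneg _) hr0)
    have m1 : r * (4 * √N * ε / lam * b) = 32 * b ^ 3 * x := by
      calc _ = 32 * b ^ 3 * (√N * √N) * ε / lam ^ 2 := by rw [hrdef]; field_simp; ring
        _ = _ := by rw [hss, hx']; ring
    have hμε : μ ≤ ε := by rw [hε]; nlinarith
    have hηε : N * η ≤ ε := by rw [hε]; linarith
    have m2 : r * (r * μ) ≤ 64 * b ^ 4 * x := by
      calc r * (r * μ) = 64 * b ^ 4 * N / lam ^ 2 * μ := by rw [← hrr]; ring
        _ ≤ 64 * b ^ 4 * N / lam ^ 2 * ε := by gcongr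
        _ = _ := by rw [hx']; ring
    have m3 : r * (√N * η) ≤ 8 * b ^ 2 * x := by
      calc r * (√N * η) = 8 * b ^ 2 * (√N * √N) * η / lam := by rw [hrdef]; ring
        _ = 8 * b ^ 2 * (N * η * lam / lam ^ 2) := by rw [hss]; field_simp
        _ ≤ 8 * b ^ 2 * (ε * N / lam ^ 2) := by gcongr
        _ = _ := by rw [hx']; ring
    have b3 : b ^ 3 ≤ b ^ 4 := pow_le_pow_right₀ hb (by norm_num)
    have b2 : b ^ 2 ≤ b ^ 4 := pow_le_pow_right₀ hb (by norm_num)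
    have a1 := abs_add_le ((Pᵀ * (P * L * Lᵀ)) i j + (Pᵀ * (P * U)) i j) ((Pᵀ * E) i j)
    have a2 := abs_add_le ((Pᵀ * (P * L * Lᵀ)) i j) ((Pᵀ * (P * U)) i j)
    have b3' : b ^ 3 * x ≤ b ^ 4 * x := by gcongr
    have b2' : b ^ 2 * x ≤ b ^ 4 * x := by gcongr
    linarith
  have hquad : |(P * (P * (L * Lᵀ + (U + E)) * P)) i j| ≤ 128 * b ^ 4 * x := by
    have f := abs_transpose_mul_apply_le P (P * (L * Lᵀ + (U + E)) * P) i j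
    rw [hs.symm] at f
    have g1 : vecNorm ((P * (L * Lᵀ + (U + E)) * P).col j) ≤ 2 * ε * r := by
      rw [col_mul]
      exact vecNorm_mulVec_le_of_le hrest (hr j)
    refine f.trans ((mul_le_mul (hr i) g1 (vecNorm_nonneg _) hr0).trans (le_of_eq ?_))
    calc r * (2 * ε * r) = 2 * ε * (r * r) := by ring
      _ = _ := by rw [hrr, hx']; ring
  have hXX : |(Xᵀ * X) i j| ≤ 289 * b ^ 6 * x := by
    refine (abs_transpose_mul_apply_le X X i j).trans ?_
    refine (mul_le_mul (hXc i) (hXc j) (vecNorm_nonneg _) (by positivity)).trans ?_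
    calc 17 * b ^ 3 * x * (17 * b ^ 3 * x) = 289 * b ^ 6 * x * x := by ring
      _ ≤ 289 * b ^ 6 * x * 1 := by gcongr
      _ = _ := by ring
  have e : (R - B * Bᵀ) i j = -((Xᵀ * X) i j - (P * (L * Lᵀ + (U + E))) i j
      - (P * (L * Lᵀ + (U + E))) j i + (P * (P * (L * Lᵀ + (U + E)) * P)) i j) := by
    have e1 : (R - B * Bᵀ) i j = -((B * Bᵀ - R) i j) := by simp
    rw [e1, h.sub_part_eq hs]
    rfl
  rw [e, abs_neg]
  have h1 := abs_le.1 (hmix i j)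
  have h2 := abs_le.1 (hmix j i)
  have h3 := abs_le.1 hquad
  have h4 := abs_le.1 hXX
  have b4 : b ^ 4 * x ≤ b ^ 6 * x := by
    have : b ^ 4 ≤ b ^ 6 := pow_le_pow_right₀ hb (by norm_num)
    gcongr
  have b6 : 0 ≤ b ^ 6 * x := by positivity
  rw [abs_le]
  constructor <;> linarith [h1.1, h1.2, h2.1, h2.2, h3.1, h3.2, h4.1, h4.2]

end FactorStep

end Entrywise

/-! ### Groupwise principal components as one block diagonal step -/

section BlockLift

open scoped Matrix.Norms.L2Operator

variable {o : Type*} [Fintype o] [DecidableEq o] {m n : o → Type*} [∀ i, Fintype (m i)]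
  [∀ i, Fintype (n i)] [∀ i, DecidableEq (m i)] [∀ i, DecidableEq (n i)]

theorem vecNorm_blockDiagonal'_mulVec_sq (A : ∀ i, Matrix (m i) (n i) ℝ) (x : (Σ i, n i) → ℝ) :
    vecNorm (blockDiagonal' A *ᵥ x) ^ 2 = ∑ j, vecNorm (A j *ᵥ fun a => x ⟨j, a⟩) ^ 2 := by
  simp only [vecNorm_sq_eq_sum, Fintype.sum_sigma, blockDiagonal'_mulVec_apply]

theorem dotProduct_blockDiagonal'_mulVec (A : ∀ i, Matrix (m i) (m i) ℝ) (x : (Σ i, m i) → ℝ) :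
    x ⬝ᵥ (blockDiagonal' A *ᵥ x) =
      ∑ j, (fun a => x ⟨j, a⟩) ⬝ᵥ (A j *ᵥ fun a => x ⟨j, a⟩) := by
  simp only [dotProduct, Fintype.sum_sigma, blockDiagonal'_mulVec_apply]

/-- Groupwise splits combine to a split of the block diagonal matrix. -/
theorem LeadingSplit.blockDiagonal' {A R P : ∀ i, Matrix (m i) (m i) ℝ} {lam : ℝ} (hlam : 0 ≤ lam)
    (h : ∀ j, LeadingSplit (A j) (R j) (P j) lam) :
    LeadingSplit (Matrix.blockDiagonal' A) (Matrix.blockDiagonal' R) (Matrix.blockDiagonal' P)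
      lam where
  symm := by
    rw [blockDiagonal'_transpose]
    exact congrArg _ (funext fun j => (h j).symm)
  idem := by
    rw [← blockDiagonal'_mul]
    exact congrArg _ (funext fun j => (h j).idem)
  left := by
    rw [← blockDiagonal'_mul]
    exact congrArg _ (funext fun j => (h j).left)
  right := by
    rw [← blockDiagonal'_mul]
    exact congrArg _ (funext fun j => (h j).right)
  lower y := by
    rw [vecNorm_blockDiagonal'_mulVec_sq, dotProduct_blockDiagonal'_mulVec, Finset.mul_sum]
    exact Finset.sum_le_sum fun j _ => (h j).lower _
  upper := by
    rw [← blockDiagonal'_sub]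
    exact l2norm_blockDiagonal'_le (by positivity) fun j => (h j).upper

/-- Groupwise factor steps combine to a factor step of the block diagonal matrix, with the same
bounds. There is no moderate part, which is encoded by a matrix without columns. The bounds on `ε`
and `lam` are assumed separately since there may be no group. -/
theorem FactorStep.blockDiagonal' {A Δ : ∀ i, Matrix (m i) (m i) ℝ}
    {B : ∀ i, Matrix (m i) (n i) ℝ} {b N lam ε : ℝ} (hlam : 0 < lam) (hb : 0 ≤ b) (hε : 0 ≤ ε)
    (hεlam : ε ≤ lam / 16)
    (h : ∀ j, FactorStep (A j) (Δ j) (B j) (0 : Matrix (m j) (Fin 0) ℝ) b N lam ε) :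
    FactorStep (Matrix.blockDiagonal' A) (Matrix.blockDiagonal' Δ) (Matrix.blockDiagonal' B)
      (0 : Matrix (Σ i, m i) (Fin 0) ℝ) b N lam ε where
  eq := by
    rw [blockDiagonal'_transpose, ← blockDiagonal'_mul, Matrix.zero_mul, add_zero,
      ← blockDiagonal'_add]
    refine congrArg _ (funext fun j => ?_)
    simpa using (h j).eq
  symm := by
    rw [blockDiagonal'_transpose]
    exact congrArg _ (funext fun j => (h j).symm)
  orth := by simp
  lam_pos := hlam
  norm_B := l2norm_blockDiagonal'_le (by positivity) fun j => (h j).norm_B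
  norm_L := by simp; positivity
  norm_err := l2norm_blockDiagonal'_le hε fun j => (h j).norm_err
  err_le := hεlam
  lower c := by
    rw [vecNorm_blockDiagonal'_mulVec_sq, vecNorm_sq_eq_sum, Fintype.sum_sigma, Finset.mul_sum]
    refine Finset.sum_le_sum fun j _ => ?_
    rw [← vecNorm_sq_eq_sum (fun a => c ⟨j, a⟩)]
    exact (h j).lower _

end BlockLift

/-! ### Inverses -/

section Inverse

open scoped Matrix.Norms.L2Operator

variable {n κ κ' l : Type*} [Fintype n] [DecidableEq n] [Fintype κ] [DecidableEq κ] [Fintype κ']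
  [DecidableEq κ'] [Fintype l] [DecidableEq l]

theorem vecNorm_mulVec_ge_of_form {M : Matrix n n ℝ} {c : ℝ}
    (h : ∀ y, c * vecNorm y ^ 2 ≤ y ⬝ᵥ (M *ᵥ y)) (y : n → ℝ) :
    c * vecNorm y ≤ vecNorm (M *ᵥ y) := by
  have h1 := h y
  have h2 := dotProduct_le_vecNorm y (M *ᵥ y)
  rcases eq_or_lt_of_le (vecNorm_nonneg y) with h0 | h0
  · rw [← h0, mul_zero]; exact vecNorm_nonneg _
  · refine le_of_mul_le_mul_right ?_ h0
    nlinarith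

theorem isUnit_det_of_form {M : Matrix n n ℝ} {c : ℝ} (hc : 0 < c)
    (h : ∀ y, c * vecNorm y ^ 2 ≤ y ⬝ᵥ (M *ᵥ y)) : IsUnit M.det := by
  rw [← Matrix.isUnit_iff_isUnit_det, ← Matrix.mulVec_injective_iff_isUnit]
  refine (injective_iff_map_eq_zero M.mulVecLin).2 fun y hy => ?_
  have h1 := vecNorm_mulVec_ge_of_form h y
  have h2 : M *ᵥ y = 0 := hy
  rw [h2, vecNorm_zero] at h1
  have h3 := vecNorm_nonneg y
  exact vecNorm_eq_zero.1 (le_antisymm (by nlinarith) h3)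

/-- A bound for `M⁻¹ * C` from a bound for the solutions of `M y = C x`. -/
theorem l2norm_inv_mul_le {M : Matrix n n ℝ} (hM : IsUnit M.det) {C : Matrix n l ℝ} {a : ℝ}
    (ha : 0 ≤ a) (h : ∀ x y, M *ᵥ y = C *ᵥ x → vecNorm y ≤ a * vecNorm x) : ‖M⁻¹ * C‖ ≤ a := by
  refine l2norm_le_of_mulVec ha fun x => h x _ ?_
  rw [mulVec_mulVec, ← Matrix.mul_assoc, Matrix.mul_nonsing_inv _ hM, Matrix.one_mul]

theorem l2norm_inv_le_of_form {M : Matrix n n ℝ} {c : ℝ} (hc : 0 < c)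
    (h : ∀ y, c * vecNorm y ^ 2 ≤ y ⬝ᵥ (M *ᵥ y)) : ‖M⁻¹‖ ≤ 1 / c := by
  have := l2norm_inv_mul_le (isUnit_det_of_form hc h) (C := (1 : Matrix n n ℝ))
    (a := 1 / c) (by positivity) (fun x y hxy => by
      have h1 := vecNorm_mulVec_ge_of_form h y
      rw [hxy, one_mulVec] at h1
      rw [div_mul_eq_mul_div, le_div_iff₀ hc]
      linarith)
  rwa [Matrix.mul_one] at this

theorem inv_sub_inv_eq {S T : Matrix n n ℝ} (hS : IsUnit S.det) (hT : IsUnit T.det) :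
    S⁻¹ - T⁻¹ = S⁻¹ * (T - S) * T⁻¹ := by
  rw [Matrix.mul_sub, Matrix.sub_mul, Matrix.nonsing_inv_mul _ hS, Matrix.mul_assoc,
    Matrix.mul_nonsing_inv _ hT]
  simp

/-- The lower bound of a quadratic form survives a small perturbation. -/
theorem form_ge_of_norm_sub_le {U W : Matrix n n ℝ} {d : ℝ}
    (hU : ∀ y, d * vecNorm y ^ 2 ≤ y ⬝ᵥ (U *ᵥ y)) (h : ‖W - U‖ ≤ d / 2) (y : n → ℝ) :
    d / 2 * vecNorm y ^ 2 ≤ y ⬝ᵥ (W *ᵥ y) := by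
  have e : y ⬝ᵥ (W *ᵥ y) = y ⬝ᵥ (U *ᵥ y) + y ⬝ᵥ ((W - U) *ᵥ y) := by
    rw [sub_mulVec, dotProduct_sub]; ring
  have h1 := (abs_le.1 (abs_dotProduct_le_vecNorm y ((W - U) *ᵥ y))).1
  have h2 := vecNorm_mulVec_le_of_le h (le_refl (vecNorm y))
  rw [e]
  nlinarith [hU y, vecNorm_nonneg y]

/-- The inverse covariance matrix is small on the range of the loadings. -/
theorem vecNorm_le_of_cov_mulVec_eq {B : Matrix n κ ℝ} {L : Matrix n κ' ℝ} {U : Matrix n n ℝ}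
    {b d lam : ℝ} (horth : Bᵀ * L = 0) (hd0 : 0 < d)
    (hd : ∀ y, d * vecNorm y ^ 2 ≤ y ⬝ᵥ (U *ᵥ y)) (hU : ‖U‖ ≤ b) (hlam : 0 < lam)
    (hB : ∀ c, lam * vecNorm c ^ 2 ≤ vecNorm (B *ᵥ c) ^ 2) {x : κ → ℝ} {y : n → ℝ}
    (h : (B * Bᵀ + L * Lᵀ + U) *ᵥ y = B *ᵥ x) : vecNorm y ≤ b / (d * √lam) * vecNorm x := by
  have hb : 0 ≤ b := (norm_nonneg _).trans hU
  set u := Bᵀ *ᵥ y with hu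
  set z := x - u with hz
  have hy0 := vecNorm_nonneg y
  have hu0 := vecNorm_nonneg u
  have hz0 := vecNorm_nonneg z
  have hx0 := vecNorm_nonneg x
  have e0 : y ⬝ᵥ ((B * Bᵀ + L * Lᵀ + U) *ᵥ y) =
      vecNorm u ^ 2 + vecNorm (Lᵀ *ᵥ y) ^ 2 + y ⬝ᵥ (U *ᵥ y) := by
    rw [hu, vecNorm_mulVec_sq, vecNorm_mulVec_sq, add_mulVec, add_mulVec, dotProduct_add,
      dotProduct_add, transpose_transpose, transpose_transpose]
  have e1 : y ⬝ᵥ (B *ᵥ x) = u ⬝ᵥ x := by rw [dotProduct_mulVec_transpose]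
  rw [h, e1] at e0
  -- the equation, multiplied by `Bᵀ`
  have e2 : (Bᵀ * B) *ᵥ z = Bᵀ *ᵥ (U *ᵥ y) := by
    have h2 : Bᵀ *ᵥ ((B * Bᵀ + L * Lᵀ + U) *ᵥ y) = Bᵀ *ᵥ (B *ᵥ x) := by rw [h]
    have h3 : Bᵀ * (B * Bᵀ + L * Lᵀ + U) = Bᵀ * B * Bᵀ + Bᵀ * U := by
      rw [Matrix.mul_add, Matrix.mul_add, ← Matrix.mul_assoc Bᵀ L, horth]
      simp [Matrix.mul_assoc]
    rw [mulVec_mulVec, h3, add_mulVec, mulVec_mulVec] at h2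
    rw [hz, hu, mulVec_sub, ← h2, mulVec_mulVec, mulVec_mulVec]
    abel
  have h4 : vecNorm (B *ᵥ z) ≤ b * vecNorm y := by
    have h5 : vecNorm (B *ᵥ z) ^ 2 = (B *ᵥ z) ⬝ᵥ (U *ᵥ y) := by
      rw [vecNorm_mulVec_sq, e2, dotProduct_mulVec_transpose, transpose_transpose]
    have h6 := dotProduct_le_vecNorm (B *ᵥ z) (U *ᵥ y)
    have h7 := vecNorm_mulVec_le_of_le hU (le_refl (vecNorm y))
    have h8 := vecNorm_nonneg (B *ᵥ z)
    have h9 : 0 ≤ b * vecNorm y := by positivity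
    nlinarith
  have h5 : √lam * vecNorm z ≤ b * vecNorm y := by
    refine le_trans ?_ h4
    refine abs_le_of_sq_le_sq' ?_ (vecNorm_nonneg _) |>.2
    rw [mul_pow, Real.sq_sqrt hlam.le]
    exact hB z
  have h6 : vecNorm u ≤ vecNorm x := by
    have := dotProduct_le_vecNorm u x
    have := hd y
    nlinarith [sq_nonneg (vecNorm (Lᵀ *ᵥ y)), sq_nonneg (vecNorm y)]
  have h7 : d * vecNorm y ^ 2 ≤ vecNorm u * vecNorm z := by
    have e3 : u ⬝ᵥ x = vecNorm u ^ 2 + u ⬝ᵥ z := by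
      rw [hz, dotProduct_sub, vecNorm_sq]; ring
    have := dotProduct_le_vecNorm u z
    have := hd y
    nlinarith [sq_nonneg (vecNorm (Lᵀ *ᵥ y))]
  have hs : 0 < √lam := Real.sqrt_pos.2 hlam
  rw [div_mul_eq_mul_div, le_div_iff₀ (by positivity)]
  rcases eq_or_lt_of_le hy0 with h0 | h0
  · rw [← h0, zero_mul]; positivity
  · refine le_of_mul_le_mul_right ?_ h0
    calc vecNorm y * (d * √lam) * vecNorm y = √lam * (d * vecNorm y ^ 2) := by ring
      _ ≤ √lam * (vecNorm u * vecNorm z) := by gcongr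
      _ = vecNorm u * (√lam * vecNorm z) := by ring
      _ ≤ vecNorm x * (b * vecNorm y) := by gcongr
      _ = _ := by ring

/-- The inverse of the estimator `R₁ + R₂ + W` is small on the range of the estimated eigenspace
of the first level, provided that it is not too close to the one of the second level. -/
theorem LeadingSplit.vecNorm_le_of_mulVec_eq {A₁ R₁ P₁ A₂ R₂ P₂ W : Matrix n n ℝ}
    {lam₁ lam₂ c w : ℝ} (h₁ : LeadingSplit A₁ R₁ P₁ lam₁) (h₂ : LeadingSplit A₂ R₂ P₂ lam₂)
    (hlam₁ : 0 < lam₁) (hlam₂ : 0 ≤ lam₂) (hc : 0 < c)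
    (hW : ∀ y, c * vecNorm y ^ 2 ≤ y ⬝ᵥ (W *ᵥ y)) (hw : ‖W‖ ≤ w) (hP : ‖P₂ * P₁‖ ≤ 1 / 2)
    {x y : n → ℝ} (h : (R₁ + R₂ + W) *ᵥ y = P₁ *ᵥ x) :
    vecNorm y ≤ 4 * w / (c * lam₁) * vecNorm x := by
  have hw0 : 0 ≤ w := (norm_nonneg _).trans hw
  set u := P₁ *ᵥ y with hu
  set z := P₁ *ᵥ x - R₁ *ᵥ y with hz
  have hy0 := vecNorm_nonneg y
  have hu0 := vecNorm_nonneg u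
  have hz0 := vecNorm_nonneg z
  have hx0 := vecNorm_nonneg x
  have hz1 : z = R₂ *ᵥ y + W *ᵥ y := by
    rw [hz, ← h, add_mulVec, add_mulVec]; abel
  have hPz : P₁ *ᵥ z = z := by
    rw [hz, mulVec_sub, mulVec_mulVec, mulVec_mulVec, h₁.idem, h₁.proj_mul_part]
  have hR₂ : 0 ≤ y ⬝ᵥ (R₂ *ᵥ y) := le_trans (by positivity) (h₂.lower y)
  -- away from the second eigenspace, `z` is an image of `W` only
  have q1 : vecNorm z ≤ 2 * w * vecNorm y := by
    have e1 : (1 - P₂) *ᵥ z = (1 - P₂) *ᵥ (W *ᵥ y) := by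
      rw [hz1, mulVec_add, mulVec_mulVec, Matrix.sub_mul, h₂.proj_mul_part]
      simp
    have e2 : z = (1 - P₂) *ᵥ (W *ᵥ y) + (P₂ * P₁) *ᵥ z := by
      rw [← e1, ← mulVec_mulVec, hPz, sub_mulVec, one_mulVec]; abel
    have t1 := vecNorm_add_le ((1 - P₂) *ᵥ (W *ᵥ y)) ((P₂ * P₁) *ᵥ z)
    rw [← e2] at t1
    have t2 := vecNorm_mulVec_le_of_le hP (le_refl (vecNorm z))
    have t3 := vecNorm_mulVec_le_of_le h₂.norm_compl_le
      (vecNorm_mulVec_le_of_le hw (le_refl (vecNorm y)))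
    linarith
  have q2 : c * vecNorm y ≤ 2 * w * vecNorm u := by
    have t1 : y ⬝ᵥ z = u ⬝ᵥ z := by
      conv_lhs => rw [← hPz, dotProduct_mulVec_transpose, h₁.symm]
    have t2 := dotProduct_le_vecNorm u z
    have t3 := hW y
    have t4 : y ⬝ᵥ z = y ⬝ᵥ (R₂ *ᵥ y) + y ⬝ᵥ (W *ᵥ y) := by rw [hz1, dotProduct_add]
    have t5 : c * vecNorm y ^ 2 ≤ vecNorm u * (2 * w * vecNorm y) := by
      have : vecNorm u * vecNorm z ≤ vecNorm u * (2 * w * vecNorm y) := by gcongr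
      linarith
    rcases eq_or_lt_of_le hy0 with h0 | h0
    · rw [← h0, mul_zero]; positivity
    · refine le_of_mul_le_mul_right ?_ h0
      nlinarith
  have q3 : lam₁ * vecNorm u ≤ 2 * vecNorm x := by
    have t1 := h₁.lower y
    have t2 : y ⬝ᵥ ((R₁ + R₂ + W) *ᵥ y) = u ⬝ᵥ x := by
      rw [h, dotProduct_mulVec_transpose, h₁.symm]
    rw [add_mulVec, add_mulVec, dotProduct_add, dotProduct_add] at t2
    have t3 := dotProduct_le_vecNorm u x
    have t4 := hW y
    have t5 : lam₁ / 2 * vecNorm u ^ 2 ≤ vecNorm u * vecNorm x := by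
      have : 0 ≤ c * vecNorm y ^ 2 := by positivity
      linarith
    rcases eq_or_lt_of_le hu0 with h0 | h0
    · rw [← h0, mul_zero]; positivity
    · refine le_of_mul_le_mul_right ?_ h0
      nlinarith
  rw [div_mul_eq_mul_div, le_div_iff₀ (by positivity)]
  calc vecNorm y * (c * lam₁) = lam₁ * (c * vecNorm y) := by ring
    _ ≤ lam₁ * (2 * w * vecNorm u) := by gcongr
    _ = 2 * w * (lam₁ * vecNorm u) := by ring
    _ ≤ 2 * w * (2 * vecNorm x) := by gcongr
    _ = _ := by ring

/-- The estimated eigenspaces of the two levels are nearly orthogonal. -/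
theorem FactorStep.norm_proj_mul_proj_le {A₁ Δ₁ R₁ P₁ A₂ Δ₂ R₂ P₂ : Matrix n n ℝ}
    {B : Matrix n κ ℝ} {L : Matrix n κ' ℝ} {b N₁ N₂ lam₁ lam₂ ε₁ ε₂ : ℝ}
    (f₁ : FactorStep A₁ Δ₁ B L b N₁ lam₁ ε₁) (h₁ : LeadingSplit A₁ R₁ P₁ lam₁)
    (f₂ : FactorStep A₂ Δ₂ L (0 : Matrix n (Fin 0) ℝ) b N₂ lam₂ ε₂)
    (h₂ : LeadingSplit A₂ R₂ P₂ lam₂) (hN₂ : 0 ≤ N₂) :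
    ‖P₂ * P₁‖ ≤ 2 * (4 * (b ^ 2 * N₂) * (ε₁ / lam₁) + ε₂) / lam₂ := by
  have hlam₁ := f₁.lam_pos
  have hlam₂ := f₂.lam_pos
  have t1 := h₂.norm_proj_mul_le hlam₂ P₁
  have e : R₂ * P₁ = P₂ * (L * (P₁ * L)ᵀ) + P₂ * (Δ₂ * P₁) := by
    rw [← h₂.left, f₂.eq, transpose_mul, h₁.symm]
    simp [Matrix.mul_add, Matrix.add_mul, Matrix.mul_assoc]
  have hPL := f₁.norm_proj_mul_L_le h₁
  have t2 : ‖P₂ * (L * (P₁ * L)ᵀ)‖ ≤ 4 * (b ^ 2 * N₂) * (ε₁ / lam₁) := by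
    have s1 := l2norm_mul_le h₂.norm_proj_le
      (l2norm_mul_le (le_refl ‖L‖) ((l2norm_transpose (P₁ * L)).le.trans hPL))
    refine s1.trans ?_
    have s2 : ‖L‖ * ‖L‖ ≤ b ^ 2 * N₂ := by
      calc ‖L‖ * ‖L‖ ≤ (b * √N₂) * (b * √N₂) :=
            mul_le_mul f₂.norm_B f₂.norm_B (norm_nonneg _) ((norm_nonneg _).trans f₂.norm_B)
        _ = b ^ 2 * (√N₂ * √N₂) := by ring
        _ = _ := by rw [Real.mul_self_sqrt hN₂]
    have s3 : 0 ≤ ε₁ / lam₁ := div_nonneg f₁.err_nonneg hlam₁.le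
    calc 1 * (‖L‖ * (4 * ‖L‖ * ε₁ / lam₁)) = 4 * (‖L‖ * ‖L‖) * (ε₁ / lam₁) := by ring
      _ ≤ _ := by gcongr
  have t3 := l2norm_mul_le h₂.norm_proj_le (l2norm_mul_le f₂.norm_err h₁.norm_proj_le)
  have t4 := norm_add_le (P₂ * (L * (P₁ * L)ᵀ)) (P₂ * (Δ₂ * P₁))
  rw [← e] at t4
  rw [le_div_iff₀ hlam₂]
  linarith

/-- The contribution of one level to the error of the inverse. -/
theorem FactorStep.norm_inv_mul_part_sub_mul_inv_le {A Δ R P S T : Matrix n n ℝ}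
    {B : Matrix n κ ℝ} {L : Matrix n κ' ℝ} {b N lam ε s t u v : ℝ}
    (f : FactorStep A Δ B L b N lam ε) (h : LeadingSplit A R P lam)
    (hS : ‖S⁻¹‖ ≤ s) (hSP : ‖S⁻¹ * P‖ ≤ u) (hT : ‖T⁻¹‖ ≤ t) (hBT : ‖Bᵀ * T⁻¹‖ ≤ v) :
    ‖S⁻¹ * (R - B * Bᵀ) * T⁻¹‖ ≤ 2 * u * t * ε + s * (2 * (b * √N) * ε / lam) * v := by
  have e : S⁻¹ * (R - B * Bᵀ) * T⁻¹ = S⁻¹ * P * (P * (L * Lᵀ + Δ)) * T⁻¹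
      - S⁻¹ * (Bᵀ * (1 - P))ᵀ * (Bᵀ * T⁻¹) := by
    have e1 : P * (P * (L * Lᵀ + Δ)) = P * (L * Lᵀ + Δ) := by
      rw [← Matrix.mul_assoc, h.idem]
    rw [f.part_sub_eq h, Matrix.mul_sub, Matrix.sub_mul, Matrix.mul_assoc S⁻¹ P, e1]
    simp only [Matrix.mul_assoc]
  rw [e]
  have t1 := l2norm_mul_le (l2norm_mul_le hSP (f.norm_proj_mul_rest_le h)) hT
  have t2 := l2norm_mul_le (l2norm_mul_le hS
    ((l2norm_transpose (Bᵀ * (1 - P))).le.trans (f.norm_missed_le h))) hBT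
  have t3 := norm_sub_le (S⁻¹ * P * (P * (L * Lᵀ + Δ)) * T⁻¹)
    (S⁻¹ * (Bᵀ * (1 - P))ᵀ * (Bᵀ * T⁻¹))
  calc _ ≤ u * (2 * ε) * t + s * (2 * (b * √N) * ε / lam) * v := by linarith
    _ = _ := by ring

end Inverse

/-! ### The relative Frobenius norm -/

section InvSqrt

variable {n : Type*} [Fintype n] [DecidableEq n]

/-- Lower bound of the spectrum from the quadratic form. -/
theorem spectrum_ge_of_form {T : Matrix n n ℝ} {d : ℝ}
    (h : ∀ y, d * vecNorm y ^ 2 ≤ y ⬝ᵥ (T *ᵥ y)) {x : ℝ} (hx : x ∈ spectrum ℝ T) : d ≤ x := by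
  by_contra hlt
  push Not at hlt
  rw [spectrum.mem_iff] at hx
  refine hx ?_
  rw [← IsUnit.neg_iff, neg_sub, Matrix.isUnit_iff_isUnit_det]
  refine isUnit_det_of_form (c := d - x) (by linarith) fun y => ?_
  have e : y ⬝ᵥ ((T - algebraMap ℝ _ x) *ᵥ y) = y ⬝ᵥ (T *ᵥ y) - x * vecNorm y ^ 2 := by
    rw [sub_mulVec, dotProduct_sub, algebraMap_eq_diagonal, vecNorm_sq]
    congr 1
    simp only [dotProduct, mulVec_diagonal, Finset.mul_sum, Pi.algebraMap_apply,
      Algebra.algebraMap_self_apply]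
    exact Finset.sum_congr rfl fun i _ => by ring
  rw [e]
  linarith [h y]

theorem invSqrt_transpose (T : Matrix n n ℝ) : (invSqrt T)ᵀ = invSqrt T := by
  have h : IsSelfAdjoint (invSqrt T) := cfc_predicate _ _
  rw [← conjTranspose_eq_transpose_of_trivial]
  exact h

theorem invSqrt_mul_self_mul_invSqrt {T : Matrix n n ℝ} (hT : Tᵀ = T) {d : ℝ} (hd : 0 < d)
    (h : ∀ y, d * vecNorm y ^ 2 ≤ y ⬝ᵥ (T *ᵥ y)) : invSqrt T * T * invSqrt T = 1 := by
  have hsa : IsSelfAdjoint T := by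
    rw [IsSelfAdjoint, star_eq_conjTranspose, conjTranspose_eq_transpose_of_trivial, hT]
  have hpos : ∀ x ∈ spectrum ℝ T, 0 < x := fun x hx => hd.trans_le (spectrum_ge_of_form h hx)
  have hc : ContinuousOn (fun x : ℝ => (√x)⁻¹) (spectrum ℝ T) :=
    ContinuousOn.inv₀ Real.continuous_sqrt.continuousOn
      fun x hx => (Real.sqrt_pos.2 (hpos x hx)).ne'
  have e : invSqrt T * T * invSqrt T = cfc (fun x : ℝ => (√x)⁻¹ * x * (√x)⁻¹) T := by
    rw [cfc_mul (fun x : ℝ => (√x)⁻¹ * x) (fun x : ℝ => (√x)⁻¹) T (hc.mul continuousOn_id) hc,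
      cfc_mul (fun x : ℝ => (√x)⁻¹) (fun x : ℝ => x) T hc continuousOn_id, cfc_id' ℝ T]
    rfl
  rw [e, cfc_congr (g := fun _ => (1 : ℝ)), cfc_const_one ℝ T]
  intro x hx
  have h0 := Real.sqrt_pos.2 (hpos x hx)
  have h1 := Real.mul_self_sqrt (hpos x hx).le
  have : (√x)⁻¹ * x * (√x)⁻¹ = (√x)⁻¹ * (√x * √x) * (√x)⁻¹ := by rw [h1]
  change (√x)⁻¹ * x * (√x)⁻¹ = 1
  rw [this]
  field_simp

end InvSqrt

section Frobenius

open scoped Matrix.Norms.L2Operator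

variable {m n κ κ' l : Type*} [Fintype m] [DecidableEq m] [Fintype n] [DecidableEq n] [Fintype κ]
  [DecidableEq κ] [Fintype κ'] [DecidableEq κ'] [Fintype l] [DecidableEq l]

theorem frobNorm_sq_eq_sum (A : Matrix m n ℝ) :
    frobNorm A ^ 2 = ∑ j, vecNorm (A.col j) ^ 2 := by
  have : (Aᵀ * A).trace = ∑ j, vecNorm (A.col j) ^ 2 := by
    simp only [vecNorm_sq]
    rfl
  rw [frobNorm, this, Real.sq_sqrt (Finset.sum_nonneg fun j _ => sq_nonneg _)]

theorem frobNorm_nonneg (A : Matrix m n ℝ) : 0 ≤ frobNorm A := Real.sqrt_nonneg _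

theorem frobNorm_eq_vecNorm (A : Matrix m n ℝ) :
    frobNorm A = vecNorm (fun ij : n × m => A ij.2 ij.1) := by
  have : frobNorm A ^ 2 = vecNorm (fun ij : n × m => A ij.2 ij.1) ^ 2 := by
    rw [frobNorm_sq_eq_sum, vecNorm_sq_eq_sum, Fintype.sum_prod_type]
    simp only [vecNorm_sq_eq_sum]
    rfl
  exact (pow_left_inj₀ (frobNorm_nonneg _) (vecNorm_nonneg _) two_ne_zero).1 this

theorem frobNorm_add_le (A B : Matrix m n ℝ) : frobNorm (A + B) ≤ frobNorm A + frobNorm B := by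
  simp only [frobNorm_eq_vecNorm]
  exact vecNorm_add_le _ _

theorem frobNorm_sub_le (A B : Matrix m n ℝ) : frobNorm (A - B) ≤ frobNorm A + frobNorm B := by
  simp only [frobNorm_eq_vecNorm]
  exact vecNorm_sub_le _ _

theorem frobNorm_transpose (A : Matrix m n ℝ) : frobNorm Aᵀ = frobNorm A := by
  rw [frobNorm, transpose_transpose, Matrix.trace_mul_comm, frobNorm]

theorem frobNorm_mul_le (A : Matrix m n ℝ) (B : Matrix n l ℝ) :
    frobNorm (A * B) ≤ ‖A‖ * frobNorm B := by
  refine abs_le_of_sq_le_sq' ?_ (mul_nonneg (norm_nonneg _) (frobNorm_nonneg _)) |>.2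
  rw [mul_pow, frobNorm_sq_eq_sum, frobNorm_sq_eq_sum, Finset.mul_sum]
  refine Finset.sum_le_sum fun j _ => ?_
  rw [col_mul, ← mul_pow]
  exact pow_le_pow_left₀ (vecNorm_nonneg _) (vecNorm_mulVec_le _ _) 2

theorem frobNorm_mul_le' (A : Matrix m n ℝ) (B : Matrix n l ℝ) :
    frobNorm (A * B) ≤ frobNorm A * ‖B‖ := by
  rw [← frobNorm_transpose, transpose_mul, ← frobNorm_transpose A, ← l2norm_transpose B, mul_comm]
  exact frobNorm_mul_le _ _

theorem frobNorm_le_sqrt_card (A : Matrix m n ℝ) : frobNorm A ≤ √(Fintype.card n) * ‖A‖ := by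
  refine abs_le_of_sq_le_sq' ?_ (by positivity) |>.2
  rw [mul_pow, frobNorm_sq_eq_sum, Real.sq_sqrt (by positivity)]
  calc ∑ j, vecNorm (A.col j) ^ 2 ≤ ∑ _j : n, ‖A‖ ^ 2 :=
        Finset.sum_le_sum fun j _ => pow_le_pow_left₀ (vecNorm_nonneg _) (vecNorm_col_le A j) 2
    _ = _ := by simp

/-- If `G Gᵀ ≤ T`, then `Gᵀ` is a contraction after `H = T^{-1/2}`. -/
theorem norm_transpose_mul_le_one_of_form {T : Matrix n n ℝ} {G : Matrix n κ ℝ}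
    (hG : ∀ y, vecNorm (Gᵀ *ᵥ y) ^ 2 ≤ y ⬝ᵥ (T *ᵥ y)) {H : Matrix n n ℝ} (hHs : Hᵀ = H)
    (hH : H * T * H = 1) : ‖Gᵀ * H‖ ≤ 1 := by
  refine l2norm_le_of_mulVec zero_le_one fun x => ?_
  refine abs_le_of_sq_le_sq' ?_ (by have := vecNorm_nonneg x; positivity) |>.2
  rw [← mulVec_mulVec, one_mul]
  refine (hG _).trans (le_of_eq ?_)
  have : (H *ᵥ x) ⬝ᵥ (T *ᵥ (H *ᵥ x)) = x ⬝ᵥ ((H * T * H) *ᵥ x) := by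
    rw [← mulVec_mulVec, ← mulVec_mulVec, dotProduct_mulVec_transpose H x, hHs]
  rw [this, hH, one_mulVec, vecNorm_sq]

/-- `T^{-1/2}` is bounded by `d^{-1/2}` for `T ≥ d`. -/
theorem l2norm_le_of_sandwich {T H : Matrix n n ℝ} {d : ℝ} (hd : 0 < d)
    (h : ∀ y, d * vecNorm y ^ 2 ≤ y ⬝ᵥ (T *ᵥ y)) (hHs : Hᵀ = H) (hH : H * T * H = 1) :
    ‖H‖ ≤ 1 / √d := by
  have h1 := norm_transpose_mul_le_one_of_form (T := T) (G := √d • (1 : Matrix n n ℝ))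
    (fun y => by
      rw [transpose_smul, transpose_one, smul_mulVec, one_mulVec, vecNorm_smul, mul_pow, sq_abs,
        Real.sq_sqrt hd.le]
      exact h y) hHs hH
  rw [transpose_smul, transpose_one, smul_mul, Matrix.one_mul, norm_smul, Real.norm_eq_abs,
    abs_of_nonneg (Real.sqrt_nonneg _)] at h1
  rw [le_div_iff₀ (Real.sqrt_pos.2 hd), mul_comm]
  exact h1

/-- The contribution of one level to the relative Frobenius error. -/
theorem FactorStep.frobNorm_sandwich_le {A Δ R P H : Matrix n n ℝ}
    {B : Matrix n κ ℝ} {L : Matrix n κ' ℝ} {b N lam ε β ρ : ℝ}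
    (f : FactorStep A Δ B L b N lam ε) (h : LeadingSplit A R P lam) (hHs : Hᵀ = H)
    (hH : ‖H‖ ≤ β) (hBH : ‖Bᵀ * H‖ ≤ 1) (hP : P.trace ≤ ρ) (hκ : (Fintype.card κ : ℝ) ≤ ρ) :
    frobNorm (H * (R - B * Bᵀ) * H) ≤
      √ρ * (6 * β * (b * √N) * ε / lam + 8 * β ^ 2 * ε ^ 2 / lam) := by
  have hlam := f.lam_pos
  have hε := f.err_nonneg
  have hβ : 0 ≤ β := (norm_nonneg _).trans hH
  have hbN : 0 ≤ b * √N := (norm_nonneg _).trans f.norm_B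
  set M := P * (L * Lᵀ + Δ) with hM
  set X := Bᵀ * (1 - P) with hX
  have hrest := f.norm_proj_mul_rest_le h
  have hPM : P * M = M := by rw [hM, ← Matrix.mul_assoc, h.idem]
  -- the projection is small in the metric of the inverse covariance matrix
  have hPH : ‖P * H‖ ≤ 2 * (b * √N + 2 * ε * β) / lam := by
    have t1 := h.norm_proj_mul_le hlam H
    have e : R * H = P * (B * (Bᵀ * H)) + M * H := by
      rw [← h.left, f.eq, hM, ← Matrix.mul_assoc B, ← Matrix.mul_assoc P, ← Matrix.add_mul,
        ← Matrix.mul_add, add_assoc]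
    have t2 := l2norm_mul_le h.norm_proj_le (l2norm_mul_le f.norm_B hBH)
    have t3 := l2norm_mul_le hrest hH
    have t4 := norm_add_le (P * (B * (Bᵀ * H))) (M * H)
    rw [← e] at t4
    rw [le_div_iff₀ hlam]
    linarith
  have hHP : ‖H * P‖ ≤ 2 * (b * √N + 2 * ε * β) / lam := by
    rw [← l2norm_transpose, transpose_mul, h.symm, hHs]
    exact hPH
  have hPF : frobNorm P ≤ √ρ := by
    rw [frobNorm, h.symm, h.idem]
    exact Real.sqrt_le_sqrt hP
  have hXF : frobNorm Xᵀ ≤ √ρ * (2 * (b * √N) * ε / lam) := by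
    refine (frobNorm_le_sqrt_card _).trans ?_
    refine mul_le_mul (Real.sqrt_le_sqrt hκ) ?_ (norm_nonneg _) (Real.sqrt_nonneg _)
    exact (l2norm_transpose X).le.trans (f.norm_missed_le h)
  have e : H * (R - B * Bᵀ) * H = H * P * (P * (M * H)) - H * (Xᵀ * (Bᵀ * H)) := by
    have e1 : P * (P * (M * H)) = M * H := by
      rw [← Matrix.mul_assoc, h.idem, ← Matrix.mul_assoc, hPM]
    rw [f.part_sub_eq h, Matrix.mul_sub, Matrix.sub_mul, Matrix.mul_assoc H P, e1]
    simp only [Matrix.mul_assoc, hX, hM]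
  rw [e]
  have t1 : frobNorm (H * P * (P * (M * H))) ≤
      2 * (b * √N + 2 * ε * β) / lam * (√ρ * (2 * ε * β)) := by
    refine (frobNorm_mul_le _ _).trans (mul_le_mul hHP ?_ (frobNorm_nonneg _) (by positivity))
    refine (frobNorm_mul_le' _ _).trans (mul_le_mul hPF ?_ (norm_nonneg _) (Real.sqrt_nonneg _))
    exact l2norm_mul_le hrest hH
  have t2 : frobNorm (H * (Xᵀ * (Bᵀ * H))) ≤ β * (√ρ * (2 * (b * √N) * ε / lam) * 1) := by
    refine (frobNorm_mul_le _ _).trans (mul_le_mul hH ?_ (frobNorm_nonneg _) hβ)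
    exact (frobNorm_mul_le' _ _).trans (mul_le_mul hXF hBH (norm_nonneg _) (by positivity))
  refine (frobNorm_sub_le _ _).trans ((add_le_add t1 t2).trans (le_of_eq ?_))
  ring

end Frobenius

/-! ### Maximum norm and adaptive thresholding -/

section MaxNorm

variable {m n : Type*} [Fintype m] [Fintype n]

theorem maxNorm_le {A : Matrix m n ℝ} {c : ℝ} (hc : 0 ≤ c) (h : ∀ i j, |A i j| ≤ c) :
    maxNorm A ≤ c :=
  Real.iSup_le (fun ij => h ij.1 ij.2) hc

theorem abs_apply_le_maxNorm (A : Matrix m n ℝ) (i : m) (j : n) : |A i j| ≤ maxNorm A :=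
  le_ciSup (f := fun ij : m × n => |A ij.1 ij.2|) (Set.finite_range _).bddAbove (i, j)

theorem maxNorm_nonneg (A : Matrix m n ℝ) : 0 ≤ maxNorm A :=
  Real.iSup_nonneg fun _ => abs_nonneg _

end MaxNorm

section Threshold

open scoped Matrix.Norms.L2Operator

variable {n : Type*} [Fintype n] [DecidableEq n] {s : n → n → ℝ → ℝ → ℝ} {τ e d D q : ℝ}
  {A U : Matrix n n ℝ}

theorem sum_le_sparsity (q : ℝ) (U : Matrix n n ℝ) (i : n) :
    ∑ j, (if U i j = 0 then 0 else |U i j| ^ q) ≤ sparsity q U :=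
  le_ciSup (f := fun i => ∑ j, if U i j = 0 then 0 else |U i j| ^ q)
    (Set.finite_range _).bddAbove i

/-- The scale of the adaptive threshold is bounded and bounded away from zero. -/
theorem sqrt_diag_bounds (hd : 0 < d) (he : e ≤ d / 2) (hU : ∀ i, d ≤ U i i)
    (hU' : ∀ i, U i i ≤ D) (h : ∀ i j, |(A - U) i j| ≤ e) (i j : n) :
    d / 2 ≤ √(A i i * A j j) ∧ √(A i i * A j j) ≤ 2 * D := by
  have hi : ∀ i, d / 2 ≤ A i i ∧ A i i ≤ 2 * D := fun i => by
    have h1 := abs_le.1 (h i i)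
    rw [Matrix.sub_apply] at h1
    constructor <;> linarith [h1.1, h1.2, hU i, hU' i]
  have hD : 0 ≤ 2 * D := by linarith [hU i, hU' i]
  constructor
  · refine Real.le_sqrt_of_sq_le ?_
    rw [pow_two]
    exact mul_le_mul (hi i).1 (hi j).1 (by positivity) (by linarith [(hi i).1])
  · rw [Real.sqrt_le_left hD, pow_two]
    exact mul_le_mul (hi i).2 (hi j).2 (by linarith [(hi j).1]) hD

/-- Thresholding adds at most the threshold to the elementwise error. -/
theorem abs_adaptiveThreshold_sub_le (hs : ∀ i j, IsShrinkage (s i j)) (hτ : 0 ≤ τ) (hd : 0 < d)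
    (he : e ≤ d / 2) (hU : ∀ i, d ≤ U i i) (hU' : ∀ i, U i i ≤ D)
    (h : ∀ i j, |(A - U) i j| ≤ e) (i j : n) :
    |(adaptiveThreshold s τ A - U) i j| ≤ e + 2 * D * τ := by
  obtain ⟨h1, h2⟩ := sqrt_diag_bounds hd he hU hU' h i j
  have hl : 0 ≤ τ * √(A i i * A j j) := by positivity
  have hl2 : τ * √(A i i * A j j) ≤ 2 * D * τ := by nlinarith
  have h3 := h i j
  rw [Matrix.sub_apply] at h3 ⊢
  simp only [adaptiveThreshold, of_apply]
  split_ifs with hij hle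
  · linarith
  · have h4 := (hs i j _ (A i j) hl).2.2
    have := abs_sub_le (s i j (τ * √(A i i * A j j)) (A i j)) (A i j) (U i j)
    linarith
  · have := abs_sub_le 0 (A i j) (U i j)
    simp only [zero_sub, abs_neg] at this ⊢
    linarith

/-- Thresholding at a level above the elementwise error recovers a sparse matrix in operator
norm: entries of `U` below `e` are estimated by zero, and there are at most
`e ^ (-q) * sparsity q U` entries of size at least `e` in a row. -/
theorem norm_adaptiveThreshold_sub_le (hs : ∀ i j, IsShrinkage (s i j)) (hq : 0 ≤ q)
    (hq1 : q < 1) (hd : 0 < d) (he0 : 0 < e)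
    (he : e ≤ d / 2) (hτe : 2 * e ≤ τ * (d / 2)) (hUs : Uᵀ = U) (hU : ∀ i, d ≤ U i i)
    (hU' : ∀ i, U i i ≤ D) (h : ∀ i j, |(A - U) i j| ≤ e) :
    ‖adaptiveThreshold s τ A - U‖ ≤ (e + 2 * D * τ) * e ^ (-q) * sparsity q U := by
  have hτ : 0 ≤ τ := by
    by_contra hneg
    nlinarith
  have hmax := abs_adaptiveThreshold_sub_le hs hτ hd he hU hU' h
  have hsp : 0 ≤ sparsity q U := Real.iSup_nonneg fun i => Finset.sum_nonneg fun j _ => by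
    split_ifs <;> positivity
  rcases isEmpty_or_nonempty n with hn | ⟨⟨i₀⟩⟩
  · have : ‖adaptiveThreshold s τ A - U‖ = 0 := by
      rw [Subsingleton.elim (adaptiveThreshold s τ A - U) 0, norm_zero]
    rw [this]
    have : sparsity q U = 0 := by simp [sparsity]
    rw [this, mul_zero]
  have hD : 0 ≤ D := by linarith [hU i₀, hU' i₀]
  set κ := (e + 2 * D * τ) * e ^ (-q) with hκ
  have hκ0 : 0 ≤ κ := by positivity
  -- entries above the error level
  have hbig : ∀ i j, e ≤ |U i j| →
      |(adaptiveThreshold s τ A - U) i j| ≤ κ * (if U i j = 0 then 0 else |U i j| ^ q) := by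
    intro i j hij
    have h0 : U i j ≠ 0 := fun h0 => by rw [h0, abs_zero] at hij; linarith
    rw [if_neg h0]
    refine (hmax i j).trans ?_
    have h1 : e ^ q ≤ |U i j| ^ q := Real.rpow_le_rpow he0.le hij hq
    calc e + 2 * D * τ = (e + 2 * D * τ) * (e ^ (-q) * e ^ q) := by
          rw [← Real.rpow_add he0, neg_add_cancel, Real.rpow_zero, mul_one]
      _ = κ * e ^ q := by rw [hκ]; ring
      _ ≤ κ * |U i j| ^ q := by gcongr
  have hent : ∀ i j,
      |(adaptiveThreshold s τ A - U) i j| ≤ κ * (if U i j = 0 then 0 else |U i j| ^ q) := by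
    intro i j
    by_cases hij : e ≤ |U i j|
    · exact hbig i j hij
    have hne : i ≠ j := by
      rintro rfl
      have := hU i
      have := le_abs_self (U i i)
      exact hij (by linarith)
    push Not at hij
    -- below the error level the estimate is thresholded to zero
    have hz : adaptiveThreshold s τ A i j = 0 := by
      have h1 := (sqrt_diag_bounds hd he hU hU' h i j).1
      have h2 := h i j
      rw [Matrix.sub_apply] at h2
      have h3 := abs_sub_abs_le_abs_sub (A i j) (U i j)
      have h4 : τ * (d / 2) ≤ τ * √(A i i * A j j) := by gcongr
      simp only [adaptiveThreshold, of_apply, if_neg hne]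
      rw [if_neg]
      intro h5
      linarith
    rw [Matrix.sub_apply, hz, zero_sub, abs_neg]
    split_ifs with h0
    · simp [h0]
    · have hpos : 0 < |U i j| := abs_pos.2 h0
      have h1 : |U i j| ^ (1 - q) ≤ e ^ (1 - q) :=
        Real.rpow_le_rpow hpos.le hij.le (by linarith)
      have h2 : e ^ (1 - q) ≤ κ := by
        have : e ^ (1 - q) = e * e ^ (-q) := by
          rw [sub_eq_add_neg, Real.rpow_add he0, Real.rpow_one]
        rw [this, hκ]
        gcongr
        nlinarith [mul_nonneg hD hτ]
      calc |U i j| = |U i j| ^ (1 - q) * |U i j| ^ q := by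
            rw [← Real.rpow_add hpos]; simp
        _ ≤ κ * |U i j| ^ q := by gcongr; exact h1.trans h2
  refine l2norm_le_of_schur (W := Matrix.of fun i j => κ * if U i j = 0 then 0 else |U i j| ^ q)
    (by positivity) hent ?_ ?_
  · intro i j
    have : U i j = U j i := congrFun (congrFun hUs j) i
    simp [this]
  · intro i
    simp only [of_apply, ← Finset.mul_sum]
    exact mul_le_mul_of_nonneg_left (sum_le_sparsity q U i) hκ0

end Threshold

/-! ### Two levels of factors -/

section TwoLevel

open scoped Matrix.Norms.L2Operator

/-- The norm of a principal submatrix. -/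
theorem l2norm_submatrix_le {m n : Type*} [Fintype m] [DecidableEq m] [Fintype n] [DecidableEq n]
    (U : Matrix n n ℝ) {f : m → n} (hf : Function.Injective f) : ‖U.submatrix f f‖ ≤ ‖U‖ := by
  set J : Matrix n m ℝ := (1 : Matrix n n ℝ).submatrix id f with hJ
  have hJJ : Jᵀ * J = 1 := by
    rw [hJ, transpose_submatrix, transpose_one,
      ← submatrix_mul _ _ f id f Function.bijective_id, Matrix.one_mul, submatrix_one f hf]
  have hJ1 : ‖J‖ ≤ 1 := by
    refine l2norm_le_of_mulVec zero_le_one fun x => ?_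
    refine abs_le_of_sq_le_sq' ?_ (by have := vecNorm_nonneg x; positivity) |>.2
    rw [vecNorm_mulVec_sq, hJJ, one_mulVec, one_mul, vecNorm_sq]
  have e : U.submatrix f f = Jᵀ * U * J := by
    ext i j
    simp [hJ, Matrix.mul_apply, one_apply, Finset.sum_ite_eq]
  rw [e]
  have := l2norm_mul_le (l2norm_mul_le ((l2norm_transpose J).le.trans hJ1) (le_refl ‖U‖)) hJ1
  simpa using this

variable {J k : ℕ} {size r : Fin J → ℕ}

/-- The population side of a two-level factor model. The global loadings `B` have strength `lam₁`
out of `N₁`, and the local loadings `L j` have strength `lam₂` out of `N₂` in each group; `b`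
bounds the rows of the loadings and the norm of `U`, whose absolute row sums are at most `μ` and
whose quadratic form is at least `d`. The last condition puts the local part below the global
one. -/
structure TwoLevel (B : Matrix ((j : Fin J) × Fin (size j)) (Fin k) ℝ)
    (L : (j : Fin J) → Matrix (Fin (size j)) (Fin (r j)) ℝ)
    (U : Matrix ((j : Fin J) × Fin (size j)) ((j : Fin J) × Fin (size j)) ℝ)
    (b d μ N₁ N₂ lam₁ lam₂ : ℝ) : Prop where
  one_le : 1 ≤ b
  d_pos : 0 < d
  d_le : d ≤ b
  le_μ : b ≤ μ
  card_le : (Fintype.card ((j : Fin J) × Fin (size j)) : ℝ) ≤ N₁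
  size_le : ∀ j, (size j : ℝ) ≤ N₂
  lam₁_pos : 0 < lam₁
  lam₂_pos : 0 < lam₂
  lam₁_le : lam₁ ≤ N₁
  lam₂_le : lam₂ ≤ N₂
  row_B : ∀ i, vecNorm (B.row i) ≤ b
  row_L : ∀ j i, vecNorm ((L j).row i) ≤ b
  orth : Bᵀ * blockDiagonal' L = 0
  symm_U : Uᵀ = U
  norm_U : ‖U‖ ≤ b
  sum_U : ∀ i, ∑ j, |U i j| ≤ μ
  form_U : ∀ y, d * vecNorm y ^ 2 ≤ y ⬝ᵥ (U *ᵥ y)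
  lower_B : ∀ c, lam₁ * vecNorm c ^ 2 ≤ vecNorm (B *ᵥ c) ^ 2
  lower_L : ∀ j c, lam₂ * vecNorm c ^ 2 ≤ vecNorm (L j *ᵥ c) ^ 2
  sep : b ^ 2 * N₂ ≤ lam₁ / 8

/-- Elementwise error of the principal components at one level, up to a factor `700 b ^ 6` (see
`FactorStep.abs_part_sub_le`), for `N` variables, factors of
strength `lam`, elementwise input error `η` and absolute row sums at most `μ` of the remainder. -/
noncomputable def levelError (N lam μ η : ℝ) : ℝ := (N / lam) ^ 2 * (η + μ / N)

/-- Elementwise input error of the second level: the sampling error plus the error of the first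
level. -/
noncomputable def localInput (b μ N₁ lam₁ η : ℝ) : ℝ := η + 700 * b ^ 6 * levelError N₁ lam₁ μ η

/-- Output error of the second level, up to a factor `700 b ^ 6`. -/
noncomputable def totalError (b μ N₁ N₂ lam₁ lam₂ η : ℝ) : ℝ :=
  levelError N₂ lam₂ μ (localInput b μ N₁ lam₁ η)

/-- The level error dominates the elementwise input error and the relative operator norm error. -/
theorem levelError_ge {N lam μ η : ℝ} (hlam : 0 < lam) (h : lam ≤ N) (hη : 0 ≤ η) (hμ : 0 ≤ μ) :
    η + μ / N ≤ levelError N lam μ η ∧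
      (N * η + μ) / lam ≤ levelError N lam μ η ∧
      0 ≤ levelError N lam μ η := by
  have hN : 0 < N := hlam.trans_le h
  have hg : 1 ≤ N / lam := by rwa [le_div_iff₀ hlam, one_mul]
  have hθ : 0 ≤ η + μ / N := by positivity
  have e : (N * η + μ) / lam = N / lam * (η + μ / N) := by field_simp
  refine ⟨?_, ?_, ?_⟩
  · unfold levelError
    nlinarith [one_le_pow₀ hg (n := 2)]
  · rw [e, levelError, pow_two, mul_assoc]
    exact le_mul_of_one_le_left (by positivity) hg
  · unfold levelError; positivity

variable {B : Matrix ((j : Fin J) × Fin (size j)) (Fin k) ℝ}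
  {L : (j : Fin J) → Matrix (Fin (size j)) (Fin (r j)) ℝ}
  {U A Rg : Matrix ((j : Fin J) × Fin (size j)) ((j : Fin J) × Fin (size j)) ℝ}
  {Rl : (j : Fin J) → Matrix (Fin (size j)) (Fin (size j)) ℝ}
  {b d μ N₁ N₂ lam₁ lam₂ η : ℝ}

namespace TwoLevel

theorem norm_blockDiagonal'_L (h : TwoLevel B L U b d μ N₁ N₂ lam₁ lam₂) :
    ‖blockDiagonal' L‖ ≤ b * √N₂ := by
  have hb := h.one_le
  refine l2norm_blockDiagonal'_le (by positivity) fun j => ?_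
  exact l2norm_le_of_rows (by linarith) (by simpa using h.size_le j) (h.row_L j)

theorem row_blockDiagonal'_L (h : TwoLevel B L U b d μ N₁ N₂ lam₁ lam₂)
    (i : (j : Fin J) × Fin (size j)) : vecNorm ((blockDiagonal' L).row i) ≤ b := by
  refine le_trans (le_of_eq ?_) (h.row_L i.1 i.2)
  refine (pow_left_inj₀ (vecNorm_nonneg _) (vecNorm_nonneg _) two_ne_zero).1 ?_
  rw [vecNorm_sq_eq_sum, vecNorm_sq_eq_sum, Fintype.sum_sigma, Finset.sum_eq_single i.1]
  · obtain ⟨j, a⟩ := i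
    simp [Matrix.row, blockDiagonal'_apply_eq]
  · intro j _ hj
    obtain ⟨j', a⟩ := i
    refine Finset.sum_eq_zero fun c _ => ?_
    simp only [Matrix.row]
    rw [blockDiagonal'_apply_ne L a c hj.symm]
    simp
  · simp

/-- The first level is a factor step for the sample covariance matrix. -/
theorem globalStep (h : TwoLevel B L U b d μ N₁ N₂ lam₁ lam₂) (hη : 0 ≤ η)
    {E : Matrix ((j : Fin J) × Fin (size j)) ((j : Fin J) × Fin (size j)) ℝ} (hEs : Eᵀ = E)
    (hA : A = B * Bᵀ + blockDiagonal' L * (blockDiagonal' L)ᵀ + (U + E))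
    (hE : ∀ i j, |E i j| ≤ η) (hsmall : levelError N₁ lam₁ μ η ≤ 1 / 16) :
    FactorStep A (U + E) B (blockDiagonal' L) b N₁ lam₁ (N₁ * η + μ) where
  eq := hA
  symm := by rw [transpose_add, h.symm_U, hEs]
  orth := h.orth
  lam_pos := h.lam₁_pos
  norm_B := l2norm_le_of_rows (by linarith [h.one_le]) h.card_le h.row_B
  norm_L := by
    have hN₂ : 0 ≤ N₂ := h.lam₂_pos.le.trans h.lam₂_le
    refine le_trans ?_ h.sep
    calc ‖blockDiagonal' L‖ ^ 2 ≤ (b * √N₂) ^ 2 :=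
          pow_le_pow_left₀ (norm_nonneg _) h.norm_blockDiagonal'_L 2
      _ = _ := by rw [mul_pow, Real.sq_sqrt hN₂]
  norm_err := by
    have h1 := norm_add_le U E
    have h2 := l2norm_le_of_abs_le hη h.card_le hE
    linarith [h.norm_U, h.le_μ]
  err_le := by
    have h0 := h.one_le
    have h1 := (levelError_ge h.lam₁_pos h.lam₁_le hη (μ := μ) (by linarith [h.le_μ])).2.1
    have := (div_le_iff₀ h.lam₁_pos).1 (h1.trans hsmall)
    linarith
  lower := h.lower_B

/-- The second level is a factor step without a moderate part in each group, for the sample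
covariance matrix minus the estimated global part. -/
theorem localStep (h : TwoLevel B L U b d μ N₁ N₂ lam₁ lam₂) (hη : 0 ≤ η)
    {E : Matrix ((j : Fin J) × Fin (size j)) ((j : Fin J) × Fin (size j)) ℝ} (hEs : Eᵀ = E)
    (hA : A = blockDiagonal' L * (blockDiagonal' L)ᵀ + (U + E))
    (hE : ∀ i j, |E i j| ≤ η) (hsmall : levelError N₂ lam₂ μ η ≤ 1 / 16) (j : Fin J) :
    FactorStep (A.blockDiag' j) (U.blockDiag' j + E.blockDiag' j) (L j)
      (0 : Matrix (Fin (size j)) (Fin 0) ℝ) b N₂ lam₂ (N₂ * η + μ) where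
  eq := by
    rw [hA, blockDiagonal'_transpose, ← blockDiagonal'_mul, blockDiag'_add, blockDiag'_add,
      blockDiag'_blockDiagonal']
    simp
  symm := by
    have h1 : (U.blockDiag' j)ᵀ = U.blockDiag' j := by
      conv_rhs => rw [← h.symm_U]
      rfl
    have h2 : (E.blockDiag' j)ᵀ = E.blockDiag' j := by
      conv_rhs => rw [← hEs]
      rfl
    rw [transpose_add, h1, h2]
  orth := by simp
  lam_pos := h.lam₂_pos
  norm_B := l2norm_le_of_rows (by linarith [h.one_le]) (by simpa using h.size_le j) (h.row_L j)
  norm_L := by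
    have := h.lam₂_pos
    rw [norm_zero]
    linarith
  norm_err := by
    have h1 := norm_add_le (U.blockDiag' j) (E.blockDiag' j)
    have h2 : ‖E.blockDiag' j‖ ≤ N₂ * η :=
      l2norm_le_of_abs_le hη (by simpa using h.size_le j) (fun i i' => hE _ _)
    have h3 : ‖U.blockDiag' j‖ ≤ b :=
      (l2norm_submatrix_le U (f := Sigma.mk j) sigma_mk_injective).trans h.norm_U
    linarith [h.le_μ]
  err_le := by
    have h0 := h.one_le
    have h1 := (levelError_ge h.lam₂_pos h.lam₂_le hη (μ := μ) (by linarith [h.le_μ])).2.1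
    have := (div_le_iff₀ h.lam₂_pos).1 (h1.trans hsmall)
    linarith
  lower := h.lower_L j

end TwoLevel

/-- The outcome of the two levels of principal components: orthogonal projections that split off
the estimated global and local parts `Rg` and `Rl'`, the latter being block diagonal, from the input
matrices `A` and `A'` of the two levels, whose deviations from the factor parts are `Δ` and `Δ'`. -/
structure TwoLevelSplit (B : Matrix ((j : Fin J) × Fin (size j)) (Fin k) ℝ)
    (L : (j : Fin J) → Matrix (Fin (size j)) (Fin (r j)) ℝ)
    (A Rg A' Rl' Δ Δ' P P' : Matrix ((j : Fin J) × Fin (size j)) ((j : Fin J) × Fin (size j)) ℝ)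
    (b N₁ N₂ lam₁ lam₂ ε₁ ε₂ : ℝ) : Prop where
  step₁ : FactorStep A Δ B (blockDiagonal' L) b N₁ lam₁ ε₁
  split₁ : LeadingSplit A Rg P lam₁
  trace₁ : P.trace ≤ k
  step₂ : FactorStep A' Δ' (blockDiagonal' L)
    (0 : Matrix ((j : Fin J) × Fin (size j)) (Fin 0) ℝ) b N₂ lam₂ ε₂
  split₂ : LeadingSplit A' Rl' P' lam₂
  trace₂ : P'.trace ≤ ∑ j, (r j : ℝ)

/-- Both levels of principal components succeed when `totalError` is small, with elementwise errors
of their outputs. -/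
theorem TwoLevel.exists_split (h : TwoLevel B L U b d μ N₁ N₂ lam₁ lam₂) (hη : 0 ≤ η)
    (hAs : Aᵀ = A)
    (hA : ∀ i j,
      |(A - (B * Bᵀ + blockDiagonal' L * (blockDiagonal' L)ᵀ + U)) i j| ≤ η)
    (hsmall : totalError b μ N₁ N₂ lam₁ lam₂ η ≤ 1 / 16)
    (hRg : IsLeadingPart k A Rg) (hRl : ∀ j, IsLeadingPart (r j) ((A - Rg).blockDiag' j) (Rl j)) :
    (∃ A' Δ Δ' P P', TwoLevelSplit B L A Rg A' (blockDiagonal' Rl) Δ Δ' P P' b N₁ N₂ lam₁ lam₂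
      (N₁ * η + μ) (N₂ * localInput b μ N₁ lam₁ η + μ)) ∧
    (∀ i j, |(Rg - B * Bᵀ) i j| ≤ 700 * b ^ 6 * levelError N₁ lam₁ μ η) ∧
    (∀ i j, |(blockDiagonal' Rl - blockDiagonal' L * (blockDiagonal' L)ᵀ) i j| ≤
      700 * b ^ 6 * totalError b μ N₁ N₂ lam₁ lam₂ η) := by
  have hb := h.one_le
  have hb6 : 1 ≤ b ^ 6 := one_le_pow₀ hb
  have hμ : 0 ≤ μ := by linarith [h.le_μ]
  obtain ⟨p1, p2, p3⟩ := levelError_ge h.lam₁_pos h.lam₁_le hη hμ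
  have hN₁ : 0 < N₁ := h.lam₁_pos.trans_le h.lam₁_le
  have hN₂ : 0 < N₂ := h.lam₂_pos.trans_le h.lam₂_le
  have hη₂ : 0 ≤ localInput b μ N₁ lam₁ η := by unfold localInput; positivity
  obtain ⟨q1, q2, q3⟩ := levelError_ge h.lam₂_pos h.lam₂_le hη₂ hμ
  change _ ≤ totalError b μ N₁ N₂ lam₁ lam₂ η at q1 q2
  have hi : localInput b μ N₁ lam₁ η ≤ 1 / 16 := by
    have : 0 ≤ μ / N₂ := by positivity
    linarith
  have hs₁ : levelError N₁ lam₁ μ η ≤ 1 / 16 := by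
    refine le_trans ?_ hi
    unfold localInput
    nlinarith
  have hη1 : η ≤ 1 := by
    have : 0 ≤ μ / N₁ := by positivity
    linarith
  -- the first level
  set LL := blockDiagonal' L * (blockDiagonal' L)ᵀ with hLL
  set E := A - (B * Bᵀ + LL + U) with hE
  have hEs : Eᵀ = E := by
    rw [hE, transpose_sub, hAs, transpose_add, transpose_add, h.symm_U, hLL]
    simp
  have f₁ := h.globalStep hη hEs (A := A) (by rw [hE]; abel) hA hs₁
  obtain ⟨P, s₁, t₁⟩ := f₁.exists_split (by simp) hRg
  have hN₁ne := hN₁.ne'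
  have hlev₁ : (N₁ / lam₁) ^ 2 * ((N₁ * η + μ) / N₁) = levelError N₁ lam₁ μ η := by
    unfold levelError
    congr 1
    field_simp
  have hlev₂ : (N₂ / lam₂) ^ 2 * ((N₂ * localInput b μ N₁ lam₁ η + μ) / N₂) =
      totalError b μ N₁ N₂ lam₁ lam₂ η := by
    unfold totalError levelError
    congr 1
    field_simp
  have e₁ := f₁.abs_part_sub_le s₁ hb h.card_le h.lam₁_le h.row_B h.row_blockDiagonal'_L h.norm_U
    hη hη1 hA h.symm_U h.sum_U rfl (by rw [hlev₁]; linarith)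
  rw [hlev₁] at e₁
  -- the second level
  have hRgs : Rgᵀ = Rg := by
    conv_lhs => rw [← s₁.left]
    rw [transpose_mul, s₁.symm, hAs, s₁.right]
  set E' := E - (Rg - B * Bᵀ) with hE'
  have hE's : E'ᵀ = E' := by
    rw [hE', transpose_sub, hEs, transpose_sub, hRgs]
    simp
  have hE'le : ∀ i j, |E' i j| ≤ localInput b μ N₁ lam₁ η := by
    intro i j
    rw [hE', Matrix.sub_apply]
    exact (abs_sub _ _).trans (add_le_add (hA i j) (e₁ i j))
  have f₂ := h.localStep hη₂ hE's (A := A - Rg) (by rw [hE', hE]; abel) hE'le hsmall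
  have hex := fun j => (f₂ j).exists_split (by simp) (hRl j)
  choose P' s₂ t₂ using hex
  refine ⟨⟨_, _, _, P, blockDiagonal' P', f₁, s₁, t₁,
    FactorStep.blockDiagonal' h.lam₂_pos (by linarith) (by positivity) ?_ f₂,
    LeadingSplit.blockDiagonal' h.lam₂_pos.le s₂, ?_⟩, e₁, ?_⟩
  · have := (div_le_iff₀ h.lam₂_pos).1 (q2.trans hsmall)
    linarith
  · rw [trace_blockDiagonal']
    exact Finset.sum_le_sum fun j _ => t₂ j
  · have e₂ : ∀ j (a c : Fin (size j)), |(Rl j - L j * (L j)ᵀ) a c| ≤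
        700 * b ^ 6 * totalError b μ N₁ N₂ lam₁ lam₂ η := by
      intro j a c
      have hUs : (U.blockDiag' j)ᵀ = U.blockDiag' j := by
        conv_rhs => rw [← h.symm_U]
        rfl
      have hUrow : ∀ i, ∑ i', |U.blockDiag' j i i'| ≤ μ := by
        intro i
        refine le_trans ?_ (h.sum_U ⟨j, i⟩)
        rw [Fintype.sum_sigma]
        exact Finset.single_le_sum (f := fun j' => ∑ i', |U ⟨j, i⟩ ⟨j', i'⟩|)
          (fun j' _ => Finset.sum_nonneg fun _ _ => abs_nonneg _) (Finset.mem_univ j)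
      have := (f₂ j).abs_part_sub_le (s₂ j) hb (by simpa using h.size_le j) h.lam₂_le (h.row_L j)
        (fun i => by
          have : vecNorm ((0 : Matrix (Fin (size j)) (Fin 0) ℝ).row i) = 0 := by
            rw [vecNorm_eq_zero]; exact Subsingleton.elim _ _
          rw [this]; linarith)
        ((l2norm_submatrix_le U (f := Sigma.mk j) sigma_mk_injective).trans h.norm_U)
        hη₂ (by linarith) (fun i i' => hE'le _ _) hUs hUrow rfl (by rw [hlev₂]; linarith) a c
      rwa [hlev₂] at this
    rintro ⟨j, a⟩ ⟨j', c⟩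
    rw [hLL, blockDiagonal'_transpose, ← blockDiagonal'_mul, ← blockDiagonal'_sub]
    by_cases hjj : j = j'
    · subst hjj
      rw [blockDiagonal'_apply_eq]
      exact e₂ j a c
    · rw [blockDiagonal'_apply_ne _ _ _ hjj, abs_zero]
      have : 0 ≤ totalError b μ N₁ N₂ lam₁ lam₂ η := q3
      positivity

end TwoLevel

/-! ### Inverse and relative error of the two-level estimator -/

section TwoLevelErrors

open scoped Matrix.Norms.L2Operator

/-- The level error also dominates the product of the norms `√N` of the loadings, `ε / lam` of the
misalignment and `1 / √lam` of `Bᵀ Σ⁻¹`. -/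
theorem sqrt_mul_div_le_levelError {N lam μ η : ℝ} (hlam : 0 < lam) (h : lam ≤ N) (hη : 0 ≤ η)
    (hμ : 0 ≤ μ) : √N * ((N * η + μ) / lam) / √lam ≤ levelError N lam μ η := by
  have hN : 0 < N := hlam.trans_le h
  have hg : 1 ≤ N / lam := by rwa [le_div_iff₀ hlam, one_mul]
  have e : √N * ((N * η + μ) / lam) / √lam = √(N / lam) * (N / lam * (η + μ / N)) := by
    rw [Real.sqrt_div hN.le]
    field_simp
  have h1 : √(N / lam) ≤ N / lam := by
    rw [Real.sqrt_le_left (by positivity)]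
    nlinarith
  rw [e, levelError, pow_two, mul_assoc]
  gcongr

variable {J k : ℕ} {size r : Fin J → ℕ} {B : Matrix ((j : Fin J) × Fin (size j)) (Fin k) ℝ}
  {L : (j : Fin J) → Matrix (Fin (size j)) (Fin (r j)) ℝ}
  {U A Rg A' Rl' Δ Δ' P P' W :
    Matrix ((j : Fin J) × Fin (size j)) ((j : Fin J) × Fin (size j)) ℝ}
  {b d μ N₁ N₂ lam₁ lam₂ η : ℝ}

namespace TwoLevel

/-- Errors accumulate from level to level. -/
theorem errors_le (h : TwoLevel B L U b d μ N₁ N₂ lam₁ lam₂) (hη : 0 ≤ η) :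
    levelError N₁ lam₁ μ η ≤ totalError b μ N₁ N₂ lam₁ lam₂ η ∧
    localInput b μ N₁ lam₁ η ≤ totalError b μ N₁ N₂ lam₁ lam₂ η ∧
    0 ≤ localInput b μ N₁ lam₁ η := by
  have hb := h.one_le
  have hb6 : 1 ≤ b ^ 6 := one_le_pow₀ hb
  have hμ : 0 ≤ μ := by linarith [h.le_μ]
  obtain ⟨p1, p2, p3⟩ := levelError_ge h.lam₁_pos h.lam₁_le hη hμ
  have hN₂ : 0 < N₂ := h.lam₂_pos.trans_le h.lam₂_le
  have hη₂ : 0 ≤ localInput b μ N₁ lam₁ η := by unfold localInput; positivity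
  obtain ⟨q1, q2, q3⟩ := levelError_ge h.lam₂_pos h.lam₂_le hη₂ hμ
  change _ ≤ totalError b μ N₁ N₂ lam₁ lam₂ η at q1
  have h1 : 0 ≤ μ / N₂ := by positivity
  have h2 : levelError N₁ lam₁ μ η ≤ localInput b μ N₁ lam₁ η := by
    unfold localInput; nlinarith
  refine ⟨by linarith, by linarith, hη₂⟩

theorem lower_blockDiagonal'_L (h : TwoLevel B L U b d μ N₁ N₂ lam₁ lam₂)
    (c : ((j : Fin J) × Fin (r j)) → ℝ) :
    lam₂ * vecNorm c ^ 2 ≤ vecNorm (blockDiagonal' L *ᵥ c) ^ 2 := by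
  rw [vecNorm_blockDiagonal'_mulVec_sq, vecNorm_sq_eq_sum, Fintype.sum_sigma, Finset.mul_sum]
  refine Finset.sum_le_sum fun j _ => ?_
  rw [← vecNorm_sq_eq_sum (fun a => c ⟨j, a⟩)]
  exact h.lower_L j _

theorem form_cov (h : TwoLevel B L U b d μ N₁ N₂ lam₁ lam₂)
    (y : ((j : Fin J) × Fin (size j)) → ℝ) :
    vecNorm (Bᵀ *ᵥ y) ^ 2 + vecNorm ((blockDiagonal' L)ᵀ *ᵥ y) ^ 2 + d * vecNorm y ^ 2 ≤
      y ⬝ᵥ ((B * Bᵀ + blockDiagonal' L * (blockDiagonal' L)ᵀ + U) *ᵥ y) := by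
  rw [vecNorm_mulVec_sq, vecNorm_mulVec_sq, add_mulVec, add_mulVec, dotProduct_add, dotProduct_add,
    transpose_transpose, transpose_transpose]
  linarith [h.form_U y]

variable (h : TwoLevel B L U b d μ N₁ N₂ lam₁ lam₂) (hη : 0 ≤ η)
  (hX : totalError b μ N₁ N₂ lam₁ lam₂ η ≤ 1 / 16)
  (t : TwoLevelSplit B L A Rg A' Rl' Δ Δ' P P' b N₁ N₂ lam₁ lam₂
    (N₁ * η + μ) (N₂ * localInput b μ N₁ lam₁ η + μ))

include h hη hX t

/-- The estimated global and local eigenspaces are at a positive angle. -/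
theorem norm_proj_mul_proj_le : ‖P' * P‖ ≤ 1 / 2 := by
  have hb := h.one_le
  have hμ : 0 ≤ μ := by linarith [h.le_μ]
  have hlam₂ := h.lam₂_pos
  have hN₂ : 0 < N₂ := h.lam₂_pos.trans_le h.lam₂_le
  obtain ⟨p1, p2, p3⟩ := levelError_ge h.lam₁_pos h.lam₁_le hη hμ
  obtain ⟨-, -, hη₂⟩ := h.errors_le hη
  obtain ⟨q1, q2, q3⟩ := levelError_ge h.lam₂_pos h.lam₂_le hη₂ hμ
  change _ ≤ totalError b μ N₁ N₂ lam₁ lam₂ η at q2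
  refine (t.step₁.norm_proj_mul_proj_le t.split₁ t.step₂ t.split₂ hN₂.le).trans ?_
  -- the first term is dominated by the input error of the second level
  have h1 : 4 * (b ^ 2 * N₂) * ((N₁ * η + μ) / lam₁) ≤ N₂ * localInput b μ N₁ lam₁ η := by
    have h2 : 4 * b ^ 2 * ((N₁ * η + μ) / lam₁) ≤ localInput b μ N₁ lam₁ η := by
      have b2 : b ^ 2 ≤ b ^ 6 := pow_le_pow_right₀ hb (by norm_num)
      have h0 : 0 ≤ (N₁ * η + μ) / lam₁ := div_nonneg t.step₁.err_nonneg h.lam₁_pos.le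
      calc 4 * b ^ 2 * ((N₁ * η + μ) / lam₁) ≤ 4 * b ^ 6 * levelError N₁ lam₁ μ η := by gcongr
        _ ≤ 700 * b ^ 6 * levelError N₁ lam₁ μ η := by gcongr; norm_num
        _ ≤ localInput b μ N₁ lam₁ η := by unfold localInput; linarith
    nlinarith
  have h3 : (N₂ * localInput b μ N₁ lam₁ η + μ) ≤ 1 / 16 * lam₂ :=
    (div_le_iff₀ hlam₂).1 (q2.trans hX)
  rw [div_le_iff₀ hlam₂]
  linarith

/-- Operator norm error of the inverse, for any estimate `W` of the idiosyncratic part. -/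
theorem norm_inv_sub_inv_le (hW : ‖W - U‖ ≤ d / 2) :
    ‖(Rg + Rl' + W)⁻¹ - (B * Bᵀ + blockDiagonal' L * (blockDiagonal' L)ᵀ + U)⁻¹‖ ≤
      2 / d ^ 2 * ‖W - U‖ + 72 * b ^ 2 / d ^ 2 * totalError b μ N₁ N₂ lam₁ lam₂ η := by
  have hb := h.one_le
  have hd := h.d_pos
  have hμ : 0 ≤ μ := by linarith [h.le_μ]
  have hlam₁ := h.lam₁_pos
  have hlam₂ := h.lam₂_pos
  obtain ⟨r1, -, hη₂⟩ := h.errors_le hη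
  obtain ⟨-, p2, p3⟩ := levelError_ge h.lam₁_pos h.lam₁_le hη hμ
  obtain ⟨-, q2, q3⟩ := levelError_ge h.lam₂_pos h.lam₂_le hη₂ hμ
  have p4 := sqrt_mul_div_le_levelError h.lam₁_pos h.lam₁_le hη hμ
  have q4 := sqrt_mul_div_le_levelError h.lam₂_pos h.lam₂_le hη₂ hμ
  change _ ≤ totalError b μ N₁ N₂ lam₁ lam₂ η at q2 q4
  set X := totalError b μ N₁ N₂ lam₁ lam₂ η with hXdef
  set T := B * Bᵀ + blockDiagonal' L * (blockDiagonal' L)ᵀ + U with hT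
  set S := Rg + Rl' + W with hS
  have hPP := h.norm_proj_mul_proj_le hη hX t
  have hWform := form_ge_of_norm_sub_le h.form_U hW
  have hWnorm : ‖W‖ ≤ 2 * b := by
    have := norm_add_le (W - U) U
    rw [sub_add_cancel] at this
    linarith [h.norm_U, h.d_le]
  have hTform : ∀ y, d * vecNorm y ^ 2 ≤ y ⬝ᵥ (T *ᵥ y) := fun y => by
    have := h.form_cov y
    have := sq_nonneg (vecNorm (Bᵀ *ᵥ y))
    have := sq_nonneg (vecNorm ((blockDiagonal' L)ᵀ *ᵥ y))
    linarith
  have hSform : ∀ y, d / 2 * vecNorm y ^ 2 ≤ y ⬝ᵥ (S *ᵥ y) := fun y => by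
    rw [hS, add_mulVec, add_mulVec, dotProduct_add, dotProduct_add]
    have h1 : 0 ≤ y ⬝ᵥ (Rg *ᵥ y) := le_trans (by positivity) (t.split₁.lower y)
    have h2 : 0 ≤ y ⬝ᵥ (Rl' *ᵥ y) := le_trans (by positivity) (t.split₂.lower y)
    linarith [hWform y]
  have hTu := isUnit_det_of_form hd hTform
  have hSu := isUnit_det_of_form (by positivity) hSform
  have hTinv := l2norm_inv_le_of_form hd hTform
  have hSinv := l2norm_inv_le_of_form (by positivity) hSform
  have hTs : Tᵀ = T := by simp [hT, h.symm_U]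
  have hTis : (T⁻¹)ᵀ = T⁻¹ := by rw [transpose_nonsing_inv, hTs]
  -- both inverses are small along the factors
  have hBT : ‖Bᵀ * T⁻¹‖ ≤ b / (d * √lam₁) := by
    rw [← l2norm_transpose, transpose_mul, transpose_transpose, hTis]
    exact l2norm_inv_mul_le hTu (by positivity) fun x y hxy =>
      vecNorm_le_of_cov_mulVec_eq h.orth hd h.form_U h.norm_U hlam₁ h.lower_B hxy
  have hLT : ‖(blockDiagonal' L)ᵀ * T⁻¹‖ ≤ b / (d * √lam₂) := by
    rw [← l2norm_transpose, transpose_mul, transpose_transpose, hTis]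
    refine l2norm_inv_mul_le hTu (by positivity) fun x y hxy =>
      vecNorm_le_of_cov_mulVec_eq (L := B) ?_ hd h.form_U h.norm_U hlam₂
        h.lower_blockDiagonal'_L ?_
    · have := congrArg transpose h.orth
      rwa [transpose_mul, transpose_transpose, transpose_zero] at this
    · rw [← hxy, hT, add_comm (B * Bᵀ)]
  have hSP : ‖S⁻¹ * P‖ ≤ 4 * (2 * b) / (d / 2 * lam₁) :=
    l2norm_inv_mul_le hSu (by positivity) fun x y hxy =>
      t.split₁.vecNorm_le_of_mulVec_eq t.split₂ hlam₁ hlam₂.le (by positivity) hWform hWnorm hPP hxy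
  have hSP' : ‖S⁻¹ * P'‖ ≤ 4 * (2 * b) / (d / 2 * lam₂) := by
    refine l2norm_inv_mul_le hSu (by positivity) fun x y hxy =>
      t.split₂.vecNorm_le_of_mulVec_eq t.split₁ hlam₂ hlam₁.le (by positivity) hWform hWnorm ?_ ?_
    · rw [← l2norm_transpose, transpose_mul, t.split₁.symm, t.split₂.symm]
      exact hPP
    · rw [← hxy, hS, add_comm Rg]
  have a₁ := t.step₁.norm_inv_mul_part_sub_mul_inv_le t.split₁ hSinv hSP hTinv hBT
  have a₂ := t.step₂.norm_inv_mul_part_sub_mul_inv_le t.split₂ hSinv hSP' hTinv hLT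
  have a₀ := l2norm_mul_le (l2norm_mul_le hSinv (le_refl ‖W - U‖)) hTinv
  -- the contribution of one level in terms of its level error
  have c₁ : ∀ {N lam ε Y : ℝ}, 0 < lam → 0 ≤ ε → ε / lam ≤ Y → √N * (ε / lam) / √lam ≤ Y → 0 ≤ Y →
      2 * (4 * (2 * b) / (d / 2 * lam)) * (1 / d) * ε +
        1 / (d / 2) * (2 * (b * √N) * ε / lam) * (b / (d * √lam)) ≤ 36 * b ^ 2 / d ^ 2 * Y := by
    intro N lam ε Y hlam h0 h1 h2 h3
    have e : 2 * (4 * (2 * b) / (d / 2 * lam)) * (1 / d) * ε +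
        1 / (d / 2) * (2 * (b * √N) * ε / lam) * (b / (d * √lam)) =
        32 * b / d ^ 2 * (ε / lam) + 4 * b ^ 2 / d ^ 2 * (√N * (ε / lam) / √lam) := by
      field_simp
      ring
    rw [e]
    have b2 : b ≤ b ^ 2 := by nlinarith
    have h4 : 0 ≤ ε / lam := by positivity
    calc _ ≤ 32 * b ^ 2 / d ^ 2 * Y + 4 * b ^ 2 / d ^ 2 * Y := by gcongr
      _ = _ := by ring
  have b₁ := a₁.trans (c₁ hlam₁ t.step₁.err_nonneg (p2.trans r1) (p4.trans r1) (p3.trans r1))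
  have b₂ := a₂.trans (c₁ hlam₂ t.step₂.err_nonneg q2 q4 q3)
  rw [inv_sub_inv_eq hSu hTu]
  have e : S⁻¹ * (T - S) * T⁻¹ = -(S⁻¹ * (W - U) * T⁻¹ + S⁻¹ * (Rg - B * Bᵀ) * T⁻¹
      + S⁻¹ * (Rl' - blockDiagonal' L * (blockDiagonal' L)ᵀ) * T⁻¹) := by
    rw [← Matrix.add_mul, ← Matrix.add_mul, ← Matrix.mul_add, ← Matrix.mul_add, ← Matrix.neg_mul,
      ← Matrix.mul_neg]
    congr 2
    rw [hT, hS]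
    abel
  rw [e, norm_neg]
  have n1 := norm_add_le (S⁻¹ * (W - U) * T⁻¹ + S⁻¹ * (Rg - B * Bᵀ) * T⁻¹)
    (S⁻¹ * (Rl' - blockDiagonal' L * (blockDiagonal' L)ᵀ) * T⁻¹)
  have n2 := norm_add_le (S⁻¹ * (W - U) * T⁻¹) (S⁻¹ * (Rg - B * Bᵀ) * T⁻¹)
  have e0 : 1 / (d / 2) * ‖W - U‖ * (1 / d) = 2 / d ^ 2 * ‖W - U‖ := by field_simp
  rw [e0] at a₀
  have e1 : 72 * b ^ 2 / d ^ 2 * X = 36 * b ^ 2 / d ^ 2 * X + 36 * b ^ 2 / d ^ 2 * X := by ring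
  rw [e1]
  linarith

/-- Relative Frobenius error, for any estimate `W` of the idiosyncratic part. The total
number of local factors may grow, but only like the ratio `N₁ / N₂`, the order of the number of
groups. -/
theorem relFrobError_le {a : ℝ} (ha : 0 ≤ a)
    (hN₁ : (Fintype.card ((j : Fin J) × Fin (size j)) : ℝ) = N₁)
    (hr : (∑ j, (r j : ℝ)) * N₂ ≤ a ^ 2 * N₁) :
    relFrobError (Rg + Rl' + W) (B * Bᵀ + blockDiagonal' L * (blockDiagonal' L)ᵀ + U) ≤
      1 / d * ‖W - U‖ + (√k + a) * (6 * (1 / √d) * b + 8 * (1 / √d) ^ 2) *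
        (totalError b μ N₁ N₂ lam₁ lam₂ η + √N₁ * totalError b μ N₁ N₂ lam₁ lam₂ η ^ 2) := by
  have hb := h.one_le
  have hd := h.d_pos
  have hμ : 0 ≤ μ := by linarith [h.le_μ]
  have hlam₁ := h.lam₁_pos
  have hlam₂ := h.lam₂_pos
  have hN₁0 : 0 < N₁ := hlam₁.trans_le h.lam₁_le
  have hN₂0 : 0 < N₂ := hlam₂.trans_le h.lam₂_le
  have hN₂₁ : N₂ ≤ N₁ := by
    have := h.sep
    have := h.lam₁_le
    have : 1 * N₂ ≤ b ^ 2 * N₂ := by gcongr; exact one_le_pow₀ hb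
    linarith
  obtain ⟨r1, -, hη₂⟩ := h.errors_le hη
  obtain ⟨-, p2, p3⟩ := levelError_ge h.lam₁_pos h.lam₁_le hη hμ
  obtain ⟨-, q2, q3⟩ := levelError_ge h.lam₂_pos h.lam₂_le hη₂ hμ
  change _ ≤ totalError b μ N₁ N₂ lam₁ lam₂ η at q2
  have p2 := p2.trans r1
  have hε₁ := t.step₁.err_nonneg
  have hε₂ := t.step₂.err_nonneg
  set X := totalError b μ N₁ N₂ lam₁ lam₂ η with hXdef
  have hX0 : 0 ≤ X := q3
  set T := B * Bᵀ + blockDiagonal' L * (blockDiagonal' L)ᵀ + U with hT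
  have hTform : ∀ y, d * vecNorm y ^ 2 ≤ y ⬝ᵥ (T *ᵥ y) := fun y => by
    have := h.form_cov y
    have := sq_nonneg (vecNorm (Bᵀ *ᵥ y))
    have := sq_nonneg (vecNorm ((blockDiagonal' L)ᵀ *ᵥ y))
    linarith
  have hTs : Tᵀ = T := by simp [hT, h.symm_U]
  set H := invSqrt T with hH
  have hHs : Hᵀ = H := invSqrt_transpose T
  have hHTH : H * T * H = 1 := invSqrt_mul_self_mul_invSqrt hTs hd hTform
  set β := 1 / √d with hβ
  have hβ0 : 0 ≤ β := by positivity
  have hHβ : ‖H‖ ≤ β := l2norm_le_of_sandwich hd hTform hHs hHTH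
  have hBH : ‖Bᵀ * H‖ ≤ 1 := norm_transpose_mul_le_one_of_form (T := T) (fun y => by
    have := h.form_cov y
    have := sq_nonneg (vecNorm ((blockDiagonal' L)ᵀ *ᵥ y))
    have : 0 ≤ d * vecNorm y ^ 2 := by positivity
    linarith) hHs hHTH
  have hLH : ‖(blockDiagonal' L)ᵀ * H‖ ≤ 1 :=
    norm_transpose_mul_le_one_of_form (T := T) (fun y => by
      have := h.form_cov y
      have := sq_nonneg (vecNorm (Bᵀ *ᵥ y))
      have : 0 ≤ d * vecNorm y ^ 2 := by positivity
      linarith) hHs hHTH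
  have a₁ := t.step₁.frobNorm_sandwich_le t.split₁ hHs hHβ hBH t.trace₁ (by simp)
  have a₂ := t.step₂.frobNorm_sandwich_le t.split₂ hHs hHβ hLH t.trace₂
    (by simp [Fintype.card_sigma])
  have a₀ : frobNorm (H * (W - U) * H) ≤ √N₁ * (β * ‖W - U‖ * β) := by
    refine (frobNorm_le_sqrt_card _).trans ?_
    rw [hN₁]
    gcongr
    exact l2norm_mul_le (l2norm_mul_le hHβ le_rfl) hHβ
  have e : H * (Rg + Rl' + W) * H - 1 = H * (W - U) * H + H * (Rg - B * Bᵀ) * H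
      + H * (Rl' - blockDiagonal' L * (blockDiagonal' L)ᵀ) * H := by
    rw [← hHTH, ← Matrix.sub_mul, ← Matrix.mul_sub, ← Matrix.add_mul, ← Matrix.add_mul,
      ← Matrix.mul_add, ← Matrix.mul_add]
    congr 2
    rw [hT]
    abel
  have n1 := frobNorm_add_le (H * (W - U) * H + H * (Rg - B * Bᵀ) * H)
    (H * (Rl' - blockDiagonal' L * (blockDiagonal' L)ᵀ) * H)
  have n2 := frobNorm_add_le (H * (W - U) * H) (H * (Rg - B * Bᵀ) * H)
  have hs₁ : 0 < √N₁ := Real.sqrt_pos.2 hN₁0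
  have hss₁ : √N₁ * √N₁ = N₁ := Real.mul_self_sqrt hN₁0.le
  have hss₂ : √N₂ * √N₂ = N₂ := Real.mul_self_sqrt hN₂0.le
  set Y := X + √N₁ * X ^ 2 with hY
  set K := 6 * β * b + 8 * β ^ 2 with hK
  have hK0 : 0 ≤ K := by positivity
  -- one level, with `N` variables in the scale of the level
  have lev : ∀ {N lam ε : ℝ}, 0 < lam → 0 ≤ N → lam ≤ N → N ≤ N₁ → 0 ≤ ε → ε / lam ≤ X →
      6 * β * (b * √N) * ε / lam + 8 * β ^ 2 * ε ^ 2 / lam ≤ √N * (K * Y) := by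
    intro N lam ε hlam hN hlN hNN hε hεX
    have hss : √N * √N = N := Real.mul_self_sqrt hN
    have f1 : 6 * β * (b * √N) * ε / lam ≤ √N * (6 * β * b * X) := by
      calc 6 * β * (b * √N) * ε / lam = √N * (6 * β * b * (ε / lam)) := by ring
        _ ≤ _ := by gcongr
    have f2 : 8 * β ^ 2 * ε ^ 2 / lam ≤ √N * (8 * β ^ 2 * (√N₁ * X ^ 2)) := by
      calc 8 * β ^ 2 * ε ^ 2 / lam = 8 * β ^ 2 * (lam * (ε / lam) ^ 2) := by field_simp
        _ ≤ 8 * β ^ 2 * (N * X ^ 2) := by gcongr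
        _ = √N * (8 * β ^ 2 * (√N * X ^ 2)) := by
            linear_combination (-8 * β ^ 2 * X ^ 2) * hss
        _ ≤ _ := by gcongr
    have f3 : 6 * β * b * X + 8 * β ^ 2 * (√N₁ * X ^ 2) ≤ K * Y := by
      have g1 : 0 ≤ √N₁ * X ^ 2 := by positivity
      have g2 : 0 ≤ 6 * β * b := by positivity
      have g3 : 0 ≤ 8 * β ^ 2 := by positivity
      calc _ ≤ 6 * β * b * X + 8 * β ^ 2 * (√N₁ * X ^ 2)
            + (6 * β * b * (√N₁ * X ^ 2) + 8 * β ^ 2 * X) :=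
              le_add_of_nonneg_right (add_nonneg (mul_nonneg g2 g1) (mul_nonneg g3 hX0))
        _ = _ := by rw [hK, hY]; ring
    calc _ ≤ √N * (6 * β * b * X + 8 * β ^ 2 * (√N₁ * X ^ 2)) := by linarith
      _ ≤ _ := by gcongr
  have l₁ := lev hlam₁ hN₁0.le h.lam₁_le le_rfl hε₁ p2
  have l₂ := lev hlam₂ hN₂0.le h.lam₂_le hN₂₁ hε₂ q2
  have hY0 : 0 ≤ Y := by positivity
  have m₁ : frobNorm (H * (Rg - B * Bᵀ) * H) ≤ √N₁ * (√k * (K * Y)) := by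
    refine a₁.trans ?_
    calc _ ≤ √k * (√N₁ * (K * Y)) := by gcongr
      _ = _ := by ring
  have m₂ : frobNorm (H * (Rl' - blockDiagonal' L * (blockDiagonal' L)ᵀ) * H) ≤
      √N₁ * (a * (K * Y)) := by
    refine a₂.trans ?_
    have : √(∑ j, (r j : ℝ)) * √N₂ ≤ a * √N₁ := by
      rw [← Real.sqrt_mul (Finset.sum_nonneg fun j _ => by positivity)]
      refine (Real.sqrt_le_sqrt hr).trans (le_of_eq ?_)
      rw [Real.sqrt_mul (sq_nonneg a), Real.sqrt_sq ha]
    calc _ ≤ √(∑ j, (r j : ℝ)) * (√N₂ * (K * Y)) := by gcongr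
      _ = √(∑ j, (r j : ℝ)) * √N₂ * (K * Y) := by ring
      _ ≤ a * √N₁ * (K * Y) := by gcongr
      _ = _ := by ring
  have hββ : β * ‖W - U‖ * β = 1 / d * ‖W - U‖ := by
    have : β * β = 1 / d := by
      rw [hβ, div_mul_div_comm, Real.mul_self_sqrt hd.le, one_mul]
    linear_combination ‖W - U‖ * this
  rw [hββ] at a₀
  unfold relFrobError
  rw [hN₁, inv_mul_le_iff₀ hs₁, ← hH, e]
  calc _ ≤ √N₁ * (1 / d * ‖W - U‖) + √N₁ * (√k * (K * Y)) + √N₁ * (a * (K * Y)) := by linarith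
    _ = _ := by ring

end TwoLevel

end TwoLevelErrors

/-! ### The Double-POET estimator for given data -/

section Estimator

open scoped Matrix.Norms.L2Operator

/-- A symmetric matrix with quadratic form between `0` and `D` has norm at most `D`. -/
theorem l2norm_le_of_form_le {n : Type*} [Fintype n] [DecidableEq n] {U : Matrix n n ℝ} {D : ℝ}
    (hD : 0 < D) (hUs : Uᵀ = U) (h0 : ∀ y, 0 ≤ y ⬝ᵥ (U *ᵥ y))
    (h1 : ∀ y, y ⬝ᵥ (U *ᵥ y) ≤ D * vecNorm y ^ 2) : ‖U‖ ≤ D := by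
  refine l2norm_le_of_mulVec hD.le fun y => ?_
  refine abs_le_of_sq_le_sq' ?_ (by have := vecNorm_nonneg y; positivity) |>.2
  set z := U *ᵥ y with hz
  -- the form is nonnegative at `y - z / D`
  have h2 := h0 (y - D⁻¹ • z)
  have h3 : y ⬝ᵥ (U *ᵥ z) = vecNorm z ^ 2 := by
    rw [dotProduct_mulVec_transpose, hUs, vecNorm_sq]
  have h4 : z ⬝ᵥ (U *ᵥ y) = vecNorm z ^ 2 := by rw [vecNorm_sq]
  rw [mulVec_sub, mulVec_smul, dotProduct_sub, sub_dotProduct, sub_dotProduct, smul_dotProduct,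
    dotProduct_smul, smul_dotProduct, dotProduct_smul, h3, h4] at h2
  simp only [smul_eq_mul] at h2
  have h5 := h1 z
  have h6 : D⁻¹ * (D⁻¹ * (z ⬝ᵥ (U *ᵥ z))) ≤ D⁻¹ * (D⁻¹ * (D * vecNorm z ^ 2)) := by gcongr
  have h7 : D⁻¹ * (D⁻¹ * (D * vecNorm z ^ 2)) = D⁻¹ * vecNorm z ^ 2 := by field_simp
  have h8 : D⁻¹ * vecNorm z ^ 2 ≤ y ⬝ᵥ (U *ᵥ y) := by linarith
  calc vecNorm z ^ 2 = D * (D⁻¹ * vecNorm z ^ 2) := by field_simp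
    _ ≤ D * (D * vecNorm y ^ 2) := mul_le_mul_of_nonneg_left (h8.trans (h1 y)) hD.le
    _ = _ := by ring

theorem norm_inv_sub_inv_le_of_form {n : Type*} [Fintype n] [DecidableEq n] {U W : Matrix n n ℝ}
    {d : ℝ} (hd : 0 < d) (hU : ∀ y, d * vecNorm y ^ 2 ≤ y ⬝ᵥ (U *ᵥ y)) (hW : ‖W - U‖ ≤ d / 2) :
    ‖W⁻¹ - U⁻¹‖ ≤ 2 / d ^ 2 * ‖W - U‖ := by
  have hWf := form_ge_of_norm_sub_le hU hW
  rw [inv_sub_inv_eq (isUnit_det_of_form (by positivity) hWf) (isUnit_det_of_form hd hU)]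
  have := l2norm_mul_le (l2norm_mul_le (l2norm_inv_le_of_form (by positivity) hWf)
    (norm_sub_rev U W).le) (l2norm_inv_le_of_form hd hU)
  refine this.trans (le_of_eq ?_)
  field_simp

theorem le_diag_of_form {n : Type*} [Fintype n] [DecidableEq n] {U : Matrix n n ℝ}
    {d : ℝ} (hU : ∀ y, d * vecNorm y ^ 2 ≤ y ⬝ᵥ (U *ᵥ y)) (i : n) : d ≤ U i i := by
  have := hU (Pi.single i 1)
  simpa [vecNorm_sq] using this

variable {J k : ℕ} {size r : Fin J → ℕ} {B : Matrix ((j : Fin J) × Fin (size j)) (Fin k) ℝ}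
  {L : (j : Fin J) → Matrix (Fin (size j)) (Fin (r j)) ℝ}
  {U A Su S : Matrix ((j : Fin J) × Fin (size j)) ((j : Fin J) × Fin (size j)) ℝ}
  {s : (j : Fin J) × Fin (size j) → (j : Fin J) × Fin (size j) → ℝ → ℝ → ℝ}
  {b d μ N₁ N₂ lam₁ lam₂ η e τ q : ℝ}

namespace TwoLevel

theorem diag_U_le (h : TwoLevel B L U b d μ N₁ N₂ lam₁ lam₂)
    (i : (j : Fin J) × Fin (size j)) : U i i ≤ b := by
  have h1 := abs_dotProduct_le_vecNorm (Pi.single i 1) (U.col i)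
  have h2 := vecNorm_col_le U i
  have h3 : vecNorm (Pi.single i (1 : ℝ) : ((j : Fin J) × Fin (size j)) → ℝ) = 1 := by
    have : vecNorm (Pi.single i (1 : ℝ) : ((j : Fin J) × Fin (size j)) → ℝ) ^ 2 = 1 := by
      rw [vecNorm_sq]; simp
    nlinarith [vecNorm_nonneg (Pi.single i (1 : ℝ) : ((j : Fin J) × Fin (size j)) → ℝ)]
  rw [h3, one_mul, single_one_dotProduct] at h1
  exact ((le_abs_self _).trans h1).trans (h2.trans h.norm_U)

/-- The principal component estimates for Double-POET, and their errors. -/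
theorem exists_parts (h : TwoLevel B L U b d μ N₁ N₂ lam₁ lam₂) (hη : 0 ≤ η) (hAs : Aᵀ = A)
    (hA : ∀ i j, |(A - (B * Bᵀ + blockDiagonal' L * (blockDiagonal' L)ᵀ + U)) i j| ≤ η)
    (hsmall : totalError b μ N₁ N₂ lam₁ lam₂ η ≤ 1 / 16)
    (he : 701 * b ^ 6 * totalError b μ N₁ N₂ lam₁ lam₂ η ≤ e)
    (hPOET : IsDoublePOET k r s τ A Su S) :
    ∃ Rg Rl' A' Δ Δ' P P', TwoLevelSplit B L A Rg A' Rl' Δ Δ' P P' b N₁ N₂ lam₁ lam₂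
      (N₁ * η + μ) (N₂ * localInput b μ N₁ lam₁ η + μ) ∧
      Su = adaptiveThreshold s τ (A - Rg - Rl') ∧ S = Rg + Rl' + Su ∧
      (∀ i j, |(A - Rg - Rl' - U) i j| ≤ e) ∧
      (∀ i j, |(Rg + Rl' - (B * Bᵀ + blockDiagonal' L * (blockDiagonal' L)ᵀ)) i j| ≤ e) := by
  obtain ⟨Rg, Rl, hRg, hRl, hSu, hS⟩ := hPOET
  obtain ⟨⟨A', Δ, Δ', P, P', t⟩, e₁, e₂⟩ := h.exists_split hη hAs hA hsmall hRg hRl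
  obtain ⟨r1, r2, r3⟩ := h.errors_le hη
  have hb6 : 1 ≤ b ^ 6 := one_le_pow₀ h.one_le
  set X := totalError b μ N₁ N₂ lam₁ lam₂ η
  have hX0 : 0 ≤ X := r3.trans r2
  have hXe : X + 700 * b ^ 6 * X ≤ e := by nlinarith
  unfold localInput at r2
  refine ⟨Rg, blockDiagonal' Rl, A', Δ, Δ', P, P', t, hSu, hS, fun i j => ?_, fun i j => ?_⟩
  · have c : (A - Rg - blockDiagonal' Rl - U) i j =
        (A - (B * Bᵀ + blockDiagonal' L * (blockDiagonal' L)ᵀ + U)) i j - (Rg - B * Bᵀ) i j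
        - (blockDiagonal' Rl - blockDiagonal' L * (blockDiagonal' L)ᵀ) i j := by
      simp only [Matrix.sub_apply, Matrix.add_apply]; ring
    rw [c]
    refine (abs_sub _ _).trans ?_
    have := abs_sub ((A - (B * Bᵀ + blockDiagonal' L * (blockDiagonal' L)ᵀ + U)) i j)
      ((Rg - B * Bᵀ) i j)
    linarith [hA i j, e₁ i j, e₂ i j]
  · have c : (Rg + blockDiagonal' Rl - (B * Bᵀ + blockDiagonal' L * (blockDiagonal' L)ᵀ)) i j =
        (Rg - B * Bᵀ) i j + (blockDiagonal' Rl - blockDiagonal' L * (blockDiagonal' L)ᵀ) i j := by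
      simp only [Matrix.sub_apply, Matrix.add_apply]; ring
    rw [c]
    refine (abs_add_le _ _).trans ?_
    linarith [e₁ i j, e₂ i j]

/-- Elementwise errors of Double-POET. -/
theorem maxNorm_errors_le (h : TwoLevel B L U b d μ N₁ N₂ lam₁ lam₂) (hη : 0 ≤ η) (hAs : Aᵀ = A)
    (hA : ∀ i j, |(A - (B * Bᵀ + blockDiagonal' L * (blockDiagonal' L)ᵀ + U)) i j| ≤ η)
    (hsmall : totalError b μ N₁ N₂ lam₁ lam₂ η ≤ 1 / 16)
    (he : 701 * b ^ 6 * totalError b μ N₁ N₂ lam₁ lam₂ η ≤ e) (hed : e ≤ d / 2)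
    (hs : ∀ i j, IsShrinkage (s i j)) (hτ : 0 ≤ τ) (hPOET : IsDoublePOET k r s τ A Su S) :
    maxNorm (Su - U) ≤ e + 2 * b * τ ∧
    maxNorm (S - (B * Bᵀ + blockDiagonal' L * (blockDiagonal' L)ᵀ + U)) ≤
      2 * e + 2 * b * τ := by
  have hb := h.one_le
  obtain ⟨Rg, Rl', -, -, -, -, -, -, hSu, hS, c₁, c₂⟩ := h.exists_parts hη hAs hA hsmall he hPOET
  obtain ⟨r1, r2, r3⟩ := h.errors_le hη
  have he0 : 0 ≤ e := le_trans (by have := r3.trans r2; positivity) he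
  have c₃ := abs_adaptiveThreshold_sub_le hs hτ h.d_pos hed (le_diag_of_form h.form_U)
    h.diag_U_le c₁
  rw [← hSu] at c₃
  refine ⟨maxNorm_le (by positivity) c₃, maxNorm_le (by positivity) fun i j => ?_⟩
  have c : (S - (B * Bᵀ + blockDiagonal' L * (blockDiagonal' L)ᵀ + U)) i j =
      (Rg + Rl' - (B * Bᵀ + blockDiagonal' L * (blockDiagonal' L)ᵀ)) i j + (Su - U) i j := by
    rw [hS]
    simp only [Matrix.sub_apply, Matrix.add_apply]; ring
  rw [c]
  refine (abs_add_le _ _).trans ?_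
  linarith [c₂ i j, c₃ i j]

/-- Errors of Double-POET in the other norms, for a threshold above the elementwise error. -/
theorem opNorm_errors_le (h : TwoLevel B L U b d μ N₁ N₂ lam₁ lam₂) (hη : 0 ≤ η) (hAs : Aᵀ = A)
    (hA : ∀ i j, |(A - (B * Bᵀ + blockDiagonal' L * (blockDiagonal' L)ᵀ + U)) i j| ≤ η)
    (hsmall : totalError b μ N₁ N₂ lam₁ lam₂ η ≤ 1 / 16)
    (he : 701 * b ^ 6 * totalError b μ N₁ N₂ lam₁ lam₂ η ≤ e) (he0 : 0 < e) (hed : e ≤ d / 2)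
    (hs : ∀ i j, IsShrinkage (s i j)) (hq : 0 ≤ q) (hq1 : q < 1) (hτe : 2 * e ≤ τ * (d / 2))
    {δ : ℝ} (hδ : (e + 2 * b * τ) * e ^ (-q) * sparsity q U ≤ δ) (hδd : δ ≤ d / 2)
    (hPOET : IsDoublePOET k r s τ A Su S)
    {a : ℝ} (ha : 0 ≤ a) (hN₁ : (Fintype.card ((j : Fin J) × Fin (size j)) : ℝ) = N₁)
    (hr : (∑ j, (r j : ℝ)) * N₂ ≤ a ^ 2 * N₁) :
    opNorm (Su - U) ≤ δ ∧
    opNorm (Su⁻¹ - U⁻¹) ≤ 2 / d ^ 2 * δ ∧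
    opNorm (S⁻¹ - (B * Bᵀ + blockDiagonal' L * (blockDiagonal' L)ᵀ + U)⁻¹) ≤
      2 / d ^ 2 * δ + 72 * b ^ 2 / d ^ 2 * totalError b μ N₁ N₂ lam₁ lam₂ η ∧
    relFrobError S (B * Bᵀ + blockDiagonal' L * (blockDiagonal' L)ᵀ + U) ≤
      1 / d * δ + (√k + a) * (6 * (1 / √d) * b + 8 * (1 / √d) ^ 2) *
        (totalError b μ N₁ N₂ lam₁ lam₂ η + √N₁ * totalError b μ N₁ N₂ lam₁ lam₂ η ^ 2) := by
  have hd := h.d_pos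
  obtain ⟨Rg, Rl', A', Δ, Δ', P, P', t, hSu, hS, c₁, c₂⟩ :=
    h.exists_parts hη hAs hA hsmall he hPOET
  have hδ' : ‖Su - U‖ ≤ δ := by
    rw [hSu]
    exact (norm_adaptiveThreshold_sub_le hs hq hq1 hd he0 hed hτe h.symm_U
      (le_diag_of_form h.form_U) h.diag_U_le c₁).trans hδ
  have hSud := hδ'.trans hδd
  have k₁ := norm_inv_sub_inv_le_of_form hd h.form_U hSud
  have k₂ := h.norm_inv_sub_inv_le hη hsmall t hSud
  have k₃ := h.relFrobError_le hη hsmall t (W := Su) ha hN₁ hr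
  rw [← hS] at k₂ k₃
  have m₁ : 2 / d ^ 2 * ‖Su - U‖ ≤ 2 / d ^ 2 * δ := by gcongr
  have m₂ : 1 / d * ‖Su - U‖ ≤ 1 / d * δ := by gcongr
  refine ⟨hδ', k₁.trans m₁, ?_, ?_⟩
  · exact k₂.trans (by linarith)
  · exact k₃.trans (by linarith)

end TwoLevel

end Estimator

/-! ### Rates -/

section Rates

variable {k : ℕ} {c a₁ a₂ q : ℝ}

theorem sparsity_nonneg {m : Type*} [Fintype m] (q : ℝ) (S : Matrix m m ℝ) : 0 ≤ sparsity q S :=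
  Real.iSup_nonneg fun i => Finset.sum_nonneg fun j _ => by
    split_ifs <;> positivity

theorem baseRate_nonneg (M : FactorModel k) : 0 ≤ M.baseRate := Real.sqrt_nonneg _

/-- `ω_{T,2}` with all powers of `p` in the numerators. -/
theorem omega₂_eq (M : FactorModel k) (hp : 0 < (M.p : ℝ)) :
    omega₂ M c a₁ a₂ q =
      (M.p : ℝ) ^ (5 / 2 * (1 - a₁) + 5 / 2 * c * (1 - a₂)) * M.baseRate
      + sparsity q M.SigmaU * (M.p : ℝ) ^ (-(c * (5 * a₂ - 3) / 2))
      + sparsity q M.SigmaU * (M.p : ℝ) ^ (-((5 * a₁ - 3 - 5 * c * (1 - a₂)) / 2)) := by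
  have h : ∀ x : ℝ, (√((M.p : ℝ) ^ x))⁻¹ = (M.p : ℝ) ^ (-(x / 2)) := by
    intro x
    rw [Real.sqrt_eq_rpow, ← Real.rpow_mul hp.le, ← Real.rpow_neg hp.le]
    congr 1
    ring
  have h' : ∀ x y : ℝ, y / √((M.p : ℝ) ^ x) = y * (M.p : ℝ) ^ (-(x / 2)) := fun x y => by
    rw [div_eq_mul_inv, h]
  rw [omega₂, h', h']

theorem omega₂_pos (M : FactorModel k) (hp : 0 < (M.p : ℝ)) (hm : 0 < sparsity q M.SigmaU) :
    0 < omega₂ M c a₁ a₂ q := by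
  rw [omega₂_eq M hp]
  have := baseRate_nonneg M
  positivity

/-- The error of the two levels of principal components, for groups of size of the order `p^c`,
is of the order `ω_{T,2}`. -/
theorem totalError_le_omega₂ (M : FactorModel k) (hp : 1 ≤ (M.p : ℝ)) (hc : 0 ≤ c)
    (ha₁ : a₁ ≤ 1) (ha₂ : a₂ ≤ 1) {b Cμ κ₁ κ₂ s K : ℝ} (hCμ : 0 ≤ Cμ)
    (hκ₁ : 0 < κ₁) (hκ₂ : 0 < κ₂) (hs : 0 < s) (hK : 0 ≤ K) :
    totalError b (Cμ * sparsity q M.SigmaU) M.p (s * (M.p : ℝ) ^ c)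
      (κ₁ * (M.p : ℝ) ^ a₁) (κ₂ * (M.p : ℝ) ^ (c * a₂)) (K * M.baseRate) ≤
    (s / κ₂) ^ 2 * (K + 700 * b ^ 6 * (κ₁⁻¹) ^ 2 * (K + Cμ) + Cμ / s) *
      omega₂ M c a₁ a₂ q := by
  have hp0 : 0 < (M.p : ℝ) := by linarith
  set p : ℝ := (M.p : ℝ) with hpdef
  set m := sparsity q M.SigmaU with hm
  set ρ := M.baseRate with hρ
  have hm0 : 0 ≤ m := sparsity_nonneg _ _
  have hρ0 : 0 ≤ ρ := baseRate_nonneg M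
  have hω := omega₂_eq (c := c) (a₁ := a₁) (a₂ := a₂) (q := q) M hp0
  rw [← hpdef, ← hm, ← hρ] at hω
  set ω := omega₂ M c a₁ a₂ q with hωdef
  have g₁ : (p / (κ₁ * p ^ a₁)) ^ 2 = (κ₁⁻¹) ^ 2 * p ^ (2 * (1 - a₁)) := by
    have e : p / (κ₁ * p ^ a₁) = κ₁⁻¹ * p ^ (1 - a₁) := by
      rw [Real.rpow_sub hp0, Real.rpow_one]; field_simp
    rw [e, mul_pow, ← Real.rpow_natCast (p ^ (1 - a₁)) 2, ← Real.rpow_mul hp0.le]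
    congr 2
    push_cast
    ring
  have g₂ : (s * p ^ c / (κ₂ * p ^ (c * a₂))) ^ 2 = (s / κ₂) ^ 2 * p ^ (2 * (c * (1 - a₂))) := by
    have e : s * p ^ c / (κ₂ * p ^ (c * a₂)) = s / κ₂ * p ^ (c * (1 - a₂)) := by
      rw [mul_sub, mul_one, Real.rpow_sub hp0]; field_simp
    rw [e, mul_pow, ← Real.rpow_natCast (p ^ (c * (1 - a₂))) 2, ← Real.rpow_mul hp0.le]
    congr 2
    push_cast
    ring
  set H₁ := p ^ (2 * (1 - a₁)) with hH₁
  set H₂ := p ^ (2 * (c * (1 - a₂))) with hH₂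
  have hc₂ : 0 ≤ c * (1 - a₂) := mul_nonneg hc (by linarith)
  have hH₁1 : 1 ≤ H₁ := Real.one_le_rpow hp (by linarith)
  have hH₂0 : 0 < H₂ := by positivity
  have t₁ : 0 ≤ p ^ (5 / 2 * (1 - a₁) + 5 / 2 * c * (1 - a₂)) * ρ := by positivity
  have t₂ : 0 ≤ m * p ^ (-(c * (5 * a₂ - 3) / 2)) := by positivity
  have t₃ : 0 ≤ m * p ^ (-((5 * a₁ - 3 - 5 * c * (1 - a₂)) / 2)) := by positivity
  -- the three contributions
  have f₁ : H₂ * (H₁ * ρ) ≤ ω := by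
    have : H₂ * H₁ ≤ p ^ (5 / 2 * (1 - a₁) + 5 / 2 * c * (1 - a₂)) := by
      rw [hH₁, hH₂, ← Real.rpow_add hp0]
      exact Real.rpow_le_rpow_of_exponent_le hp (by linarith)
    have : H₂ * H₁ * ρ ≤ p ^ (5 / 2 * (1 - a₁) + 5 / 2 * c * (1 - a₂)) * ρ := by gcongr
    linarith
  have f₂ : H₂ * (m / p ^ c) ≤ ω := by
    have : H₂ / p ^ c ≤ p ^ (-(c * (5 * a₂ - 3) / 2)) := by
      rw [hH₂, ← Real.rpow_sub hp0]
      exact Real.rpow_le_rpow_of_exponent_le hp (by linarith)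
    have : m * (H₂ / p ^ c) ≤ m * p ^ (-(c * (5 * a₂ - 3) / 2)) := by gcongr
    have e : H₂ * (m / p ^ c) = m * (H₂ / p ^ c) := by ring
    linarith
  have f₃ : H₂ * (H₁ * (m / p)) ≤ ω := by
    have : H₂ * H₁ / p ≤ p ^ (-((5 * a₁ - 3 - 5 * c * (1 - a₂)) / 2)) := by
      have e : H₂ * H₁ / p = p ^ (2 * (c * (1 - a₂)) + 2 * (1 - a₁) - 1) := by
        rw [Real.rpow_sub hp0, Real.rpow_add hp0, Real.rpow_one]
      rw [e]
      exact Real.rpow_le_rpow_of_exponent_le hp (by linarith)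
    have : m * (H₂ * H₁ / p) ≤ m * p ^ (-((5 * a₁ - 3 - 5 * c * (1 - a₂)) / 2)) := by gcongr
    have e : H₂ * (H₁ * (m / p)) = m * (H₂ * H₁ / p) := by ring
    linarith
  have f₀ : H₂ * ρ ≤ ω := by
    refine le_trans ?_ f₁
    gcongr
    exact le_mul_of_one_le_left hρ0 hH₁1
  have e : totalError b (Cμ * m) p (s * p ^ c) (κ₁ * p ^ a₁) (κ₂ * p ^ (c * a₂)) (K * ρ) =
      (s / κ₂) ^ 2 * (K * (H₂ * ρ) + 700 * b ^ 6 * (κ₁⁻¹) ^ 2 *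
        (K * (H₂ * (H₁ * ρ)) + Cμ * (H₂ * (H₁ * (m / p)))) + Cμ / s * (H₂ * (m / p ^ c))) := by
    unfold totalError localInput levelError
    rw [g₁, g₂]
    field_simp
  rw [e, mul_assoc ((s / κ₂) ^ 2)]
  have : K * (H₂ * ρ) + 700 * b ^ 6 * (κ₁⁻¹) ^ 2 *
        (K * (H₂ * (H₁ * ρ)) + Cμ * (H₂ * (H₁ * (m / p)))) + Cμ / s * (H₂ * (m / p ^ c)) ≤
      K * ω + 700 * b ^ 6 * (κ₁⁻¹) ^ 2 * (K * ω + Cμ * ω) + Cμ / s * ω := by gcongr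
  calc _ ≤ (s / κ₂) ^ 2 * (K * ω + 700 * b ^ 6 * (κ₁⁻¹) ^ 2 * (K * ω + Cμ * ω) + Cμ / s * ω) := by
        gcongr
    _ = _ := by ring

/-- The rate in the relative Frobenius norm dominates `√p ω_{T,2}²`. -/
theorem sqrt_mul_omega₂_sq_le (M : FactorModel k) (hp : 1 ≤ (M.p : ℝ)) :
    √(M.p : ℝ) * omega₂ M c a₁ a₂ q ^ 2 ≤
      3 * (relRate M c a₁ a₂ q - opRate M c a₁ a₂ q) := by
  have hp0 : 0 < (M.p : ℝ) := by linarith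
  rw [omega₂_eq M hp0]
  set p : ℝ := (M.p : ℝ) with hpdef
  set m := sparsity q M.SigmaU with hm
  have hρ : M.baseRate ^ 2 = Real.log p / M.T := by
    rw [FactorModel.baseRate, Real.sq_sqrt]
    have := Real.log_nonneg hp
    positivity
  have hpow : ∀ x y : ℝ, 1 / 2 + 2 * x = y → √p * (p ^ x) ^ 2 = p ^ y := by
    intro x y h
    rw [Real.sqrt_eq_rpow, ← Real.rpow_natCast (p ^ x) 2, ← Real.rpow_mul hp0.le,
      ← Real.rpow_add hp0, ← h]
    congr 1
    push_cast
    ring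
  set x₁ := p ^ (5 / 2 * (1 - a₁) + 5 / 2 * c * (1 - a₂)) * M.baseRate with hx₁
  set x₂ := m * p ^ (-(c * (5 * a₂ - 3) / 2)) with hx₂
  set x₃ := m * p ^ (-((5 * a₁ - 3 - 5 * c * (1 - a₂)) / 2)) with hx₃
  have y₁ : √p * x₁ ^ 2 = p ^ (11 / 2 - 5 * a₁ + 5 * c * (1 - a₂)) * (Real.log p / M.T) := by
    rw [hx₁, mul_pow, hρ, ← mul_assoc,
      hpow _ (11 / 2 - 5 * a₁ + 5 * c * (1 - a₂)) (by ring)]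
  have y₂ : √p * x₂ ^ 2 = m ^ 2 / p ^ (c * (5 * a₂ - 3) - 1 / 2) := by
    rw [hx₂, mul_pow, mul_left_comm, hpow _ (-(c * (5 * a₂ - 3) - 1 / 2)) (by ring),
      Real.rpow_neg hp0.le]
    exact (div_eq_mul_inv _ _).symm
  have y₃ : √p * x₃ ^ 2 = m ^ 2 / p ^ (5 * a₁ - 7 / 2 - 5 * c * (1 - a₂)) := by
    rw [hx₃, mul_pow, mul_left_comm, hpow _ (-(5 * a₁ - 7 / 2 - 5 * c * (1 - a₂))) (by ring),
      Real.rpow_neg hp0.le]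
    exact (div_eq_mul_inv _ _).symm
  have hrel : relRate M c a₁ a₂ q - opRate M c a₁ a₂ q =
      √p * x₁ ^ 2 + √p * x₃ ^ 2 + √p * x₂ ^ 2 := by
    rw [y₁, y₂, y₃, relRate]; ring
  rw [hrel]
  have hs : 0 ≤ √p := Real.sqrt_nonneg _
  nlinarith [mul_nonneg hs (sq_nonneg (x₁ - x₂)), mul_nonneg hs (sq_nonneg (x₁ - x₃)),
    mul_nonneg hs (sq_nonneg (x₂ - x₃))]

end Rates

/-! ### The sequence of models -/

section Sequence

open scoped Matrix.Norms.L2Operator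

variable {k : ℕ} {M : ℕ → FactorModel k} {c a₁ a₂ q : ℝ}

theorem FactorModel.SigmaU_transpose (M : FactorModel k) : M.SigmaUᵀ = M.SigmaU := by
  rw [← M.cov_U ⟨0, M.T_pos⟩, covMatrix_transpose]

theorem FactorModel.Sigma_eq (M : FactorModel k) :
    M.Sigma = M.B * M.Bᵀ + blockDiagonal' M.L * (blockDiagonal' M.L)ᵀ + M.SigmaU :=
  M.cov_y _

theorem FactorModel.sampleCov_transpose (M : FactorModel k) (ω : M.Ω) :
    (M.sampleCov ω)ᵀ = M.sampleCov ω := by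
  simp only [FactorModel.sampleCov, transpose_smul, transpose_sum, transpose_vecMulVec]

theorem FactorModel.p_eq_sum (M : FactorModel k) : M.p = ∑ j, M.size j := by
  simp [FactorModel.p]

/-- A row with entries at most `d` and at most `R` columns. -/
theorem vecNorm_row_le_of_maxNorm {m n : Type*} [Fintype m] [Fintype n] [DecidableEq n]
    {A : Matrix m n ℝ}
    {d R : ℝ} (hA : maxNorm A ≤ d) (hR : (Fintype.card n : ℝ) ≤ R) (i : m) :
    vecNorm (A.row i) ≤ √R * d :=
  vecNorm_le_of_abs_le ((maxNorm_nonneg A).trans hA) hR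
    fun j => (abs_apply_le_maxNorm A i j).trans hA

theorem maxNorm_le_maxNorm_blockDiagonal' {o : Type*} [Fintype o] [DecidableEq o]
    {m n : o → Type*} [∀ i, Fintype (m i)] [∀ i, Fintype (n i)]
    (A : ∀ i, Matrix (m i) (n i) ℝ) (j : o) : maxNorm (A j) ≤ maxNorm (blockDiagonal' A) := by
  refine maxNorm_le (maxNorm_nonneg _) fun a b => ?_
  have := abs_apply_le_maxNorm (blockDiagonal' A) ⟨j, a⟩ ⟨j, b⟩
  rwa [blockDiagonal'_apply_eq] at this

theorem sum_abs_row_le_oneNorm {n : Type*} [Fintype n] {U : Matrix n n ℝ} (hU : Uᵀ = U) (i : n) :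
    ∑ j, |U i j| ≤ oneNorm U := by
  have : ∑ j, |U i j| = ∑ j, |U j i| := by
    conv_lhs => rw [← hU]
    rfl
  rw [this]
  exact le_ciSup (f := fun j => ∑ i, |U i j|) (Set.finite_range _).bddAbove i

/-- A diagonal that is bounded away from zero bounds the sparsity level away from zero. -/
theorem le_sparsity {n : Type*} [Fintype n] [DecidableEq n] {U : Matrix n n ℝ} {d : ℝ}
    (hq : 0 ≤ q) (hd : 0 < d) (hU : ∀ i, d ≤ U i i) (i : n) : d ^ q ≤ sparsity q U := by
  have h1 : d ^ q ≤ (if U i i = 0 then 0 else |U i i| ^ q) := by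
    rw [if_neg (by linarith [hU i])]
    exact Real.rpow_le_rpow hd.le ((hU i).trans (le_abs_self _)) hq
  refine h1.trans (le_trans ?_ (sum_le_sparsity q U i))
  exact Finset.single_le_sum (f := fun j => if U i j = 0 then 0 else |U i j| ^ q)
    (fun j _ => by split_ifs <;> positivity) (Finset.mem_univ i)

/-- Strength of loadings from the spectrum of their scaled Gram matrix. -/
theorem loadings_form_of_spectrum {m n : Type*} [Fintype m] [DecidableEq m] [Fintype n]
    [DecidableEq n] {A : Matrix m n ℝ} {κ s : ℝ} (hs : 0 < s)
    (h : ∀ x ∈ spectrum ℝ (s⁻¹ • (Aᵀ * A)), κ ≤ x) (v : n → ℝ) :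
    κ * s * vecNorm v ^ 2 ≤ vecNorm (A *ᵥ v) ^ 2 := by
  have h1 := le_dotProduct_mulVec_of_spectrum (A := s⁻¹ • (Aᵀ * A)) (by simp) h v
  rw [smul_mulVec, dotProduct_smul, ← vecNorm_mulVec_sq, ← vecNorm_sq, smul_eq_mul,
    inv_mul_eq_div, le_div_iff₀ hs] at h1
  linarith

/-- Eventually, the models satisfy the hypotheses of the deterministic error bounds, with constants
that do not depend on the data. -/
theorem Assumptions.eventually_twoLevel (hM : Assumptions M c a₁ a₂ q)
    (orthogonal : ∀ n, (M n).Bᵀ * (M n).Lam = 0) :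
    ∃ b d Cμ κ₁ κ₂ s a m₀ : ℝ, 0 < b ∧ 0 < d ∧ 0 < Cμ ∧ 0 < κ₁ ∧ 0 < κ₂ ∧ 0 < s ∧ 0 ≤ a ∧ 0 < m₀ ∧
      ∀ᶠ n in atTop, 1 ≤ ((M n).p : ℝ) ∧ m₀ ≤ sparsity q (M n).SigmaU ∧
        TwoLevel (M n).B (M n).L (M n).SigmaU b d (Cμ * sparsity q (M n).SigmaU) (M n).p
          (s * ((M n).p : ℝ) ^ c) (κ₁ * ((M n).p : ℝ) ^ a₁) (κ₂ * ((M n).p : ℝ) ^ (c * a₂)) ∧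
        (∑ j, ((M n).r j : ℝ)) * (s * ((M n).p : ℝ) ^ c) ≤ a ^ 2 * (M n).p := by
  obtain ⟨R, hR⟩ := hM.r_bdd
  obtain ⟨s₁, s₂, hs₁, hs₂, hsize⟩ := hM.size_order
  obtain ⟨κB, hκB, hB⟩ := hM.pervasive_B
  obtain ⟨κL, hκL, hL⟩ := hM.pervasive_L
  obtain ⟨dl, hdl, hload⟩ := hM.loadings_bdd
  obtain ⟨d, hd, hlow⟩ := hM.eig_lower
  obtain ⟨D, hD, hup⟩ := hM.eig_upper
  obtain ⟨d₂, hd₂, hone⟩ := hM.oneNorm_le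
  obtain ⟨hc0, hc1⟩ := hM.c_mem
  obtain ⟨ha₁, ha₁1⟩ := hM.a₁_mem
  obtain ⟨ha₂, ha₂1⟩ := hM.a₂_mem
  obtain ⟨hq0, hq1⟩ := hM.q_mem
  have hac : c < a₁ := by linarith
  set b := 1 + d + D + √k * dl + √R * dl with hb
  have hkd : 0 ≤ √(k : ℝ) * dl := by positivity
  have hRd : 0 ≤ √(R : ℝ) * dl := by positivity
  have hb1 : 1 ≤ b := by linarith
  have hm₀ : 0 < d ^ q := by positivity
  -- the minima ensure that the strengths do not exceed the numbers of variables
  set κ₁ := min κB 1 with hκ₁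
  set κ₂ := min (κL * s₁ ^ a₂) s₂ with hκ₂
  have hκ₁0 : 0 < κ₁ := lt_min hκB one_pos
  have hκ₂0 : 0 < κ₂ := lt_min (by positivity) hs₂
  have hp : Tendsto (fun n => ((M n).p : ℝ)) atTop atTop :=
    tendsto_natCast_atTop_atTop.comp hM.p_tendsto
  -- the global strength `p ^ a₁` dominates the group size `p ^ c`, as `a₁ > (3 + 2 c) / 5 ≥ c`
  have hsep : ∀ᶠ n in atTop, b ^ 2 * s₂ * 8 / κ₁ ≤ ((M n).p : ℝ) ^ (a₁ - c) :=
    ((tendsto_rpow_atTop (by linarith)).comp hp).eventually_ge_atTop _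
  refine ⟨b, d, d₂ + b / d ^ q, κ₁, κ₂, s₂, √(R * s₂ / s₁), d ^ q, by linarith, hd, by positivity,
    hκ₁0, hκ₂0, hs₂, Real.sqrt_nonneg _, hm₀, ?_⟩
  filter_upwards [hsize, hB, hL, hsep, hp.eventually_ge_atTop 1] with n hsz hBn hLn hsepn hpn
  set p : ℝ := ((M n).p : ℝ) with hpdef
  have hp0 : 0 < p := by linarith
  have hne : Nonempty (M n).Idx := by
    refine Fintype.card_pos_iff.1 ?_
    have : (0 : ℝ) < (M n).p := hp0
    exact_mod_cast this
  have hform : ∀ y, d * vecNorm y ^ 2 ≤ y ⬝ᵥ ((M n).SigmaU *ᵥ y) := fun y => by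
    rw [vecNorm_sq]
    exact le_dotProduct_mulVec_of_spectrum (M n).SigmaU_transpose (fun x hx => (hlow n x hx).le) y
  have hm : d ^ q ≤ sparsity q (M n).SigmaU :=
    le_sparsity hq0 hd (le_diag_of_form hform) hne.some
  have hU : ‖(M n).SigmaU‖ ≤ D := by
    refine l2norm_le_of_form_le hD (M n).SigmaU_transpose (fun y => ?_) (fun y => ?_)
    · exact le_trans (by positivity) (hform y)
    · rw [vecNorm_sq]
      exact dotProduct_mulVec_le_of_spectrum (M n).SigmaU_transpose (hup n) y
  refine ⟨hpn, hm, ?_, ?_⟩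
  · refine ⟨hb1, hd, by linarith, ?_, le_of_eq rfl, fun j => (hsz j).2, by positivity,
      by positivity, ?_, ?_, fun i => ?_, fun j i => ?_, orthogonal n, (M n).SigmaU_transpose,
      by linarith, fun i => ?_, hform, fun v => ?_, fun j v => ?_, ?_⟩
    · have : b / d ^ q * d ^ q ≤ b / d ^ q * sparsity q (M n).SigmaU := by gcongr
      rw [div_mul_cancel₀ _ hm₀.ne'] at this
      have : 0 ≤ d₂ * sparsity q (M n).SigmaU := mul_nonneg hd₂.le (sparsity_nonneg _ _)
      linarith
    · have : p ^ a₁ ≤ p ^ (1 : ℝ) := Real.rpow_le_rpow_of_exponent_le hpn ha₁1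
      rw [Real.rpow_one] at this
      calc κ₁ * p ^ a₁ ≤ 1 * p := mul_le_mul (min_le_right _ _) this (by positivity) zero_le_one
        _ = p := one_mul p
    · have : p ^ (c * a₂) ≤ p ^ c := Real.rpow_le_rpow_of_exponent_le hpn (by nlinarith)
      exact mul_le_mul (min_le_right _ _) this (by positivity) hs₂.le
    · refine (vecNorm_row_le_of_maxNorm (hload n).1 (R := k) (by simp) i).trans ?_
      linarith
    · refine (vecNorm_row_le_of_maxNorm
        ((maxNorm_le_maxNorm_blockDiagonal' (M n).L j).trans (hload n).2) (R := R) ?_ i).trans ?_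
      · simpa using hR n j
      · linarith
    · refine (sum_abs_row_le_oneNorm (M n).SigmaU_transpose i).trans ((hone n).trans ?_)
      have := sparsity_nonneg q (M n).SigmaU
      gcongr
      have : 0 ≤ b / d ^ q := by positivity
      linarith
    · refine le_trans ?_ (loadings_form_of_spectrum (by positivity) hBn v)
      gcongr
      exact min_le_left _ _
    · have hsj : 0 < ((M n).size j : ℝ) := lt_of_lt_of_le (by positivity) (hsz j).1
      refine le_trans ?_ (loadings_form_of_spectrum (by positivity) (hLn j) v)
      gcongr ?_ * _
      calc κ₂ * p ^ (c * a₂) ≤ κL * s₁ ^ a₂ * p ^ (c * a₂) := by gcongr; exact min_le_left _ _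
        _ = κL * (s₁ * p ^ c) ^ a₂ := by
            rw [Real.mul_rpow hs₁.le (by positivity), ← Real.rpow_mul hp0.le, mul_assoc]
        _ ≤ _ := by
            gcongr
            exact (hsz j).1
    · rw [div_le_iff₀ hκ₁0, Real.rpow_sub hp0, div_mul_eq_mul_div, le_div_iff₀ (by positivity)]
        at hsepn
      linarith
  · -- there are at most `p / (s₁ p ^ c)` groups
    have hJ : ((M n).J : ℝ) * (s₁ * p ^ c) ≤ p := by
      have : p = ∑ j, ((M n).size j : ℝ) := by
        rw [hpdef, (M n).p_eq_sum]; push_cast; rfl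
      calc ((M n).J : ℝ) * (s₁ * p ^ c) = ∑ _j : Fin (M n).J, s₁ * p ^ c := by simp
        _ ≤ ∑ j, ((M n).size j : ℝ) := Finset.sum_le_sum fun j _ => (hsz j).1
        _ = p := this.symm
    have hr : ∑ j, ((M n).r j : ℝ) ≤ (M n).J * R := by
      calc ∑ j, ((M n).r j : ℝ) ≤ ∑ _j : Fin (M n).J, (R : ℝ) :=
            Finset.sum_le_sum fun j _ => by exact_mod_cast hR n j
        _ = _ := by simp
    rw [Real.sq_sqrt (by positivity)]
    calc (∑ j, ((M n).r j : ℝ)) * (s₂ * p ^ c) ≤ (M n).J * R * (s₂ * p ^ c) := by gcongr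
      _ = R * s₂ / s₁ * ((M n).J * (s₁ * p ^ c)) := by field_simp
      _ ≤ _ := by gcongr

end Sequence

/-! ### Error bounds on the event of a close sample covariance matrix -/

section Final

variable {k : ℕ} {M : ℕ → FactorModel k} {c a₁ a₂ q K : ℝ}

/-- The rate in the operator norm is at least a multiple of `ω_{T,2}`, since the sparsity level is
bounded away from zero. -/
theorem omega₂_le_opRate (M : FactorModel k) {m₀ : ℝ} (hq : 0 ≤ q) (hm₀ : 0 < m₀)
    (hm : m₀ ≤ sparsity q M.SigmaU) (h0 : 0 < omega₂ M c a₁ a₂ q) (h1 : omega₂ M c a₁ a₂ q ≤ 1) :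
    omega₂ M c a₁ a₂ q ≤ m₀⁻¹ * opRate M c a₁ a₂ q := by
  have h2 : omega₂ M c a₁ a₂ q ≤ omega₂ M c a₁ a₂ q ^ (1 - q) := by
    simpa using Real.rpow_le_rpow_of_exponent_ge h0 h1 (y := 1) (z := 1 - q) (by linarith)
  rw [inv_mul_eq_div, le_div_iff₀ hm₀, opRate, mul_comm]
  exact mul_le_mul hm h2 h0.le (hm₀.le.trans hm)

/-- Consistency in operator norm forces `ω_{T,2} → 0`, since the sparsity level is bounded away from
zero. -/
theorem tendsto_omega₂ (hq : q < 1) {m₀ : ℝ} (hm₀ : 0 < m₀)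
    (hm : ∀ᶠ n in atTop, 0 < omega₂ (M n) c a₁ a₂ q ∧ m₀ ≤ sparsity q (M n).SigmaU)
    (hrate : Tendsto (fun n => opRate (M n) c a₁ a₂ q) atTop (𝓝 0)) :
    Tendsto (fun n => omega₂ (M n) c a₁ a₂ q) atTop (𝓝 0) := by
  have h1 : Tendsto (fun n => omega₂ (M n) c a₁ a₂ q ^ (1 - q)) atTop (𝓝 0) := by
    have h2 := hrate.const_mul m₀⁻¹
    rw [mul_zero] at h2
    refine squeeze_zero' ?_ ?_ h2
    · filter_upwards [hm] with n hn
      exact Real.rpow_nonneg hn.1.le _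
    · filter_upwards [hm] with n hn
      have := Real.rpow_nonneg hn.1.le (1 - q)
      rw [inv_mul_eq_div, le_div_iff₀ hm₀, opRate, mul_comm]
      exact mul_le_mul_of_nonneg_right hn.2 this
  have hq' : 0 < 1 - q := by linarith
  have h3 := h1.rpow_const (p := (1 - q)⁻¹) (Or.inr (by positivity))
  rw [Real.zero_rpow (by positivity)] at h3
  refine h3.congr' ?_
  filter_upwards [hm] with n hn
  rw [← Real.rpow_mul hn.1.le, mul_inv_cancel₀ hq'.ne', Real.rpow_one]

/-- On the event that the sample covariance matrix is within `K √(log p / T)` of `Σ`, the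
deterministic error bounds apply with the elementwise error `C₁ ω_{T,2}` of the idiosyncratic
part. -/
theorem Assumptions.eventually_totalError_le (hM : Assumptions M c a₁ a₂ q)
    (orthogonal : ∀ n, (M n).Bᵀ * (M n).Lam = 0)
    (hrate : Tendsto (fun n => opRate (M n) c a₁ a₂ q) atTop (𝓝 0)) (hK : 0 ≤ K) :
    ∃ b d a m₀ C₁ : ℝ, 0 < b ∧ 0 < d ∧ 0 ≤ a ∧ 0 < m₀ ∧ 0 < C₁ ∧
      ∀ᶠ n in atTop, ∃ μ N₂ lam₁ lam₂ : ℝ,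
        TwoLevel (M n).B (M n).L (M n).SigmaU b d μ (M n).p N₂ lam₁ lam₂ ∧
        1 ≤ ((M n).p : ℝ) ∧ m₀ ≤ sparsity q (M n).SigmaU ∧
        0 < omega₂ (M n) c a₁ a₂ q ∧ omega₂ (M n) c a₁ a₂ q ≤ 1 ∧
        totalError b μ (M n).p N₂ lam₁ lam₂ (K * (M n).baseRate) ≤ 1 / 16 ∧
        701 * b ^ 6 * totalError b μ (M n).p N₂ lam₁ lam₂ (K * (M n).baseRate) ≤
          C₁ * omega₂ (M n) c a₁ a₂ q ∧
        C₁ * omega₂ (M n) c a₁ a₂ q ≤ d / 2 ∧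
        (∑ j, ((M n).r j : ℝ)) * N₂ ≤ a ^ 2 * (M n).p := by
  obtain ⟨b, d, Cμ, κ₁, κ₂, s, a, m₀, hb, hd, hCμ, hκ₁, hκ₂, hs, ha, hm₀, hev⟩ :=
    hM.eventually_twoLevel orthogonal
  obtain ⟨hq0, hq1⟩ := hM.q_mem
  set C := (s / κ₂) ^ 2 * (K + 700 * b ^ 6 * (κ₁⁻¹) ^ 2 * (K + Cμ) + Cμ / s) with hC
  have hC0 : 0 < C := by positivity
  have hω := tendsto_omega₂ (c := c) (a₁ := a₁) (a₂ := a₂) hq1 hm₀ (by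
    filter_upwards [hev] with n hn
    exact ⟨omega₂_pos _ (by linarith [hn.1]) (hm₀.trans_le hn.2.1), hn.2.1⟩) hrate
  have e₁ := (hω.const_mul C).eventually_le_const (u := 1 / 16) (by norm_num)
  have e₂ := (hω.const_mul (701 * b ^ 6 * C)).eventually_le_const (u := d / 2)
    (by rw [mul_zero]; positivity)
  have e₃ := hω.eventually_le_const (u := 1) one_pos
  refine ⟨b, d, a, m₀, 701 * b ^ 6 * C, hb, hd, ha, hm₀, by positivity, ?_⟩
  filter_upwards [hev, e₁, e₂, e₃] with n hn h₁ h₂ h₃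
  obtain ⟨hp, hm, htl, hr⟩ := hn
  have hX := totalError_le_omega₂ (q := q) (b := b) (M n) hp hM.c_mem.1.le hM.a₁_mem.2 hM.a₂_mem.2
    hCμ.le hκ₁ hκ₂ hs hK
  rw [← hC] at hX
  refine ⟨_, _, _, _, htl, hp, hm, omega₂_pos _ (by linarith) (hm₀.trans_le hm), h₃,
    hX.trans h₁, ?_, h₂, hr⟩
  rw [mul_assoc (701 * b ^ 6) C]
  gcongr

theorem FactorModel.abs_sampleCov_sub_le (M : FactorModel k) {ω : M.Ω} {η : ℝ}
    (h : maxNorm (M.sampleCov ω - M.Sigma) ≤ η) (i j : M.Idx) :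
    |(M.sampleCov ω - (M.B * M.Bᵀ + blockDiagonal' M.L * (blockDiagonal' M.L)ᵀ + M.SigmaU)) i j|
      ≤ η := by
  rw [← M.Sigma_eq]
  exact (abs_apply_le_maxNorm _ i j).trans h

/-- Elementwise errors on the event of a close sample covariance matrix, for every threshold of the
order `ω_{T,2}`. -/
theorem Assumptions.eventually_maxNorm_le (hM : Assumptions M c a₁ a₂ q)
    (orthogonal : ∀ n, (M n).Bᵀ * (M n).Lam = 0)
    (hrate : Tendsto (fun n => opRate (M n) c a₁ a₂ q) atTop (𝓝 0))
    {s : (n : ℕ) → (M n).Idx → (M n).Idx → ℝ → ℝ → ℝ} (hs : ∀ n i j, IsShrinkage (s n i j))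
    (hK : 0 ≤ K) {τ : ℕ → ℝ} (hτ : SameOrder τ (fun n => omega₂ (M n) c a₁ a₂ q)) :
    ∃ C : ℝ, ∀ᶠ n in atTop, ∀ ω,
      maxNorm ((M n).sampleCov ω - (M n).Sigma) ≤ K * (M n).baseRate → ∀ Su S,
      IsDoublePOET k (M n).r (s n) (τ n) ((M n).sampleCov ω) Su S →
      maxNorm (Su - (M n).SigmaU) ≤ C * omega₂ (M n) c a₁ a₂ q ∧
      maxNorm (S - (M n).Sigma) ≤ C * omega₂ (M n) c a₁ a₂ q := by
  obtain ⟨b, d, a, m₀, C₁, hb, hd, ha, hm₀, hC₁, hev⟩ :=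
    hM.eventually_totalError_le orthogonal hrate hK
  obtain ⟨cτ, Cτ, hcτ, hCτ, hτ⟩ := hτ
  refine ⟨2 * C₁ + 2 * b * Cτ, ?_⟩
  filter_upwards [hev, hτ] with n hn hτn ω hω Su S hPOET
  obtain ⟨μ, N₂, lam₁, lam₂, htl, hp, hm, hpos, -, hX, he, hed, -⟩ := hn
  have hη : 0 ≤ K * (M n).baseRate := mul_nonneg hK (baseRate_nonneg _)
  have hτ0 : 0 ≤ τ n := le_trans (by positivity) hτn.1
  obtain ⟨r₁, r₂⟩ := htl.maxNorm_errors_le hη ((M n).sampleCov_transpose ω)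
    ((M n).abs_sampleCov_sub_le hω) hX he hed (hs n) hτ0 hPOET
  rw [← (M n).Sigma_eq] at r₂
  have h1 : 2 * b * τ n ≤ 2 * b * (Cτ * omega₂ (M n) c a₁ a₂ q) := by gcongr; exact hτn.2
  have h2 : 0 ≤ C₁ * omega₂ (M n) c a₁ a₂ q := by positivity
  constructor <;> linarith

theorem opRate_le_relRate (M : FactorModel k) (hp : 1 ≤ (M.p : ℝ)) :
    opRate M c a₁ a₂ q ≤ relRate M c a₁ a₂ q := by
  have := sqrt_mul_omega₂_sq_le (c := c) (a₁ := a₁) (a₂ := a₂) (q := q) M hp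
  have h : 0 ≤ √(M.p : ℝ) * omega₂ M c a₁ a₂ q ^ 2 := by positivity
  linarith

/-- Errors in the other norms on the event of a close sample covariance matrix, for thresholds with
a constant that depends on the constant `K` of this event. -/
theorem Assumptions.eventually_opNorm_le (hM : Assumptions M c a₁ a₂ q)
    (orthogonal : ∀ n, (M n).Bᵀ * (M n).Lam = 0)
    (hrate : Tendsto (fun n => opRate (M n) c a₁ a₂ q) atTop (𝓝 0))
    {s : (n : ℕ) → (M n).Idx → (M n).Idx → ℝ → ℝ → ℝ} (hs : ∀ n i j, IsShrinkage (s n i j))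
    (hK : 0 ≤ K) :
    ∃ C₀ : ℝ, 0 < C₀ ∧ ∀ τ : ℕ → ℝ, SameOrder τ (fun n => omega₂ (M n) c a₁ a₂ q) →
      (∀ᶠ n in atTop, C₀ * omega₂ (M n) c a₁ a₂ q ≤ τ n) →
      ∃ C : ℝ, ∀ᶠ n in atTop, ∀ ω,
      maxNorm ((M n).sampleCov ω - (M n).Sigma) ≤ K * (M n).baseRate → ∀ Su S,
      IsDoublePOET k (M n).r (s n) (τ n) ((M n).sampleCov ω) Su S →
      opNorm (Su - (M n).SigmaU) ≤ C * opRate (M n) c a₁ a₂ q ∧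
      opNorm (Su⁻¹ - (M n).SigmaU⁻¹) ≤ C * opRate (M n) c a₁ a₂ q ∧
      opNorm (S⁻¹ - (M n).Sigma⁻¹) ≤ C * opRate (M n) c a₁ a₂ q ∧
      relFrobError S (M n).Sigma ≤ C * relRate (M n) c a₁ a₂ q := by
  obtain ⟨b, d, a, m₀, C₁, hb, hd, ha, hm₀, hC₁, hev⟩ :=
    hM.eventually_totalError_le orthogonal hrate hK
  obtain ⟨hq0, hq1⟩ := hM.q_mem
  -- the threshold of an entry is at least `τ d / 2`, which has to be twice the error `C₁ ω_{T,2}`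
  refine ⟨4 * C₁ / d, by positivity, fun τ hτ hτC₀ => ?_⟩
  obtain ⟨cτ, Cτ, hcτ, hCτ, hτ⟩ := hτ
  set C₃ := (C₁ + 2 * b * Cτ) * C₁ ^ (-q) with hC₃
  have hC₃0 : 0 < C₃ := by positivity
  have hδ := (hrate.const_mul C₃).eventually_le_const (u := d / 2) (by rw [mul_zero]; positivity)
  set D₃ := 2 / d ^ 2 * C₃ + 72 * b ^ 2 / d ^ 2 * (C₁ * m₀⁻¹) with hD₃
  set D₄ := 1 / d * C₃ + (√k + a) * (6 * (1 / √d) * b + 8 * (1 / √d) ^ 2) *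
    (C₁ * m₀⁻¹ + 3 * C₁ ^ 2) with hD₄
  have hD₃0 : 0 ≤ D₃ := by positivity
  have hD₄0 : 0 ≤ D₄ := by positivity
  have hD₂0 : 0 ≤ 2 / d ^ 2 * C₃ := by positivity
  refine ⟨C₃ + D₃ + D₄, ?_⟩
  filter_upwards [hev, hτ, hτC₀, hδ] with n hn hτn hτC₀n hδn ω hω Su S hPOET
  obtain ⟨μ, N₂, lam₁, lam₂, htl, hp, hm, hpos, hone, hX, he, hed, hr⟩ := hn
  have hη : 0 ≤ K * (M n).baseRate := mul_nonneg hK (baseRate_nonneg _)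
  set w := omega₂ (M n) c a₁ a₂ q with hw
  set X := totalError b μ (M n).p N₂ lam₁ lam₂ (K * (M n).baseRate) with hXdef
  have hX0 : 0 ≤ X := by
    obtain ⟨-, r2, r3⟩ := htl.errors_le hη
    exact r3.trans r2
  have hXw : X ≤ C₁ * w := by
    have : 1 ≤ b ^ 6 := one_le_pow₀ htl.one_le
    nlinarith
  have hwr := omega₂_le_opRate (c := c) (a₁ := a₁) (a₂ := a₂) (M n) hq0 hm₀ hm hpos hone
  have hop0 : 0 ≤ opRate (M n) c a₁ a₂ q :=
    mul_nonneg (sparsity_nonneg _ _) (Real.rpow_nonneg hpos.le _)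
  have hrel := opRate_le_relRate (c := c) (a₁ := a₁) (a₂ := a₂) (q := q) (M n) hp
  have hsq := sqrt_mul_omega₂_sq_le (c := c) (a₁ := a₁) (a₂ := a₂) (q := q) (M n) hp
  have hδ' : (C₁ * w + 2 * b * τ n) * (C₁ * w) ^ (-q) * sparsity q (M n).SigmaU ≤
      C₃ * opRate (M n) c a₁ a₂ q := by
    have e : C₃ * opRate (M n) c a₁ a₂ q =
        (C₁ * w + 2 * b * (Cτ * w)) * (C₁ * w) ^ (-q) * sparsity q (M n).SigmaU := by
      have : w ^ (1 - q) = w * w ^ (-q) := by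
        rw [sub_eq_add_neg, Real.rpow_add hpos, Real.rpow_one]
      rw [opRate, ← hw, this, Real.mul_rpow hC₁.le hpos.le, hC₃]
      ring
    rw [e]
    have := sparsity_nonneg q (M n).SigmaU
    gcongr
    exact hτn.2
  have hτe : 2 * (C₁ * w) ≤ τ n * (d / 2) := by
    calc 2 * (C₁ * w) = 4 * C₁ / d * w * (d / 2) := by field_simp; ring
      _ ≤ _ := by gcongr
  obtain ⟨r₁, r₂, r₃, r₄⟩ := htl.opNorm_errors_le hη ((M n).sampleCov_transpose ω)
    ((M n).abs_sampleCov_sub_le hω) hX he (by positivity) hed (hs n) hq0 hq1 hτe hδ' hδn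
    hPOET ha rfl hr
  rw [← (M n).Sigma_eq] at r₃ r₄
  have hXop : X ≤ C₁ * m₀⁻¹ * opRate (M n) c a₁ a₂ q :=
    hXw.trans (by rw [mul_assoc]; gcongr)
  have hXsq : √((M n).p : ℝ) * X ^ 2 ≤ 3 * C₁ ^ 2 * relRate (M n) c a₁ a₂ q := by
    calc √((M n).p : ℝ) * X ^ 2 ≤ √((M n).p : ℝ) * (C₁ * w) ^ 2 := by gcongr
      _ = C₁ ^ 2 * (√((M n).p : ℝ) * w ^ 2) := by ring
      _ ≤ C₁ ^ 2 * (3 * relRate (M n) c a₁ a₂ q) :=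
          mul_le_mul_of_nonneg_left (hsq.trans (by linarith)) (by positivity)
      _ = _ := by ring
  have hrel0 := hop0.trans hrel
  refine ⟨r₁.trans ?_, r₂.trans ?_, r₃.trans ?_, r₄.trans ?_⟩
  · gcongr; linarith
  · rw [← mul_assoc]
    gcongr
    have : 0 ≤ 72 * b ^ 2 / d ^ 2 * (C₁ * m₀⁻¹) := by positivity
    linarith
  · calc _ ≤ 2 / d ^ 2 * (C₃ * opRate (M n) c a₁ a₂ q) +
          72 * b ^ 2 / d ^ 2 * (C₁ * m₀⁻¹ * opRate (M n) c a₁ a₂ q) := by gcongr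
      _ = D₃ * opRate (M n) c a₁ a₂ q := by rw [hD₃]; ring
      _ ≤ _ := by gcongr; linarith
  · calc _ ≤ 1 / d * (C₃ * relRate (M n) c a₁ a₂ q) +
          (√k + a) * (6 * (1 / √d) * b + 8 * (1 / √d) ^ 2) *
          (C₁ * m₀⁻¹ * relRate (M n) c a₁ a₂ q + 3 * C₁ ^ 2 * relRate (M n) c a₁ a₂ q) := by
          gcongr
          exact hXop.trans (by gcongr)
      _ = D₄ * relRate (M n) c a₁ a₂ q := by rw [hD₄]; ring
      _ ≤ _ := by gcongr; linarith

/-! ### Bounds in probability -/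

/-- A bound on the event that the sample covariance matrix is close to `Σ` is a bound up to the
probability of its complement. -/
theorem BoundedUpTo.of_forall_close {ε : ℝ} {X : (n : ℕ) → (M n).Ω → ℝ} {a : ℕ → ℝ}
    (hP : ∀ᶠ n in atTop, (M n).P {ω | K * (M n).baseRate <
      maxNorm ((M n).sampleCov ω - (M n).Sigma)} ≤ ENNReal.ofReal ε) {C : ℝ}
    (hX : ∀ᶠ n in atTop, ∀ ω, maxNorm ((M n).sampleCov ω - (M n).Sigma) ≤ K * (M n).baseRate →
      |X n ω| ≤ C * a n) : BoundedUpTo M ε X a := by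
  refine ⟨C, ?_⟩
  filter_upwards [hP, hX] with n hPn hXn
  refine (measure_mono fun ω hω => ?_).trans hPn
  by_contra h
  exact absurd (hXn ω (not_lt.1 h)) (not_le.2 hω)

/-- The sample covariance matrix is close to `Σ` up to any level, with a nonnegative constant. -/
theorem Assumptions.exists_close (hM : Assumptions M c a₁ a₂ q) {ε : ℝ} (hε : 0 < ε) :
    ∃ K : ℝ, 0 ≤ K ∧ ∀ᶠ n in atTop, (M n).P {ω | K * (M n).baseRate <
      maxNorm ((M n).sampleCov ω - (M n).Sigma)} ≤ ENNReal.ofReal ε := by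
  obtain ⟨K, hK⟩ := hM.sampleCov_rate ε hε
  refine ⟨max K 0, le_max_right _ _, ?_⟩
  filter_upwards [hK] with n hn
  refine (measure_mono fun ω hω => ?_).trans hn
  have := mul_le_mul_of_nonneg_right (le_max_left K 0) (baseRate_nonneg (M n))
  exact (lt_of_le_of_lt this hω).trans_le (le_abs_self _)

theorem opNorm_nonneg {m : Type*} [Fintype m] [DecidableEq m] (A : Matrix m m ℝ) : 0 ≤ opNorm A :=
  norm_nonneg _

theorem relFrobError_nonneg {m : Type*} [Fintype m] [DecidableEq m] (R S : Matrix m m ℝ) :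
    0 ≤ relFrobError R S :=
  mul_nonneg (inv_nonneg.2 (Real.sqrt_nonneg _)) (Real.sqrt_nonneg _)

/-- Bounds at one level in the operator norm and the relative Frobenius norm, when the sample
covariance matrix is close to `Σ` up to that level. -/
theorem boundedUpTo_of_eventually_opNorm_le {s : (n : ℕ) → (M n).Idx → (M n).Idx → ℝ → ℝ → ℝ}
    {τ : ℕ → ℝ} {C ε : ℝ}
    (h : ∀ᶠ n in atTop, ∀ ω,
      maxNorm ((M n).sampleCov ω - (M n).Sigma) ≤ K * (M n).baseRate → ∀ Su S,
      IsDoublePOET k (M n).r (s n) (τ n) ((M n).sampleCov ω) Su S →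
      opNorm (Su - (M n).SigmaU) ≤ C * opRate (M n) c a₁ a₂ q ∧
      opNorm (Su⁻¹ - (M n).SigmaU⁻¹) ≤ C * opRate (M n) c a₁ a₂ q ∧
      opNorm (S⁻¹ - (M n).Sigma⁻¹) ≤ C * opRate (M n) c a₁ a₂ q ∧
      relFrobError S (M n).Sigma ≤ C * relRate (M n) c a₁ a₂ q)
    (hP : ∀ᶠ n in atTop, (M n).P {ω | K * (M n).baseRate <
      maxNorm ((M n).sampleCov ω - (M n).Sigma)} ≤ ENNReal.ofReal ε)
    {Su S : (n : ℕ) → (M n).Ω → Matrix (M n).Idx (M n).Idx ℝ}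
    (hPOET : ∀ n ω, IsDoublePOET k (M n).r (s n) (τ n) ((M n).sampleCov ω) (Su n ω) (S n ω)) :
    BoundedUpTo M ε (fun n ω => opNorm (Su n ω - (M n).SigmaU))
        (fun n => opRate (M n) c a₁ a₂ q) ∧
    BoundedUpTo M ε (fun n ω => opNorm ((Su n ω)⁻¹ - (M n).SigmaU⁻¹))
        (fun n => opRate (M n) c a₁ a₂ q) ∧
    BoundedUpTo M ε (fun n ω => opNorm ((S n ω)⁻¹ - (M n).Sigma⁻¹))
        (fun n => opRate (M n) c a₁ a₂ q) ∧
    BoundedUpTo M ε (fun n ω => relFrobError (S n ω) (M n).Sigma)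
        (fun n => relRate (M n) c a₁ a₂ q) := by
  refine ⟨.of_forall_close hP (C := C) ?_, .of_forall_close hP (C := C) ?_,
    .of_forall_close hP (C := C) ?_, .of_forall_close hP (C := C) ?_⟩ <;>
  filter_upwards [h] with n hn ω hω
  · rw [abs_of_nonneg (opNorm_nonneg _)]
    exact (hn ω hω _ _ (hPOET n ω)).1
  · rw [abs_of_nonneg (opNorm_nonneg _)]
    exact (hn ω hω _ _ (hPOET n ω)).2.1
  · rw [abs_of_nonneg (opNorm_nonneg _)]
    exact (hn ω hω _ _ (hPOET n ω)).2.2.1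
  · rw [abs_of_nonneg (relFrobError_nonneg _ _)]
    exact (hn ω hω _ _ (hPOET n ω)).2.2.2

end Final

theorem theorem2 {k : ℕ} (M : ℕ → FactorModel k) (c a₁ a₂ q : ℝ)
    (hM : Assumptions M c a₁ a₂ q)
    (orthogonal : ∀ n, (M n).Bᵀ * (M n).Lam = 0)
    (hm : (fun n => sparsity q (M n).SigmaU) =o[atTop] fun n =>
      min (((M n).p : ℝ) ^ ((5 * a₁ - 3) / 2)) (((M n).p : ℝ) ^ (c * (5 * a₂ - 3) / 2)))
    (hrate : Tendsto (fun n => opRate (M n) c a₁ a₂ q) atTop (𝓝 0))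
    (s : (n : ℕ) → (M n).Idx → (M n).Idx → ℝ → ℝ → ℝ) (hs : ∀ n i j, IsShrinkage (s n i j)) :
    -- maximum norm, for every threshold of the order of the rate
    (∀ τ : ℕ → ℝ, SameOrder τ (fun n => omega₂ (M n) c a₁ a₂ q) →
      ∀ Su S : (n : ℕ) → (M n).Ω → Matrix (M n).Idx (M n).Idx ℝ,
      (∀ n ω, IsDoublePOET k (M n).r (s n) (τ n) ((M n).sampleCov ω) (Su n ω) (S n ω)) →
      IsBigOP M (fun n ω => maxNorm (Su n ω - (M n).SigmaU))
          (fun n => omega₂ (M n) c a₁ a₂ q) ∧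
      IsBigOP M (fun n ω => maxNorm (S n ω - (M n).Sigma))
          (fun n => omega₂ (M n) c a₁ a₂ q)) ∧
    -- the other norms, at every level `ε`, for every threshold of the order of the rate with a
    -- sufficiently large constant
    (∀ ε : ℝ, 0 < ε → ∃ C₀ : ℝ, 0 < C₀ ∧
      ∀ τ : ℕ → ℝ, SameOrder τ (fun n => omega₂ (M n) c a₁ a₂ q) →
      (∀ᶠ n in atTop, C₀ * omega₂ (M n) c a₁ a₂ q ≤ τ n) →
      ∀ Su S : (n : ℕ) → (M n).Ω → Matrix (M n).Idx (M n).Idx ℝ,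
      (∀ n ω, IsDoublePOET k (M n).r (s n) (τ n) ((M n).sampleCov ω) (Su n ω) (S n ω)) →
      BoundedUpTo M ε (fun n ω => opNorm (Su n ω - (M n).SigmaU))
          (fun n => opRate (M n) c a₁ a₂ q) ∧
      BoundedUpTo M ε (fun n ω => opNorm ((Su n ω)⁻¹ - (M n).SigmaU⁻¹))
          (fun n => opRate (M n) c a₁ a₂ q) ∧
      BoundedUpTo M ε (fun n ω => opNorm ((S n ω)⁻¹ - (M n).Sigma⁻¹))
          (fun n => opRate (M n) c a₁ a₂ q) ∧
      (3 / 4 < a₁ → 3 / 4 < a₂ →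
        BoundedUpTo M ε (fun n ω => relFrobError (S n ω) (M n).Sigma)
          (fun n => relRate (M n) c a₁ a₂ q))) ∧
    -- the constant can be chosen once for all levels `ε` as soon as the elementwise bound on the
    -- sample covariance matrix holds with one constant with probability tending to one
    ((∃ K : ℝ, Tendsto (fun n => (M n).P {ω | K * (M n).baseRate <
          maxNorm ((M n).sampleCov ω - (M n).Sigma)}) atTop (𝓝 0)) →
      ∃ C₀ : ℝ, 0 < C₀ ∧
      ∀ τ : ℕ → ℝ, SameOrder τ (fun n => omega₂ (M n) c a₁ a₂ q) →
      (∀ᶠ n in atTop, C₀ * omega₂ (M n) c a₁ a₂ q ≤ τ n) →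
      ∀ Su S : (n : ℕ) → (M n).Ω → Matrix (M n).Idx (M n).Idx ℝ,
      (∀ n ω, IsDoublePOET k (M n).r (s n) (τ n) ((M n).sampleCov ω) (Su n ω) (S n ω)) →
      IsBigOP M (fun n ω => opNorm (Su n ω - (M n).SigmaU))
          (fun n => opRate (M n) c a₁ a₂ q) ∧
      IsBigOP M (fun n ω => opNorm ((Su n ω)⁻¹ - (M n).SigmaU⁻¹))
          (fun n => opRate (M n) c a₁ a₂ q) ∧
      IsBigOP M (fun n ω => opNorm ((S n ω)⁻¹ - (M n).Sigma⁻¹))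
          (fun n => opRate (M n) c a₁ a₂ q) ∧
      (3 / 4 < a₁ → 3 / 4 < a₂ →
        IsBigOP M (fun n ω => relFrobError (S n ω) (M n).Sigma)
          (fun n => relRate (M n) c a₁ a₂ q))) := by
  refine ⟨fun τ hτ Su S hPOET => ⟨fun ε hε => ?_, fun ε hε => ?_⟩, fun ε hε => ?_, ?_⟩
  · obtain ⟨K, hK, hP⟩ := hM.exists_close hε
    obtain ⟨C, hC⟩ := hM.eventually_maxNorm_le orthogonal hrate hs hK hτ
    refine .of_forall_close hP (C := C) ?_
    filter_upwards [hC] with n hn ω hω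
    rw [abs_of_nonneg (maxNorm_nonneg _)]
    exact (hn ω hω _ _ (hPOET n ω)).1
  · obtain ⟨K, hK, hP⟩ := hM.exists_close hε
    obtain ⟨C, hC⟩ := hM.eventually_maxNorm_le orthogonal hrate hs hK hτ
    refine .of_forall_close hP (C := C) ?_
    filter_upwards [hC] with n hn ω hω
    rw [abs_of_nonneg (maxNorm_nonneg _)]
    exact (hn ω hω _ _ (hPOET n ω)).2
  · obtain ⟨K, hK, hP⟩ := hM.exists_close hε
    obtain ⟨C₀, hC₀, h⟩ := hM.eventually_opNorm_le orthogonal hrate hs hK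
    refine ⟨C₀, hC₀, fun τ hτ hτC₀ Su S hPOET => ?_⟩
    obtain ⟨C, hC⟩ := h τ hτ hτC₀
    obtain ⟨r₁, r₂, r₃, r₄⟩ := boundedUpTo_of_eventually_opNorm_le hC hP hPOET
    exact ⟨r₁, r₂, r₃, fun _ _ => r₄⟩
  · rintro ⟨K, hK⟩
    obtain ⟨C₀, hC₀, h⟩ := hM.eventually_opNorm_le orthogonal hrate hs (le_max_right K 0)
    refine ⟨C₀, hC₀, fun τ hτ hτC₀ Su S hPOET => ?_⟩
    obtain ⟨C, hC⟩ := h τ hτ hτC₀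
    have hP : ∀ ε : ℝ, 0 < ε → ∀ᶠ n in atTop, (M n).P {ω | max K 0 * (M n).baseRate <
        maxNorm ((M n).sampleCov ω - (M n).Sigma)} ≤ ENNReal.ofReal ε := fun ε hε => by
      filter_upwards [hK.eventually_le_const (ENNReal.ofReal_pos.2 hε)] with n hn
      refine (measure_mono fun ω hω => ?_).trans hn
      exact (mul_le_mul_of_nonneg_right (le_max_left K 0) (baseRate_nonneg (M n))).trans_lt hω
    have r := fun ε hε => boundedUpTo_of_eventually_opNorm_le hC (hP ε hε) hPOET
    exact ⟨fun ε hε => (r ε hε).1, fun ε hε => (r ε hε).2.1, fun ε hε => (r ε hε).2.2.1,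
      fun _ _ ε hε => (r ε hε).2.2.2⟩
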